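/- **Setting.** Let $m\ge 2$. Let $L(k)$, $k\in\mathbb R^d$, be Hermitian $2J\times 2J$ matrices with eigenvalues $\omega_{n,\zeta}(k)$ and unit eigenvectors $g_{n,\zeta}(k)$, $n=1,\dots,J$, $\zeta=\pm$; let $\Pi_{n,\zeta}(k)$ be the orthogonal projection onto $\mathbb C g_{n,\zeta}(k)$, and $\omega_n=\omega_{n,+}$. Let $\sigma_{bc}$ be the set of the $k$ at which $L$ is discontinuous, or $\omega_{n+1,\zeta}(k)=\omega_{n,\zeta}(k)$ for some $n,\zeta$, or $\omega_{1,+}(k)=0$ or $\omega_{1,-}(k)=0$. Assume that $\sigma_{bc}$ is closed, nowhere dense and Lebesgue-null; that for $k\notin\sigma_{bc}$ one has $\omega_{J,+}\ge\dots\ge\omega_{1,+}\ge0\ge\omega_{1,-}\ge\dots\ge\omega_{J,-}$ and $\omega_{n,-\zeta}(-k)=-\omega_{n,\zeta}(k)$; that $L$ is $C^\infty$ off $\sigma_{bc}$; and that $\|L(k)\|\le C(1+|k|^p)$ for some $C,p>0$. Let $F$ be the homogeneous nonlinearity of degree $m$ given in Fourier form by $$\hat F(\hat U)(k)=(2\pi)^{-(m-1)d}\int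 \chi(k,k',\dots,k^{(m)})\,[\hat U(k'),\dots,\hat U(k^{(m)})]\,dk'\cdots dk^{(m-1)},\qquad k^{(m)}=k-k'-\dots-k^{(m-1)},$$ where the $m$-linear tensor $\chi$ is $C^\infty$ when none of its arguments is in $\sigma_{bc}$, and $(2\pi)^{-(m-1)d}|\chi|\le C_\chi$ there. **Wavepackets.** Fix $0<\epsilon<1$ and $s>0$. A family $\hat h(\beta,\cdot)\in L^1(\mathbb R^d;\mathbb C^{2J})$ is a *wavepacket* with $nk$-pair $(n,k_*)$, regularity degree $s$ and localization parameter $\epsilon$ if for some $\beta_0>0$ and all $0<\beta<\beta_0$: $\|\hat h(\beta)\|_{L^1}\le C$ and $\hat h=\hat h_-+\hat h_++\hat D$, where $\hat h_\zeta(\beta,k)=\mathbf 1_{\{|k-\zeta k_*|\le\beta^{1-\epsilon}\}}\Pi_{n,\zeta}(k)\hat h_\zeta(\beta,k)$ and $\|\hat D(\beta)\|_{L^1}\le C'\beta^s$, with $C,C'$ independent of $\beta$. For a finite set $S=\{(n_l,k_{*l})\}_{l=1}^N$ of distinct pairs, a *multi-wavepacket* with $nk$-spectrum $S$ is a sum of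 $N$ wavepackets with $nk$-pairs $(n_l,k_{*l})$, all with the given $s$ and $\epsilon$. **Resonance invariance.** Assume that no $k_{*l}$ and no $\varkappa=\sum_{j=1}^m\zeta_jk_{*l_j}$ ($\zeta_j=\pm1$, $1\le l_j\le N$) is in $\sigma_{bc}$, and that $S$ is resonance invariant: whenever $\zeta=\pm1$, $1\le n\le J$ and $-\zeta\omega_n(\zeta\varkappa)+\sum_{j=1}^m\zeta_j\omega_{n_{l_j}}(k_{*l_j})=0$, one has $(n,\zeta\varkappa)\in S$. **Solutions.** A solution (F-solution) of $$\partial_tV=-\mathrm iL(-\mathrm i\nabla)V+F(V),\qquad V|_{t=0}=\varrho^{1/(m-1)}h,$$ on $[0,T]$ is a function $V$ whose Fourier transform is $\hat V(t)=e^{-\mathrm itL}\hat u(t)$ with $\hat u\in C([0,T],L^1)$ and $\hat u(t)=\varrho^{1/(m-1)}\hat h+\int_0^te^{\mathrm it'L}\hat F(e^{-\mathrm it'L}\hat u(t'))\,dt'$. **Claim.** For every $R$ there is $\tau_*>0$, depending only on $R$, $C_\chi$, $m$, $d$, $J$, such that the following holds. Let $\hat h(\beta)$ be a multi-wavepacket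 with such an $nk$-spectrum $S$, regularity degree $s$ and localization parameter $\epsilon$, with $\|\hat h(\beta)\|_{L^1}\le R$ for small $\beta$; let $0<\rho(\beta)\le C\beta^s$ for small $\beta$, and put $\varrho=\rho(\beta)$. Then for all small $\beta$ a solution exists on $[0,\tau_*/\varrho]$; and for any solutions $V=V_\beta$ and all times $t=t(\beta)\in[0,\tau_*/\varrho]$ the family $\varrho^{-1/(m-1)}\hat V(t)$ is a multi-wavepacket with the same $nk$-spectrum $S$ and the same regularity degree $s$, for every localization parameter $\epsilon'\in(\epsilon,1)$. -/

import Mathlib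

open MeasureTheory Filter Topology Set


noncomputable section

/-- Wavevectors (and positions): `ℝ^d` with its Euclidean norm. -/
abbrev Wave (d : ℕ) := EuclideanSpace ℝ (Fin d)

/-- The state space `ℂ^{2J}` with its Euclidean norm. -/
abbrev Vec (J : ℕ) := EuclideanSpace ℂ (Fin (2 * J))

/-- `L¹(ℝ^d; ℂ^{2J})`, the space of the Fourier transforms. -/
abbrev Spec (d J : ℕ) := Lp (Vec J) 1 (volume : Measure (Wave d))

/-- The sign `ζ = ±1` as a real number. -/
def sg (ζ : ℤˣ) : ℝ := ((ζ : ℤ) : ℝ)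

/-! ### Linear part -/

/-- The symbol `L(k)` (a `2J × 2J` matrix, seen as an operator of `ℂ^{2J}`), with its eigenvalues
`ω_{n,ζ}(k)` and eigenvectors `g_{n,ζ}(k)`; the band number `n = 1, …, J` is `Fin J` shifted
by one, and `ζ = ±` is `ℤˣ`. The laws are in `LinearPart.Admissible`. -/
structure LinearPart (d J : ℕ) where
  L : Wave d → (Vec J →L[ℂ] Vec J)
  ω : Fin J → ℤˣ → Wave d → ℝ
  g : Fin J → ℤˣ → Wave d → Vec J

namespace LinearPart

variable {d J : ℕ}

/-- Band-crossing points: two consecutive eigenvalues of the same sign coincide, or `L` is not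
continuous, or one of the two eigenvalues of the first band vanishes. -/
def bandCrossing (A : LinearPart d J) : Set (Wave d) :=
  {k | (∃ (n n' : Fin J) (ζ : ℤˣ), n'.val = n.val + 1 ∧ A.ω n' ζ k = A.ω n ζ k) ∨
    ¬ ContinuousAt A.L k ∨
    (∃ (n : Fin J) (ζ : ℤˣ), n.val = 0 ∧ A.ω n ζ k = 0)}

/-- The conditions on the linear part. -/
structure Admissible (A : LinearPart d J) : Prop where
  hermitian : ∀ k, IsSelfAdjoint (A.L k)
  eigen : ∀ k ∉ A.bandCrossing, ∀ n ζ, A.L k (A.g n ζ k) = (A.ω n ζ k : ℂ) • A.g n ζ k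
  unit : ∀ k ∉ A.bandCrossing, ∀ n ζ, ‖A.g n ζ k‖ = 1
  nonneg : ∀ k ∉ A.bandCrossing, ∀ n, 0 ≤ A.ω n 1 k
  nonpos : ∀ k ∉ A.bandCrossing, ∀ n, A.ω n (-1) k ≤ 0
  order_pos : ∀ k ∉ A.bandCrossing, ∀ n n', n ≤ n' → A.ω n 1 k ≤ A.ω n' 1 k
  order_neg : ∀ k ∉ A.bandCrossing, ∀ n n', n ≤ n' → A.ω n' (-1) k ≤ A.ω n (-1) k
  symm : ∀ k ∉ A.bandCrossing, ∀ n ζ, A.ω n (-ζ) (-k) = -A.ω n ζ k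
  closed : IsClosed A.bandCrossing
  nowhereDense : IsNowhereDense A.bandCrossing
  null : volume A.bandCrossing = 0
  smooth : ContDiffOn ℝ ((⊤ : ℕ∞) : WithTop ℕ∞) A.L A.bandCrossingᶜ
  bound : ∃ C > (0 : ℝ), ∃ p > (0 : ℝ), ∀ k, ‖A.L k‖ ≤ C * (1 + ‖k‖ ^ p)

/-- `Π_{n,ζ}(k)`: the orthogonal projection onto the line spanned by the unit vector
`g_{n,ζ}(k)`. -/
def proj (A : LinearPart d J) (n : Fin J) (ζ : ℤˣ) (k : Wave d) (x : Vec J) : Vec J :=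
  inner ℂ (A.g n ζ k) x • A.g n ζ k

end LinearPart

/-! ### Nonlinear part -/

/-- A susceptibility of degree `m`: an `m`-linear tensor `χ(k, k', …, k^{(m)})`. -/
abbrev Susceptibility (d J m : ℕ) :=
  Wave d → (Fin m → Wave d) → ContinuousMultilinearMap ℂ (fun _ : Fin m => Vec J) (Vec J)

/-- The conditions on the susceptibility: smooth away from the band-crossing points, and bounded
there by the constant `C`. -/
structure Susceptibility.Admissible {d J m : ℕ} (χ : Susceptibility d J m) (A : LinearPart d J)
    (C : ℝ) : Prop where
  smooth : ContDiffOn ℝ ((⊤ : ℕ∞) : WithTop ℕ∞) (fun q : Wave d × (Fin m → Wave d) => χ q.1 q.2)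
    {q | q.1 ∉ A.bandCrossing ∧ ∀ j, q.2 j ∉ A.bandCrossing}
  bound : ∀ k κ, k ∉ A.bandCrossing → (∀ j, κ j ∉ A.bandCrossing) →
    ((2 * Real.pi) ^ ((m - 1) * d))⁻¹ * ‖χ k κ‖ ≤ C

open Classical in
/-- The class in `L¹` of an integrable function. (It is only applied to functions that are
integrable under the standing conditions.) -/
def asL1 {d J : ℕ} (f : Wave d → Vec J) : Spec d J :=
  if hf : Integrable f volume then hf.toL1 f else 0

/-- The wavevectors `(k', …, k^{(m-1)}, k^{(m)})` with `k^{(m)} = k - k' - … - k^{(m-1)}`. -/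
def convVec {d : ℕ} (m : ℕ) (k : Wave d) (κ : Fin (m - 1) → Wave d) (j : Fin m) : Wave d :=
  if hj : j.val < m - 1 then κ ⟨j.val, hj⟩ else k - ∑ i, κ i

/-- The homogeneous nonlinearity of degree `m` in Fourier form,
`F̂(Û)(k) = (2π)^{-(m-1)d} ∫ χ(k, k', …, k^{(m)}) Û(k') ⋯ Û(k^{(m)}) dk' ⋯ dk^{(m-1)}`. -/
def nonlin {d J m : ℕ} (χ : Susceptibility d J m) (U : Spec d J) : Spec d J :=
  asL1 fun k => ((2 * Real.pi) ^ ((m - 1) * d))⁻¹ •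
    ∫ κ : Fin (m - 1) → Wave d, χ k (convVec m k κ) (fun j => U (convVec m k κ j))

/-- The unitary group `e^{-itL}`, acting in `L¹` as multiplication by `e^{-itL(k)}`. -/
def propagator {d J : ℕ} (A : LinearPart d J) (t : ℝ) (f : Spec d J) : Spec d J :=
  asL1 fun k => NormedSpace.exp ((-(Complex.I * (t : ℂ))) • A.L k) (f k)

/-- `V`, with Fourier transform `V̂(t) ∈ L¹`, is an F-solution on `[0, T]` of
`∂_t V = -i L(-i∇) V + F(V)` whose initial value has Fourier transform `ĥ₀`: the slow variable
`û(t) = e^{itL} V̂(t)` lies in `C([0, T], L¹)` and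
`û(t) = ĥ₀ + ∫₀ᵗ e^{it'L} F̂(e^{-it'L} û(t')) dt'`. -/
def IsFSolution {d J m : ℕ} (A : LinearPart d J) (χ : Susceptibility d J m) (T : ℝ)
    (h₀ : Spec d J) (V : ℝ → Wave d → Vec J) (Vhat : ℝ → Spec d J) : Prop :=
  (∀ t ∈ Icc 0 T, ∀ r, V t r = ((2 * Real.pi) ^ d)⁻¹ •
    ∫ k, Complex.exp (Complex.I * ((inner ℝ r k : ℝ) : ℂ)) • Vhat t k) ∧
  ∃ u : ℝ → Spec d J, ContinuousOn u (Icc 0 T) ∧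
    (∀ t ∈ Icc 0 T, Vhat t = propagator A t (u t)) ∧
    (∀ t ∈ Icc 0 T,
      u t = h₀ + ∫ t' in (0 : ℝ)..t, propagator A (-t') (nonlin χ (propagator A t' (u t'))))

/-! ### Wavepackets -/

open Classical in
/-- The cutoff function `Ψ`: the indicator function of the closed unit ball. -/
def cutoff {d : ℕ} (η : Wave d) : ℝ := if ‖η‖ ≤ 1 then 1 else 0

/-- A wavepacket with `nk`-pair `(n, k_*)`, degree of regularity `s` and localization
exponent `ε`. -/
def IsWavepacket {d J : ℕ} (A : LinearPart d J) (ε s : ℝ) (n : Fin J) (kstar : Wave d)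
    (h : ℝ → Spec d J) : Prop :=
  ∃ β₀ > (0 : ℝ),
    (∃ C > (0 : ℝ), ∀ β ∈ Ioo 0 β₀, ‖h β‖ ≤ C) ∧
    ∃ (hs : ℤˣ → ℝ → Spec d J) (D : ℝ → Spec d J),
      (∀ β ∈ Ioo 0 β₀, h β = hs (-1) β + hs 1 β + D β) ∧
      (∀ β ∈ Ioo 0 β₀, ∀ ζ : ℤˣ, ∀ᵐ k ∂(volume : Measure (Wave d)),
        hs ζ β k = cutoff (β ^ (-(1 - ε)) • (k - sg ζ • kstar)) • A.proj n ζ k (hs ζ β k)) ∧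
      ∃ C' > (0 : ℝ), ∀ β ∈ Ioo 0 β₀, ‖D β‖ ≤ C' * β ^ s

/-- A multi-wavepacket with `nk`-spectrum `S`. -/
def IsMultiWavepacket {d J : ℕ} (A : LinearPart d J) (ε s : ℝ) (S : Finset (Fin J × Wave d))
    (h : ℝ → Spec d J) : Prop :=
  ∃ hl : Fin J × Wave d → ℝ → Spec d J,
    (∀ p ∈ S, IsWavepacket A ε s p.1 p.2 (hl p)) ∧
    ∃ β₀ > (0 : ℝ), ∀ β ∈ Ioo 0 β₀, h β = ∑ p ∈ S, hl p β

/-! ### Resonance invariance (for a homogeneous nonlinearity of degree `m`) -/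

/-- `ϰ_m = Σ_j ζ_j k_{*l_j}` for a string of signs and a string of `nk`-pairs. -/
def kappa {d J m : ℕ} (ζs : Fin m → ℤˣ) (p : Fin m → Fin J × Wave d) : Wave d :=
  ∑ j, sg (ζs j) • (p j).2

/-- The output `k`-spectrum of `S`. -/
def outK {d J : ℕ} (m : ℕ) (S : Finset (Fin J × Wave d)) : Set (Wave d) :=
  {k | ∃ (ζs : Fin m → ℤˣ) (p : Fin m → Fin J × Wave d), (∀ j, p j ∈ S) ∧ k = kappa ζs p}

/-- The resonant output spectrum of `S`: the pairs `(n, ζ ϰ_m)` in the output `nk`-spectrum for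
which the resonance equation `-ζ ω_n(ζ ϰ_m) + Σ_j ζ_j ω_{n_{l_j}}(k_{*l_j}) = 0` holds,
where `ω_n = ω_{n,+}`. -/
def outRes {d J : ℕ} (A : LinearPart d J) (m : ℕ) (S : Finset (Fin J × Wave d)) :
    Set (Fin J × Wave d) :=
  {q | q.2 ∈ outK m S ∧
    ∃ (ζ : ℤˣ) (ζs : Fin m → ℤˣ) (p : Fin m → Fin J × Wave d), (∀ j, p j ∈ S) ∧
      q.2 = sg ζ • kappa ζs p ∧
      -(sg ζ * A.ω q.1 1 (sg ζ • kappa ζs p)) + ∑ j, sg (ζs j) * A.ω (p j).1 1 (p j).2 = 0}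

/-- `S` is resonance invariant: `R(S) = S ∪ [S]_out^res` equals `S`. -/
def ResonanceInvariant {d J : ℕ} (A : LinearPart d J) (m : ℕ) (S : Finset (Fin J × Wave d)) :
    Prop :=
  (S : Set (Fin J × Wave d)) ∪ outRes A m S = S

end

set_option linter.unusedSectionVars false

noncomputable section

/-! ### Differential equations with a power-type nonlinearity -/

/-! In the slow variable, divided by ϱ^{1/(m-1)}, the equation reads v = h + ρ ∫ N(t', v) with N
homogeneous of degree m. N comes from an m-linear operator on L¹ whose norm is bounded uniformly in
time: the flow is unitary, and integration over wavevectors with a given sum is a convolution.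
Picard iteration and Gronwall therefore give existence and uniqueness up to times τ/ρ
(`exists_bounded_slow`, `IsPowerField.eq_of_integral_eq`). The real issue is that the spectrum stays
concentrated.

The solution is compared with a closed system of packets, one for each pair in S and each sign ζ,
with center ζk_* and band (n, ζ). The system keeps every interaction whose centers add up to the
center of a packet; the output is projected onto the band of that packet and cut off to a fixed ball
of radius δ. The unknown of a packet with center c carries a weight W(k - c), an exponential
truncated at height β^{-s}. Since W is submultiplicative and centers add up, the weights of inputs
and output cancel, and the weighted system is bounded by 2JC, whatever β, W and the number of
packets (`PacketFamily.norm_systemKernel_le`). With rate β^{-(1-ε)}, the weight is at most 3 on the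
initial balls of radius β^{1-ε} and has height β^{-s} beyond radius β^{1-ε'}. A bounded weighted
norm thus leaves only O(β^s) outside of the larger balls; this is why ε' > ε is needed.

Inserting the collected packets into the full equation leaves two errors
(`PacketFamily.interactionKernel_comp_collect`). Output in the band of a packet but outside of its
δ-ball is O(β^s), again by the weight. Output whose center and band belong to no packet oscillates:
resonance invariance says that its phase does not vanish at the centers, and continuity of the
eigenvalues (`LinearPart.continuousAt_ev`) keeps it away from zero on small balls
(`ResonanceInvariant.exists_packetFamily`). Hence this part is the explicit time derivative of a
bounded expression P, and adding ρP to the collected packets removes it up to a relative error O(ρ)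
(`norm_sub_le_of_normalForm`). Gronwall over a time τ/ρ yields a total error O(ρ + β^s), which is
O(β^s) because ρ ≤ Cβ^s. -/

theorem gronwallBound_le {δ K ε x : ℝ} (hK : 0 ≤ K) (hε : 0 ≤ ε) :
    gronwallBound δ K ε x ≤ (δ + ε * x) * Real.exp (K * x) := by
  rcases hK.eq_or_lt with rfl | hK
  · simp [gronwallBound_K0]
  · rw [gronwallBound_of_K_ne_0 hK.ne']
    have h1 : Real.exp (K * x) - 1 ≤ K * x * Real.exp (K * x) := by
      have := Real.add_one_le_exp (-(K * x))
      have h2 : Real.exp (K * x) * Real.exp (-(K * x)) = 1 := by rw [← Real.exp_add]; simp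
      nlinarith [Real.exp_pos (K * x)]
    calc δ * Real.exp (K * x) + ε / K * (Real.exp (K * x) - 1)
        ≤ δ * Real.exp (K * x) + ε / K * (K * x * Real.exp (K * x)) := by gcongr
      _ = _ := by field_simp

/-- A time-dependent vector field with the bounds of a homogeneous polynomial of degree `m`. -/
structure IsPowerField {E : Type*} [NormedAddCommGroup E] (N : ℝ → E → E) (C : ℝ) (m : ℕ) :
    Prop where
  nonneg : 0 ≤ C
  norm_le : ∀ t x, ‖N t x‖ ≤ C * ‖x‖ ^ m
  norm_sub_le : ∀ t x y, ‖N t x - N t y‖ ≤ C * m * max ‖x‖ ‖y‖ ^ (m - 1) * ‖x - y‖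
  continuous_time : ∀ x, Continuous fun t => N t x

namespace IsPowerField

variable {E : Type*} [NormedAddCommGroup E] {N : ℝ → E → E} {C : ℝ} {m : ℕ}

theorem norm_sub_le_of_le (hN : IsPowerField N C m) {M : ℝ} {x y : E} (hx : ‖x‖ ≤ M)
    (hy : ‖y‖ ≤ M) (t : ℝ) : ‖N t x - N t y‖ ≤ C * m * M ^ (m - 1) * ‖x - y‖ := by
  have := hN.nonneg
  refine (hN.norm_sub_le t x y).trans ?_
  gcongr
  exact max_le hx hy

/-- Time continuity is assumed for each fixed state only, because the flow of an unbounded symbol is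
merely strongly continuous; the local Lipschitz bound, uniform in time, upgrades it to joint
continuity. -/
theorem continuous_uncurry (hN : IsPowerField N C m) :
    Continuous fun p : ℝ × E => N p.1 p.2 := by
  rw [continuous_iff_continuousAt]
  rintro ⟨t, x⟩
  have h1 : Tendsto (fun p : ℝ × E => N p.1 x) (𝓝 (t, x)) (𝓝 (N t x)) :=
    ((hN.continuous_time x).comp continuous_fst).tendsto (t, x)
  have h2 : Tendsto (fun p : ℝ × E => N p.1 p.2 - N p.1 x) (𝓝 (t, x)) (𝓝 0) := by
    have hb : Tendsto (fun p : ℝ × E => C * m * max ‖p.2‖ ‖x‖ ^ (m - 1) * ‖p.2 - x‖)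
        (𝓝 (t, x)) (𝓝 0) := by
      have : Continuous fun p : ℝ × E => C * m * max ‖p.2‖ ‖x‖ ^ (m - 1) * ‖p.2 - x‖ := by
        fun_prop
      simpa using this.tendsto (t, x)
    exact squeeze_zero_norm (fun p => hN.norm_sub_le p.1 p.2 x) hb
  simpa [ContinuousAt] using h2.add h1

theorem continuousOn_comp (hN : IsPowerField N C m) {v : ℝ → E} {s : Set ℝ}
    (hv : ContinuousOn v s) : ContinuousOn (fun t => N t (v t)) s :=
  hN.continuous_uncurry.comp_continuousOn (continuousOn_id.prodMk hv)

variable [NormedSpace ℝ E]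

/-- A bounded solution exists as long as `ρ T C (r + 1)^m ≤ 1`. -/
theorem exists_solution [CompleteSpace E] (hN : IsPowerField N C m) {ρ T r : ℝ} (hρ : 0 ≤ ρ)
    (hT : 0 ≤ T) (hr : 0 ≤ r) (hsmall : ρ * T * (C * (r + 1) ^ m) ≤ 1) {x₀ : E} (hx₀ : ‖x₀‖ ≤ r) :
    ∃ v : ℝ → E, v 0 = x₀ ∧ ContinuousOn v (Icc 0 T) ∧ (∀ t ∈ Icc 0 T, ‖v t‖ ≤ r + 1) ∧
      ∀ t ∈ Icc 0 T, v t = x₀ + ρ • ∫ t' in (0 : ℝ)..t, N t' (v t') := by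
  have hC := hN.nonneg
  have hball : ∀ x ∈ Metric.closedBall x₀ ((1 : NNReal) : ℝ), ‖x‖ ≤ r + 1 := by
    intro x hx
    rw [mem_closedBall_iff_norm] at hx
    have := norm_sub_norm_le x x₀
    simp only [NNReal.coe_one] at hx
    linarith
  -- On the unit ball around `x₀` the field has speed at most `L` and Lipschitz constant `K`. Only
  -- `L` is restricted: the solution must not leave the unit ball before time `T`.
  obtain ⟨L, hL⟩ : ∃ L : NNReal, (L : ℝ) = ρ * (C * (r + 1) ^ m) := ⟨⟨_, by positivity⟩, rfl⟩
  obtain ⟨K, hK⟩ : ∃ K : NNReal, (K : ℝ) = ρ * (C * m * (r + 1) ^ (m - 1)) :=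
    ⟨⟨_, by positivity⟩, rfl⟩
  have h0T : (0 : ℝ) ∈ Icc 0 T := ⟨le_refl 0, hT⟩
  have hPL : IsPicardLindelof (fun t x => ρ • N t x) (⟨0, h0T⟩ : Icc (0 : ℝ) T) x₀ 1 0
      L K := by
    refine ⟨fun t _ => ?_, fun x _ => ?_, fun t _ x hx => ?_, ?_⟩
    · refine LipschitzOnWith.of_dist_le_mul fun x hx y hy => ?_
      rw [dist_eq_norm, dist_eq_norm, ← smul_sub, norm_smul, Real.norm_of_nonneg hρ]
      rw [hK, mul_assoc ρ]
      gcongr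
      exact hN.norm_sub_le_of_le (hball x hx) (hball y hy) t
    · exact ((hN.continuous_time x).const_smul ρ).continuousOn
    · rw [norm_smul, Real.norm_of_nonneg hρ]
      rw [hL]
      gcongr
      refine (hN.norm_le t x).trans ?_
      gcongr
      exact hball x hx
    · change (L : ℝ) * max (T - 0) (0 - 0) ≤ 1 - 0
      rw [hL, sub_zero, sub_zero, sub_zero, max_eq_left hT]
      linarith
  have hx : x₀ ∈ Metric.closedBall x₀ ((0 : NNReal) : ℝ) := by simp
  obtain ⟨α, hα⟩ := ODE.FunSpace.exists_isFixedPt_next hPL hx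
  have hsol : ∀ t ∈ Icc 0 T,
      α.compProj t = x₀ + ∫ t' in (0 : ℝ)..t, ρ • N t' (α.compProj t') := by
    intro t ht
    conv_lhs => rw [← show ODE.FunSpace.next hPL hx α = α from hα]
    rw [ODE.FunSpace.compProj_apply, ODE.FunSpace.next_apply, projIcc_of_mem _ ht]
    rfl
  refine ⟨α.compProj, ?_, α.continuous_compProj.continuousOn, fun t ht => ?_, fun t ht => ?_⟩
  · simpa using hsol 0 ⟨le_refl 0, hT⟩
  · exact hball _ (α.compProj_mem_closedBall hPL.mul_max_le)
  · rw [hsol t ht, intervalIntegral.integral_smul]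

/-- The integral equation implies the differential equation. -/
theorem hasDerivWithinAt_of_integral_eq [CompleteSpace E] (hN : IsPowerField N C m) {ρ T : ℝ}
    {x₀ : E} {v : ℝ → E} (hv : ContinuousOn v (Icc 0 T))
    (hint : ∀ t ∈ Icc 0 T, v t = x₀ + ρ • ∫ t' in (0 : ℝ)..t, N t' (v t')) :
    ∀ t ∈ Ico 0 T, HasDerivWithinAt v (ρ • N t (v t)) (Ici t) t := by
  intro t ht
  have hT : 0 < T := ht.1.trans_lt ht.2
  have hcont := hN.continuousOn_comp hv
  have h1 : HasDerivWithinAt (fun u => ∫ t' in (0 : ℝ)..u, N t' (v t')) (N t (v t)) (Icc t T) t := by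
    have : Fact (t ∈ Icc 0 T) := ⟨⟨ht.1, ht.2.le⟩⟩
    have := intervalIntegral.integral_hasDerivWithinAt_right (s := Icc 0 T) (t := Icc 0 T)
      (f := fun t' => N t' (v t')) (a := 0) (b := t) ?_ ?_ ?_
    · exact this.mono (Icc_subset_Icc_left ht.1)
    · refine (hcont.mono ?_).intervalIntegrable
      rw [uIcc_of_le ht.1]
      exact Icc_subset_Icc_right ht.2.le
    · exact hcont.stronglyMeasurableAtFilter_nhdsWithin measurableSet_Icc t
    · exact hcont t ⟨ht.1, ht.2.le⟩
  have h2 : HasDerivWithinAt v (ρ • N t (v t)) (Icc t T) t := by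
    refine ((h1.const_smul ρ).const_add x₀).congr (fun u hu => ?_) ?_
    · exact hint u ⟨ht.1.trans hu.1, hu.2⟩
    · exact hint t ⟨ht.1, ht.2.le⟩
  exact h2.mono_of_mem_nhdsWithin (Icc_mem_nhdsGE ht.2)

/-- Two approximate solutions in a ball stay close. -/
theorem norm_sub_le_of_approx (hN : IsPowerField N C m) {ρ T M δ ε : ℝ} (hρ : 0 ≤ ρ)
    (hM : 0 ≤ M) (hδ : 0 ≤ δ) (hε : 0 ≤ ε) {v z z' : ℝ → E}
    (hv : ContinuousOn v (Icc 0 T)) (hz : ContinuousOn z (Icc 0 T))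
    (hv' : ∀ t ∈ Ico 0 T, HasDerivWithinAt v (ρ • N t (v t)) (Ici t) t)
    (hz' : ∀ t ∈ Ico 0 T, HasDerivWithinAt z (z' t) (Ici t) t)
    (hvM : ∀ t ∈ Icc 0 T, ‖v t‖ ≤ M) (hzM : ∀ t ∈ Icc 0 T, ‖z t‖ ≤ M)
    (happ : ∀ t ∈ Ico 0 T, ‖z' t - ρ • N t (z t)‖ ≤ ε) (h0 : ‖v 0 - z 0‖ ≤ δ) :
    ∀ t ∈ Icc 0 T,
      ‖v t - z t‖ ≤ (δ + ε * T) * Real.exp (ρ * T * (C * m * M ^ (m - 1))) := by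
  intro t ht
  have hC := hN.nonneg
  have key := norm_le_gronwallBound_of_norm_deriv_right_le
    (f := fun t => v t - z t) (f' := fun t => ρ • N t (v t) - z' t)
    (K := ρ * (C * m * M ^ (m - 1))) (ε := ε) (hv.sub hz)
    (fun t ht => (hv' t ht).sub (hz' t ht)) h0 (fun t ht => ?_) t ht
  · have hK : 0 ≤ ρ * (C * m * M ^ (m - 1)) := by positivity
    rw [sub_zero] at key
    refine key.trans ((gronwallBound_le hK hε).trans ?_)
    have h1 : ρ * (C * m * M ^ (m - 1)) * t ≤ ρ * T * (C * m * M ^ (m - 1)) := by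
      calc ρ * (C * m * M ^ (m - 1)) * t ≤ ρ * (C * m * M ^ (m - 1)) * T := by
            gcongr; exact ht.2
        _ = _ := by ring
    have h2 := ht.2
    have h3 := ht.1.trans ht.2
    gcongr
  · have ht' : t ∈ Icc 0 T := ⟨ht.1, ht.2.le⟩
    calc ‖ρ • N t (v t) - z' t‖
        = ‖ρ • (N t (v t) - N t (z t)) - (z' t - ρ • N t (z t))‖ := by
          congr 1; rw [smul_sub]; abel
      _ ≤ ‖ρ • (N t (v t) - N t (z t))‖ + ‖z' t - ρ • N t (z t)‖ := _root_.norm_sub_le _ _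
      _ ≤ ρ * (C * m * M ^ (m - 1) * ‖v t - z t‖) + ε := by
          rw [norm_smul, Real.norm_of_nonneg hρ]
          gcongr
          · exact hN.norm_sub_le_of_le (hvM t ht') (hzM t ht') t
          · exact happ t ht
      _ = _ := by ring

/-- Continuous solutions of the integral equation are unique. -/
theorem eq_of_integral_eq [CompleteSpace E] (hN : IsPowerField N C m) {ρ T : ℝ} (hρ : 0 ≤ ρ)
    {x₀ : E} {v w : ℝ → E} (hv : ContinuousOn v (Icc 0 T)) (hw : ContinuousOn w (Icc 0 T))
    (hvi : ∀ t ∈ Icc 0 T, v t = x₀ + ρ • ∫ t' in (0 : ℝ)..t, N t' (v t'))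
    (hwi : ∀ t ∈ Icc 0 T, w t = x₀ + ρ • ∫ t' in (0 : ℝ)..t, N t' (w t')) :
    ∀ t ∈ Icc 0 T, v t = w t := by
  intro t ht
  obtain ⟨M₁, hM₁⟩ := isCompact_Icc.exists_bound_of_continuousOn hv
  obtain ⟨M₂, hM₂⟩ := isCompact_Icc.exists_bound_of_continuousOn hw
  have h0 : (0 : ℝ) ∈ Icc 0 T := ⟨le_refl 0, ht.1.trans ht.2⟩
  -- No a priori bound is needed: continuity on a compact interval bounds both solutions, and the
  -- approximation estimate with zero errors applies in that ball.
  have hM : 0 ≤ max M₁ M₂ := (norm_nonneg _).trans ((hM₁ 0 h0).trans (le_max_left _ _))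
  have := hN.norm_sub_le_of_approx hρ hM le_rfl le_rfl hv hw
    (hN.hasDerivWithinAt_of_integral_eq hv hvi) (hN.hasDerivWithinAt_of_integral_eq hw hwi)
    (fun t ht => (hM₁ t ht).trans (le_max_left _ _))
    (fun t ht => (hM₂ t ht).trans (le_max_right _ _)) (by simp)
    (by rw [hvi 0 h0, hwi 0 h0]; simp) t ht
  simp only [zero_mul, add_zero] at this
  exact sub_eq_zero.1 (norm_le_zero_iff.1 this)

end IsPowerField

/-! ### Multilinear fields: power bounds and the product rule -/

section Multilinear

variable {E G : Type*} [NormedAddCommGroup E] [NormedSpace ℂ E] [NormedAddCommGroup G]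
  [NormedSpace ℂ G]

theorem IsPowerField.of_multilinear {m : ℕ} {B : ℝ → ContinuousMultilinearMap ℂ (fun _ : Fin m => E) E}
    {C : ℝ} (hC : 0 ≤ C) (hB : ∀ t, ‖B t‖ ≤ C)
    (hc : ∀ x : E, Continuous fun t => B t (fun _ => x)) :
    IsPowerField (fun t x => B t (fun _ => x)) C m where
  nonneg := hC
  norm_le t x := by
    refine ((B t).le_opNorm _).trans ?_
    rw [Finset.prod_const, Finset.card_univ, Fintype.card_fin]
    gcongr
    exact hB t
  norm_sub_le t x y := by
    rcases Nat.eq_zero_or_pos m with rfl | hm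
    · rw [show (fun _ : Fin 0 => x) = fun _ => y from Subsingleton.elim _ _]
      simp
    have : Nonempty (Fin m) := ⟨⟨0, hm⟩⟩
    have h := (B t).norm_image_sub_le (fun _ => x) (fun _ => y)
    rw [Fintype.card_fin, show (fun _ : Fin m => x) - (fun _ => y) = fun _ => x - y from rfl,
      pi_norm_const, pi_norm_const, pi_norm_const] at h
    refine h.trans ?_
    gcongr
    exact hB t
  continuous_time := hc

/-- The product rule for `Q_t(v(t), …, v(t))`, with a bound for the terms in which `v` is
differentiated. -/
theorem exists_hasDerivWithinAt_multilinear [NormedSpace ℝ E] [IsScalarTower ℝ ℂ E]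
    [NormedSpace ℝ G] [IsScalarTower ℝ ℂ G] {m : ℕ}
    {Q : ℝ → ContinuousMultilinearMap ℂ (fun _ : Fin m => E) G}
    {Q' : ContinuousMultilinearMap ℂ (fun _ : Fin m => E) G} {v : ℝ → E} {v' : E} {s : Set ℝ}
    {t q M M' : ℝ} (hQ : HasDerivAt Q Q' t) (hv : HasDerivWithinAt v v' s t) (hq : ‖Q t‖ ≤ q)
    (hM : ‖v t‖ ≤ M) (hM' : ‖v'‖ ≤ M') :
    ∃ e : G, HasDerivWithinAt (fun t => Q t (fun _ => v t)) (Q' (fun _ => v t) + e) s t ∧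
      ‖e‖ ≤ m * (q * (M ^ (m - 1) * M')) := by
  classical
  -- Time is real whereas the maps are complex multilinear, so the product rule is applied after
  -- restriction of scalars.
  let Rs := ContinuousMultilinearMap.restrictScalarsLinear (𝕜 := ℂ) (E := fun _ : Fin m => E)
    (F := G) ℝ
  have hRs : ∀ (B : ContinuousMultilinearMap ℂ (fun _ : Fin m => E) G) x, Rs B x = B x :=
    fun _ _ => rfl
  have h1 : HasDerivWithinAt (fun t => Rs (Q t)) (Rs Q') s t :=
    (Rs.hasFDerivAt.comp_hasDerivAt t hQ).hasDerivWithinAt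
  have h2 := (h1.hasFDerivWithinAt.continuousMultilinearMap_apply
    (g := fun _ : Fin m => v) fun _ => hv.hasFDerivWithinAt).hasDerivWithinAt
  refine ⟨∑ i, Q t (Function.update (fun _ => v t) i v'), ?_, ?_⟩
  · have h3 : ((ContinuousMultilinearMap.apply ℝ (fun _ : Fin m => E) G fun _ => v t) ∘L
        ContinuousLinearMap.toSpanSingleton ℝ (Rs Q') +
        ∑ i, (Rs (Q t)).toContinuousLinearMap (fun _ => v t) i ∘L
          ContinuousLinearMap.toSpanSingleton ℝ v') 1 =
        Q' (fun _ => v t) + ∑ i, Q t (Function.update (fun _ => v t) i v') := by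
      simp only [add_apply, ContinuousLinearMap.comp_apply, sum_apply,
        ContinuousLinearMap.toSpanSingleton_apply, one_smul]
      rfl
    rw [← h3]
    exact h2
  · have hq0 : 0 ≤ q := (norm_nonneg _).trans hq
    have hM0 : 0 ≤ M := (norm_nonneg _).trans hM
    refine (norm_sum_le _ _).trans ?_
    have : ∀ i ∈ Finset.univ, ‖Q t (Function.update (fun _ => v t) i v')‖ ≤
        q * (M ^ (m - 1) * M') := by
      intro i _
      refine ((Q t).le_opNorm _).trans ?_
      have hp : ∏ j, ‖Function.update (fun _ : Fin m => v t) i v' j‖ ≤ M ^ (m - 1) * M' := by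
        rw [← Finset.prod_erase_mul _ _ (Finset.mem_univ i), Function.update_self]
        gcongr
        refine (Finset.prod_le_prod (g := fun _ => M) (fun _ _ => norm_nonneg _) ?_).trans ?_
        · intro j hj
          rw [Function.update_of_ne (Finset.ne_of_mem_erase hj)]
          exact hM
        · rw [Finset.prod_const, Finset.card_erase_of_mem (Finset.mem_univ i), Finset.card_univ,
            Fintype.card_fin]
      gcongr
    refine (Finset.sum_le_card_nsmul _ _ _ this).trans ?_
    simp

end Multilinear

/-! ### Integral operators with bounded multilinear kernels -/

/-- Continuous `m`-linear maps from `Y` to `Z`. -/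
abbrev Tensor (m : ℕ) (Y Z : Type*) [NormedAddCommGroup Y] [NormedSpace ℂ Y]
    [NormedAddCommGroup Z] [NormedSpace ℂ Z] := ContinuousMultilinearMap ℂ (fun _ : Fin m => Y) Z

/-- Integrable functions of the wavevector with values in `Y`. -/
abbrev SpecOf (d : ℕ) (Y : Type*) [NormedAddCommGroup Y] := Lp Y 1 (volume : Measure (Wave d))

/-! ### Integration over tuples of wavevectors with a prescribed sum -/

section ConvVec

variable {d m : ℕ} [NeZero m]

theorem sum_convVec (k : Wave d) (κ : Fin (m - 1) → Wave d) : ∑ j, convVec m k κ j = k := by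
  obtain ⟨n, rfl⟩ : ∃ n, m = n + 1 := Nat.exists_eq_succ_of_ne_zero (NeZero.ne m)
  rw [Fin.sum_univ_castSucc]
  simp [convVec]

/-- The map is a shear (κ, k) ↦ (κ, k - Σκ) composed with coordinate swaps and the insertion of the
last coordinate. It makes Fubini available: an integral over k and the free wavevectors is an
integral over all tuples. -/
theorem measurePreserving_convVec :
    MeasurePreserving (fun q : Wave d × (Fin (m - 1) → Wave d) => convVec m q.1 q.2)
      (volume.prod volume) volume := by
  obtain ⟨n, rfl⟩ : ∃ n, m = n + 1 := Nat.exists_eq_succ_of_ne_zero (NeZero.ne m)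
  have h1 := (volume_preserving_piFinSuccAbove (fun _ : Fin (n + 1) => Wave d) (Fin.last n)).symm
  have h2 : MeasurePreserving
      (fun p : (Fin n → Wave d) × Wave d => (p.1, p.2 - ∑ i, p.1 i))
      ((volume : Measure (Fin n → Wave d)).prod volume) (volume.prod volume) := by
    refine (MeasurePreserving.id (volume : Measure (Fin n → Wave d))).skew_product
      (g := fun κ k => k - ∑ i, κ i) (by fun_prop) (ae_of_all _ fun κ => ?_)
    exact (measurePreserving_sub_right (volume : Measure (Wave d)) (∑ i, κ i)).map_eq
  have h3 := h1.comp ((Measure.measurePreserving_swap (μ := (volume : Measure (Fin n → Wave d)))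
    (ν := (volume : Measure (Wave d)))).comp (h2.comp
      (Measure.measurePreserving_swap (μ := (volume : Measure (Wave d)))
        (ν := (volume : Measure (Fin n → Wave d))))))
  convert! h3 using 1
  ext1 ⟨k, κ⟩
  funext j
  refine Fin.lastCases ?_ (fun i => ?_) j
  · simp [convVec, MeasurableEquiv.piFinSuccAbove_symm_apply, Fin.insertNthEquiv]
  · simp [convVec, MeasurableEquiv.piFinSuccAbove_symm_apply, Fin.insertNthEquiv,
      Fin.insertNth_last']

/-- In the coordinates (k, κ) of `convVec` the sum is the first projection. Null sets and
measurability in the output wavevector can therefore be pulled back to tuples, where all kernels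
live. -/
theorem quasiMeasurePreserving_sum :
    Measure.QuasiMeasurePreserving (fun κ : Fin m → Wave d => ∑ j, κ j) volume volume := by
  refine ⟨by fun_prop, Measure.AbsolutelyContinuous.mk fun s hs h0 => ?_⟩
  have hmeas : Measurable fun κ : Fin m → Wave d => ∑ j, κ j := by fun_prop
  have hp := measurePreserving_convVec (d := d) (m := m)
  rw [Measure.map_apply hmeas hs, ← hp.map_eq, Measure.map_apply hp.measurable (hmeas hs)]
  have : (fun q : Wave d × (Fin (m - 1) → Wave d) => convVec m q.1 q.2) ⁻¹'
      ((fun κ : Fin m → Wave d => ∑ j, κ j) ⁻¹' s) = Prod.fst ⁻¹' s := by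
    ext q
    simp only [mem_preimage, sum_convVec]
  rw [this]
  exact Measure.quasiMeasurePreserving_fst.preimage_null h0

theorem ae_sum {p : Wave d → Prop} (hp : ∀ᵐ k, p k) :
    ∀ᵐ κ : Fin m → Wave d, p (∑ j, κ j) :=
  quasiMeasurePreserving_sum.ae hp

theorem aesm_comp_sum {E : Type*} [TopologicalSpace E] {T : Wave d → E}
    (hT : AEStronglyMeasurable T volume) :
    AEStronglyMeasurable (fun κ : Fin m → Wave d => T (∑ j, κ j)) volume :=
  hT.comp_quasiMeasurePreserving quasiMeasurePreserving_sum

theorem ae_ae_convVec {p : (Fin m → Wave d) → Prop} (hp : ∀ᵐ κ, p κ) :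
    ∀ᵐ k : Wave d, ∀ᵐ κ : Fin (m - 1) → Wave d, p (convVec m k κ) :=
  Measure.ae_ae_of_ae_prod (measurePreserving_convVec.quasiMeasurePreserving.ae hp)

variable {Z : Type*} [NormedAddCommGroup Z]

theorem integrable_comp_convVec {F : (Fin m → Wave d) → Z} (hF : Integrable F) :
    Integrable (fun q : Wave d × (Fin (m - 1) → Wave d) => F (convVec m q.1 q.2))
      (volume.prod volume) :=
  (measurePreserving_convVec.integrable_comp hF.aestronglyMeasurable).2 hF

variable [NormedSpace ℝ Z]

/-- The integral over the wavevectors with a given sum. -/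
def fiberIntegral (m : ℕ) (F : (Fin m → Wave d) → Z) (k : Wave d) : Z :=
  ∫ κ : Fin (m - 1) → Wave d, F (convVec m k κ)

theorem integrable_fiberIntegral {F : (Fin m → Wave d) → Z} (hF : Integrable F) :
    Integrable (fiberIntegral m F) :=
  (integrable_comp_convVec hF).integral_prod_left

theorem ae_integrable_fiber {F : (Fin m → Wave d) → Z} (hF : Integrable F) :
    ∀ᵐ k : Wave d, Integrable fun κ : Fin (m - 1) → Wave d => F (convVec m k κ) :=
  (integrable_comp_convVec hF).prod_right_ae

theorem integral_norm_fiberIntegral_le {F : (Fin m → Wave d) → Z} (hF : Integrable F) :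
    ∫ k, ‖fiberIntegral m F k‖ ≤ ∫ κ, ‖F κ‖ := by
  calc ∫ k, ‖fiberIntegral m F k‖
      ≤ ∫ k : Wave d, ∫ κ : Fin (m - 1) → Wave d, ‖F (convVec m k κ)‖ :=
        integral_mono (integrable_fiberIntegral hF).norm
          (integrable_comp_convVec hF).integral_norm_prod_left
          fun k => norm_integral_le_integral_norm _
    _ = ∫ q : Wave d × (Fin (m - 1) → Wave d), ‖F (convVec m q.1 q.2)‖ ∂volume.prod volume :=
        (integral_prod _ (integrable_comp_convVec hF).norm).symm
    _ = ∫ κ, ‖F κ‖ := by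
        have hp := measurePreserving_convVec (d := d) (m := m)
        have := integral_map (μ := (volume : Measure (Wave d)).prod volume)
          hp.measurable.aemeasurable (f := fun κ => ‖F κ‖)
          (by rw [hp.map_eq]; exact hF.aestronglyMeasurable.norm)
        rw [← this, hp.map_eq]

theorem fiberIntegral_congr {F G : (Fin m → Wave d) → Z} (h : F =ᵐ[volume] G) :
    fiberIntegral m F =ᵐ[volume] fiberIntegral m G := by
  filter_upwards [ae_ae_convVec h] with k hk
  exact integral_congr_ae hk

theorem fiberIntegral_add {F G : (Fin m → Wave d) → Z} (hF : Integrable F) (hG : Integrable G) :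
    fiberIntegral m (fun κ => F κ + G κ) =ᵐ[volume]
      fun k => fiberIntegral m F k + fiberIntegral m G k := by
  filter_upwards [ae_integrable_fiber hF, ae_integrable_fiber hG] with k h1 h2
  exact integral_add h1 h2

theorem fiberIntegral_smul [NormedSpace ℂ Z] [IsScalarTower ℝ ℂ Z] (c : ℂ)
    (F : (Fin m → Wave d) → Z) (k : Wave d) :
    fiberIntegral m (fun κ => c • F κ) k = c • fiberIntegral m F k :=
  integral_smul c _

end ConvVec

/-! ### Multilinear operators of L¹ with essentially bounded kernels -/

section KernelOperator

variable {d m : ℕ}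
variable {Y Z : Type*} [NormedAddCommGroup Y] [NormedSpace ℂ Y] [NormedAddCommGroup Z]
  [NormedSpace ℂ Z]

/-- Measurable, essentially bounded kernels. -/
structure IsBddKernel (K : (Fin m → Wave d) → Tensor m Y Z) : Prop where
  aesm : AEStronglyMeasurable K volume
  bdd : ∃ C : ℝ, ∀ᵐ κ, ‖K κ‖ ≤ C

theorem IsBddKernel.add {K K' : (Fin m → Wave d) → Tensor m Y Z} (hK : IsBddKernel K)
    (hK' : IsBddKernel K') : IsBddKernel fun κ => K κ + K' κ := by
  obtain ⟨C, hC⟩ := hK.bdd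
  obtain ⟨C', hC'⟩ := hK'.bdd
  refine ⟨hK.aesm.add hK'.aesm, C + C', ?_⟩
  filter_upwards [hC, hC'] with κ h1 h2
  exact (norm_add_le _ _).trans (add_le_add h1 h2)

theorem IsBddKernel.zero : IsBddKernel fun _ : Fin m → Wave d => (0 : Tensor m Y Z) :=
  ⟨aestronglyMeasurable_const, 0, ae_of_all _ fun _ => by simp⟩

theorem IsBddKernel.sum {ι : Type*} (s : Finset ι) {K : ι → (Fin m → Wave d) → Tensor m Y Z}
    (hK : ∀ i ∈ s, IsBddKernel (K i)) : IsBddKernel fun κ => ∑ i ∈ s, K i κ := by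
  classical
  induction s using Finset.induction_on with
  | empty => simpa using IsBddKernel.zero
  | insert i s hi ih =>
    simp only [Finset.sum_insert hi]
    exact (hK i (Finset.mem_insert_self _ _)).add
      (ih fun j hj => hK j (Finset.mem_insert_of_mem hj))

theorem IsBddKernel.smul_fun {K : (Fin m → Wave d) → Tensor m Y Z} (hK : IsBddKernel K)
    {a : (Fin m → Wave d) → ℂ} (ha : AEStronglyMeasurable a volume) {B : ℝ}
    (hB : ∀ᵐ κ, K κ = 0 ∨ ‖a κ‖ ≤ B) : IsBddKernel fun κ => a κ • K κ := by
  obtain ⟨C, hC⟩ := hK.bdd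
  refine ⟨ha.smul hK.aesm, max B 0 * C, ?_⟩
  filter_upwards [hC, hB] with κ h1 h2
  have hC0 := (norm_nonneg _).trans h1
  rcases h2 with h2 | h2
  · rw [h2, smul_zero, norm_zero]
    positivity
  · rw [norm_smul]
    exact mul_le_mul (h2.trans (le_max_left _ _)) h1 (norm_nonneg _) (le_max_right _ _)

theorem IsBddKernel.smul {K : (Fin m → Wave d) → Tensor m Y Z} (hK : IsBddKernel K) (c : ℂ) :
    IsBddKernel fun κ => c • K κ := by
  obtain ⟨C, hC⟩ := hK.bdd
  refine ⟨hK.aesm.const_smul c, ‖c‖ * C, ?_⟩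
  filter_upwards [hC] with κ h1
  rw [norm_smul]
  gcongr

/-- The integrand of an integral operator. -/
def kerFun (K : (Fin m → Wave d) → Tensor m Y Z) (f : Fin m → SpecOf d Y) (κ : Fin m → Wave d) :
    Z :=
  K κ fun j => f j (κ j)

theorem ae_eval {p : Wave d → Prop} (hp : ∀ᵐ k, p k) (j : Fin m) :
    ∀ᵐ κ : Fin m → Wave d, p (κ j) :=
  (Measure.quasiMeasurePreserving_eval _ j).ae hp

/-- A tuple is the finite sum of its coordinates placed by the continuous maps `Pi.single`; this
needs no countability assumption on the target. -/
theorem aesm_pi {α ι E : Type*} [MeasurableSpace α] {μ : Measure α} [Fintype ι]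
    [NormedAddCommGroup E] {g : ι → α → E} (hg : ∀ j, AEStronglyMeasurable (g j) μ) :
    AEStronglyMeasurable (fun a j => g j a) μ := by
  classical
  have h : (fun a j => g j a) = fun a => ∑ j, Pi.single j (g j a) := by
    funext a
    exact (Finset.univ_sum_single _).symm
  rw [h]
  exact Finset.aestronglyMeasurable_fun_sum _ fun j _ =>
    (continuous_single (A := fun _ : ι => E) j).comp_aestronglyMeasurable (hg j)

theorem aesm_eval (f : Fin m → SpecOf d Y) :
    AEStronglyMeasurable (fun (κ : Fin m → Wave d) (j : Fin m) => f j (κ j)) volume := by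
  refine aesm_pi fun j => ?_
  exact (Lp.aestronglyMeasurable (f j)).comp_quasiMeasurePreserving
    (Measure.quasiMeasurePreserving_eval _ j)

theorem aesm_kerFun {K : (Fin m → Wave d) → Tensor m Y Z} (hK : IsBddKernel K)
    (f : Fin m → SpecOf d Y) : AEStronglyMeasurable (kerFun K f) volume :=
  (continuous_eval (F := Tensor m Y Z)).comp_aestronglyMeasurable (hK.aesm.prodMk (aesm_eval f))

theorem integrable_prod_norm (f : Fin m → SpecOf d Y) :
    Integrable fun κ : Fin m → Wave d => ∏ j, ‖f j (κ j)‖ :=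
  Integrable.fintype_prod fun j => (L1.integrable_coeFn (f j)).norm

theorem integral_prod_norm (f : Fin m → SpecOf d Y) :
    ∫ κ : Fin m → Wave d, ∏ j, ‖f j (κ j)‖ = ∏ j, ‖f j‖ := by
  rw [integral_fintype_prod_volume_eq_prod (fun (j : Fin m) (k : Wave d) => ‖f j k‖)]
  exact Finset.prod_congr rfl fun j _ => (L1.norm_eq_integral_norm (f j)).symm

theorem norm_kerFun_le {K : (Fin m → Wave d) → Tensor m Y Z} {C : ℝ} (hC : ∀ᵐ κ, ‖K κ‖ ≤ C)
    (f : Fin m → SpecOf d Y) : ∀ᵐ κ, ‖kerFun K f κ‖ ≤ C * ∏ j, ‖f j (κ j)‖ := by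
  filter_upwards [hC] with κ h
  refine ((K κ).le_opNorm _).trans ?_
  gcongr

theorem integrable_kerFun {K : (Fin m → Wave d) → Tensor m Y Z} (hK : IsBddKernel K)
    (f : Fin m → SpecOf d Y) : Integrable (kerFun K f) := by
  obtain ⟨C, hC⟩ := hK.bdd
  exact ((integrable_prod_norm f).const_mul C).mono' (aesm_kerFun hK f) (norm_kerFun_le hC f)

theorem integral_norm_kerFun_le {K : (Fin m → Wave d) → Tensor m Y Z} (hK : IsBddKernel K) {C : ℝ}
    (hC : ∀ᵐ κ, ‖K κ‖ ≤ C) (f : Fin m → SpecOf d Y) :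
    ∫ κ, ‖kerFun K f κ‖ ≤ C * ∏ j, ‖f j‖ := by
  rw [← integral_prod_norm f, ← integral_const_mul]
  exact integral_mono_ae (integrable_kerFun hK f).norm ((integrable_prod_norm f).const_mul C)
    (norm_kerFun_le hC f)

theorem kerFun_update_add (K : (Fin m → Wave d) → Tensor m Y Z) (f : Fin m → SpecOf d Y)
    (i : Fin m) (x y : SpecOf d Y) :
    kerFun K (Function.update f i (x + y)) =ᵐ[volume]
      fun κ => kerFun K (Function.update f i x) κ + kerFun K (Function.update f i y) κ := by
  filter_upwards [ae_eval (Lp.coeFn_add x y) i] with κ h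
  have hu : ∀ z : SpecOf d Y, (fun j => Function.update f i z j (κ j)) =
      Function.update (fun j => f j (κ j)) i (z (κ i)) := by
    intro z
    funext j
    rcases eq_or_ne j i with rfl | hj
    · simp
    · simp [hj]
  simp only [kerFun, hu]
  rw [h, Pi.add_apply, ContinuousMultilinearMap.map_update_add]

theorem kerFun_update_smul (K : (Fin m → Wave d) → Tensor m Y Z) (f : Fin m → SpecOf d Y)
    (i : Fin m) (c : ℂ) (x : SpecOf d Y) :
    kerFun K (Function.update f i (c • x)) =ᵐ[volume]
      fun κ => c • kerFun K (Function.update f i x) κ := by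
  filter_upwards [ae_eval (Lp.coeFn_smul c x) i] with κ h
  have hu : ∀ z : SpecOf d Y, (fun j => Function.update f i z j (κ j)) =
      Function.update (fun j => f j (κ j)) i (z (κ i)) := by
    intro z
    funext j
    rcases eq_or_ne j i with rfl | hj
    · simp
    · simp [hj]
  simp only [kerFun, hu]
  rw [h, Pi.smul_apply, ContinuousMultilinearMap.map_update_smul]

variable [NeZero m] [NormedSpace ℝ Z] [IsScalarTower ℝ ℂ Z]

open Classical in
/-- The multilinear operator `(f₁, …, f_m) ↦ ∫ K(k', …, k^{(m)})[f₁(k'), …, f_m(k^{(m)})]` of `L¹`,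
with integration over the wavevectors with sum `k`. -/
def kerOp (K : (Fin m → Wave d) → Tensor m Y Z) : Tensor m (SpecOf d Y) (SpecOf d Z) :=
  if hK : IsBddKernel K then
    MultilinearMap.mkContinuous
      { toFun := fun f => (integrable_fiberIntegral (integrable_kerFun hK f)).toL1 _
        map_update_add' := by
          intro hdec f i x y
          rw [Subsingleton.elim hdec (instDecidableEqFin m), ← Integrable.toL1_add,
            Integrable.toL1_eq_toL1_iff]
          exact (fiberIntegral_congr (kerFun_update_add K f i x y)).trans
            (fiberIntegral_add (integrable_kerFun hK _) (integrable_kerFun hK _))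
        map_update_smul' := by
          intro hdec f i c x
          rw [Subsingleton.elim hdec (instDecidableEqFin m), ← Integrable.toL1_smul,
            Integrable.toL1_eq_toL1_iff]
          refine (fiberIntegral_congr (kerFun_update_smul K f i c x)).trans ?_
          exact ae_of_all _ fun k => fiberIntegral_smul c _ k }
      hK.bdd.choose fun f => by
        change ‖(integrable_fiberIntegral (integrable_kerFun hK f)).toL1 _‖ ≤ _
        rw [L1.norm_of_fun_eq_integral_norm]
        exact (integral_norm_fiberIntegral_le (integrable_kerFun hK f)).trans
          (integral_norm_kerFun_le hK hK.bdd.choose_spec f)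
  else 0

variable {K K' : (Fin m → Wave d) → Tensor m Y Z}

theorem kerOp_apply (hK : IsBddKernel K) (f : Fin m → SpecOf d Y) :
    kerOp K f = (integrable_fiberIntegral (integrable_kerFun hK f)).toL1 _ := by
  rw [kerOp, dif_pos hK]
  rfl

theorem coeFn_kerOp (hK : IsBddKernel K) (f : Fin m → SpecOf d Y) :
    kerOp K f =ᵐ[volume] fiberIntegral m (kerFun K f) := by
  rw [kerOp_apply hK]
  exact Integrable.coeFn_toL1 _

theorem norm_kerOp_apply_le (hK : IsBddKernel K) (f : Fin m → SpecOf d Y) :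
    ‖kerOp K f‖ ≤ ∫ κ, ‖kerFun K f κ‖ := by
  rw [kerOp_apply hK, L1.norm_of_fun_eq_integral_norm]
  exact integral_norm_fiberIntegral_le (integrable_kerFun hK f)

/-- The Young inequality for L¹: by Fubini the output norm is at most the integral over all tuples,
which factorizes. All estimates of operators are thereby reduced to pointwise estimates of kernels.
-/
theorem norm_kerOp_le (hK : IsBddKernel K) {C : ℝ} (hC0 : 0 ≤ C) (hC : ∀ᵐ κ, ‖K κ‖ ≤ C) :
    ‖kerOp K‖ ≤ C :=
  ContinuousMultilinearMap.opNorm_le_bound hC0 fun f =>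
    (norm_kerOp_apply_le hK f).trans (integral_norm_kerFun_le hK hC f)

theorem kerOp_apply_congr {Y' : Type*} [NormedAddCommGroup Y'] [NormedSpace ℂ Y']
    {K' : (Fin m → Wave d) → Tensor m Y' Z} (hK : IsBddKernel K) (hK' : IsBddKernel K')
    {f : Fin m → SpecOf d Y} {f' : Fin m → SpecOf d Y'}
    (h : kerFun K f =ᵐ[volume] kerFun K' f') : kerOp K f = kerOp K' f' := by
  rw [kerOp_apply hK, kerOp_apply hK', Integrable.toL1_eq_toL1_iff]
  exact fiberIntegral_congr h

theorem kerOp_congr (hK : IsBddKernel K) (hK' : IsBddKernel K') (h : ∀ᵐ κ, K κ = K' κ) :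
    kerOp K = kerOp K' := by
  ext1 f
  refine kerOp_apply_congr hK hK' ?_
  filter_upwards [h] with κ hκ
  rw [kerFun, kerFun, hκ]

theorem kerOp_add (hK : IsBddKernel K) (hK' : IsBddKernel K') :
    kerOp (fun κ => K κ + K' κ) = kerOp K + kerOp K' := by
  ext1 f
  rw [_root_.add_apply, kerOp_apply hK, kerOp_apply hK',
    kerOp_apply (hK.add hK'), ← Integrable.toL1_add, Integrable.toL1_eq_toL1_iff]
  exact fiberIntegral_add (integrable_kerFun hK f) (integrable_kerFun hK' f)

theorem kerOp_smul (hK : IsBddKernel K) (c : ℂ) : kerOp (fun κ => c • K κ) = c • kerOp K := by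
  ext1 f
  rw [_root_.smul_apply, kerOp_apply hK, kerOp_apply (hK.smul c),
    ← Integrable.toL1_smul, Integrable.toL1_eq_toL1_iff]
  exact ae_of_all _ fun k => fiberIntegral_smul c _ k

theorem kerOp_sub (hK : IsBddKernel K) (hK' : IsBddKernel K') :
    kerOp (fun κ => K κ - K' κ) = kerOp K - kerOp K' := by
  have := kerOp_add hK (hK'.smul (-1))
  rw [kerOp_smul hK'] at this
  simpa [sub_eq_add_neg] using this

theorem kerOp_zero : kerOp (fun _ : Fin m → Wave d => (0 : Tensor m Y Z)) = 0 := by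
  have := kerOp_smul (IsBddKernel.zero (d := d) (m := m) (Y := Y) (Z := Z)) 0
  simpa using this

theorem kerOp_sum {ι : Type*} (s : Finset ι) {K : ι → (Fin m → Wave d) → Tensor m Y Z}
    (hK : ∀ i ∈ s, IsBddKernel (K i)) : kerOp (fun κ => ∑ i ∈ s, K i κ) = ∑ i ∈ s, kerOp (K i) := by
  classical
  induction s using Finset.induction_on with
  | empty => simpa using kerOp_zero
  | insert i s hi ih =>
    have hs : ∀ j ∈ s, IsBddKernel (K j) := fun j hj => hK j (Finset.mem_insert_of_mem hj)
    simp only [Finset.sum_insert hi]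
    rw [kerOp_add (hK i (Finset.mem_insert_self _ _)) (IsBddKernel.sum s hs), ih hs]

/-- Strong continuity with respect to a parameter. -/
theorem continuous_kerOp_apply {K : ℝ → (Fin m → Wave d) → Tensor m Y Z}
    (hK : ∀ t, IsBddKernel (K t)) {C : ℝ} (hC : ∀ t, ∀ᵐ κ, ‖K t κ‖ ≤ C)
    (hcont : ∀ᵐ κ, Continuous fun t => K t κ) (f : Fin m → SpecOf d Y) :
    Continuous fun t => kerOp (K t) f := by
  rw [continuous_iff_continuousAt]
  intro t₀
  rw [ContinuousAt, tendsto_iff_norm_sub_tendsto_zero]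
  have hsub : ∀ t, kerOp (K t) f - kerOp (K t₀) f = kerOp (fun κ => K t κ - K t₀ κ) f := by
    intro t
    rw [kerOp_sub (hK t) (hK t₀)]
    rfl
  have hbdd : ∀ t, IsBddKernel fun κ => K t κ - K t₀ κ := by
    intro t
    simpa [sub_eq_add_neg] using (hK t).add ((hK t₀).smul (-1))
  have hlim : Tendsto (fun t => ∫ κ, ‖kerFun (fun κ => K t κ - K t₀ κ) f κ‖) (𝓝 t₀) (𝓝 0) := by
    have : Tendsto (fun t => ∫ κ, ‖kerFun (fun κ => K t κ - K t₀ κ) f κ‖) (𝓝 t₀)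
        (𝓝 (∫ _ : Fin m → Wave d, (0 : ℝ))) := by
      refine tendsto_integral_filter_of_dominated_convergence
        (fun κ => (C + C) * ∏ j, ‖f j (κ j)‖) ?_ ?_ ?_ ?_
      · exact Eventually.of_forall fun t => (aesm_kerFun (hbdd t) f).norm
      · refine Eventually.of_forall fun t => ?_
        have : ∀ᵐ κ, ‖K t κ - K t₀ κ‖ ≤ C + C := by
          filter_upwards [hC t, hC t₀] with κ h1 h2
          exact (norm_sub_le _ _).trans (add_le_add h1 h2)
        filter_upwards [norm_kerFun_le this f] with κ h
        rwa [norm_norm]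
      · exact (integrable_prod_norm f).const_mul _
      · filter_upwards [hcont] with κ h
        have h1 : Continuous fun t => ‖kerFun (fun κ => K t κ - K t₀ κ) f κ‖ := by
          unfold kerFun
          exact ((continuous_eval_const (F := Tensor m Y Z) _).comp
            (h.sub continuous_const)).norm
        have h2 := h1.tendsto t₀
        simpa [kerFun] using h2
    simpa using this
  refine squeeze_zero (fun _ => norm_nonneg _) (fun t => ?_) hlim
  rw [hsub]
  exact norm_kerOp_apply_le (hbdd t) f

end KernelOperator

/-! ### Multiplication operators and their composition with kernel operators -/

section Multiplication

variable {d m : ℕ}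
variable {X Y Z : Type*} [NormedAddCommGroup X] [NormedSpace ℂ X] [NormedAddCommGroup Y]
  [NormedSpace ℂ Y] [NormedAddCommGroup Z] [NormedSpace ℂ Z]

/-- Measurable, essentially bounded multipliers. -/
structure IsBddMul (T : Wave d → Y →L[ℂ] Z) : Prop where
  aesm : AEStronglyMeasurable T volume
  bdd : ∃ C : ℝ, ∀ᵐ k, ‖T k‖ ≤ C

theorem aesm_mul_apply {T : Wave d → Y →L[ℂ] Z} (hT : IsBddMul T) (f : SpecOf d Y) :
    AEStronglyMeasurable (fun k => T k (f k)) volume :=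
  isBoundedBilinearMap_apply.continuous.comp_aestronglyMeasurable
    (hT.aesm.prodMk (Lp.aestronglyMeasurable f))

theorem norm_mul_apply_le {T : Wave d → Y →L[ℂ] Z} {C : ℝ} (hC : ∀ᵐ k, ‖T k‖ ≤ C)
    (f : SpecOf d Y) : ∀ᵐ k, ‖T k (f k)‖ ≤ C * ‖f k‖ := by
  filter_upwards [hC] with k h
  exact (T k).le_of_opNorm_le h _

theorem integrable_mul_apply {T : Wave d → Y →L[ℂ] Z} (hT : IsBddMul T) (f : SpecOf d Y) :
    Integrable fun k => T k (f k) := by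
  obtain ⟨C, hC⟩ := hT.bdd
  exact ((L1.integrable_coeFn f).norm.const_mul C).mono' (aesm_mul_apply hT f)
    (norm_mul_apply_le hC f)

theorem norm_toL1_mul_apply_le {T : Wave d → Y →L[ℂ] Z} (hT : IsBddMul T) {C : ℝ}
    (hC : ∀ᵐ k, ‖T k‖ ≤ C) (f : SpecOf d Y) :
    ‖(integrable_mul_apply hT f).toL1 _‖ ≤ C * ‖f‖ := by
  rw [L1.norm_of_fun_eq_integral_norm, L1.norm_eq_integral_norm, ← integral_const_mul]
  exact integral_mono_ae (integrable_mul_apply hT f).norm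
    ((L1.integrable_coeFn f).norm.const_mul C) (norm_mul_apply_le hC f)

open Classical in
/-- The operator of multiplication by `T(k)` in `L¹`. -/
def mulOp (T : Wave d → Y →L[ℂ] Z) : SpecOf d Y →L[ℂ] SpecOf d Z :=
  if hT : IsBddMul T then
    LinearMap.mkContinuous
      { toFun := fun f => (integrable_mul_apply hT f).toL1 _
        map_add' := by
          intro f g
          rw [← Integrable.toL1_add, Integrable.toL1_eq_toL1_iff]
          filter_upwards [Lp.coeFn_add f g] with k h
          rw [h, Pi.add_apply, map_add, Pi.add_apply]
        map_smul' := by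
          intro c f
          rw [RingHom.id_apply, ← Integrable.toL1_smul, Integrable.toL1_eq_toL1_iff]
          filter_upwards [Lp.coeFn_smul c f] with k h
          rw [h, Pi.smul_apply, map_smul] }
      hT.bdd.choose fun f => norm_toL1_mul_apply_le hT hT.bdd.choose_spec f
  else 0

theorem mulOp_apply {T : Wave d → Y →L[ℂ] Z} (hT : IsBddMul T) (f : SpecOf d Y) :
    mulOp T f = (integrable_mul_apply hT f).toL1 _ := by
  rw [mulOp, dif_pos hT]
  rfl

theorem coeFn_mulOp {T : Wave d → Y →L[ℂ] Z} (hT : IsBddMul T) (f : SpecOf d Y) :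
    mulOp T f =ᵐ[volume] fun k => T k (f k) := by
  rw [mulOp_apply hT]
  exact Integrable.coeFn_toL1 _

theorem norm_mulOp_le {T : Wave d → Y →L[ℂ] Z} (hT : IsBddMul T) {C : ℝ}
    (hC : ∀ᵐ k, ‖T k‖ ≤ C) (f : SpecOf d Y) : ‖mulOp T f‖ ≤ C * ‖f‖ := by
  rw [mulOp_apply hT]
  exact norm_toL1_mul_apply_le hT hC f

theorem IsBddMul.comp {T : Wave d → Y →L[ℂ] Z} {T' : Wave d → X →L[ℂ] Y} (hT : IsBddMul T)
    (hT' : IsBddMul T') : IsBddMul fun k => T k ∘L T' k := by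
  obtain ⟨C, hC⟩ := hT.bdd
  obtain ⟨C', hC'⟩ := hT'.bdd
  refine ⟨isBoundedBilinearMap_comp.continuous.comp_aestronglyMeasurable
    (hT.aesm.prodMk hT'.aesm), C * C', ?_⟩
  filter_upwards [hC, hC'] with k h1 h2
  have := (norm_nonneg _).trans h1
  exact ((T k).opNorm_comp_le _).trans (by gcongr)

theorem mulOp_mulOp {T : Wave d → Y →L[ℂ] Z} {T' : Wave d → X →L[ℂ] Y} (hT : IsBddMul T)
    (hT' : IsBddMul T') (f : SpecOf d X) :
    mulOp T (mulOp T' f) = mulOp (fun k => T k ∘L T' k) f := by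
  refine Lp.ext ?_
  filter_upwards [coeFn_mulOp hT (mulOp T' f), coeFn_mulOp hT' f, coeFn_mulOp (hT.comp hT') f]
    with k h1 h2 h3
  rw [h1, h2, h3]
  rfl

variable [NeZero m]

theorem IsBddKernel.mul_comp {K : (Fin m → Wave d) → Tensor m X Y} {T : Wave d → Y →L[ℂ] Z}
    (hT : IsBddMul T) (hK : IsBddKernel K) :
    IsBddKernel fun κ => (T (∑ j, κ j)).compContinuousMultilinearMap (K κ) := by
  obtain ⟨C, hC⟩ := hT.bdd
  obtain ⟨C', hC'⟩ := hK.bdd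
  refine ⟨?_, C * C', ?_⟩
  · exact ((ContinuousLinearMap.compContinuousMultilinearMapL ℂ
      (fun _ : Fin m => X) Y Z).isBoundedBilinearMap.continuous).comp_aestronglyMeasurable
      ((aesm_comp_sum hT.aesm).prodMk hK.aesm)
  · filter_upwards [ae_sum (m := m) hC, hC'] with κ h1 h2
    have := (norm_nonneg _).trans h1
    exact (ContinuousLinearMap.norm_compContinuousMultilinearMap_le _ _).trans (by gcongr)

theorem continuous_compContinuousLinearMap :
    Continuous fun p : Tensor m Y Z × (Fin m → X →L[ℂ] Y) => p.1.compContinuousLinearMap p.2 :=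
  continuous_iff_continuousAt.2 fun p =>
    (ContinuousMultilinearMap.hasStrictFDerivAt_compContinuousLinearMap p).continuousAt

theorem IsBddKernel.comp_mul {K : (Fin m → Wave d) → Tensor m Y Z} {T : Fin m → Wave d → X →L[ℂ] Y}
    (hK : IsBddKernel K) (hT : ∀ j, IsBddMul (T j)) :
    IsBddKernel fun κ => (K κ).compContinuousLinearMap fun j => T j (κ j) := by
  choose C hC using fun j => (hT j).bdd
  obtain ⟨C', hC'⟩ := hK.bdd
  refine ⟨?_, C' * ∏ j : Fin m, C j, ?_⟩
  · have hT' : AEStronglyMeasurable (fun (κ : Fin m → Wave d) (j : Fin m) => T j (κ j)) volume :=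
      aesm_pi fun j => (hT j).aesm.comp_quasiMeasurePreserving (Measure.quasiMeasurePreserving_eval _ j)
    exact continuous_compContinuousLinearMap.comp_aestronglyMeasurable (hK.aesm.prodMk hT')
  · filter_upwards [ae_all_iff.2 fun j : Fin m => ae_eval (hC j) j, hC'] with κ h1 h2
    have := (norm_nonneg _).trans h2
    refine (ContinuousMultilinearMap.norm_compContinuousLinearMap_le _ _).trans ?_
    gcongr with j
    exact h1 j

/-- The sum of the wavevectors is constant along each fiber, so an output multiplier passes under
the fiber integral and is absorbed into the kernel. -/
theorem mulOp_kerOp [NormedSpace ℝ Y] [IsScalarTower ℝ ℂ Y] [NormedSpace ℝ Z]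
    [IsScalarTower ℝ ℂ Z] [CompleteSpace Y] [CompleteSpace Z]
    {K : (Fin m → Wave d) → Tensor m X Y} {T : Wave d → Y →L[ℂ] Z}
    (hT : IsBddMul T) (hK : IsBddKernel K) (f : Fin m → SpecOf d X) :
    mulOp T (kerOp K f) =
      kerOp (fun κ => (T (∑ j, κ j)).compContinuousMultilinearMap (K κ)) f := by
  refine Lp.ext ?_
  filter_upwards [coeFn_mulOp hT (kerOp K f), coeFn_kerOp hK f, coeFn_kerOp (IsBddKernel.mul_comp hT hK) f,
    ae_integrable_fiber (integrable_kerFun hK f)] with k h1 h2 h3 h4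
  rw [h1, h2, h3, fiberIntegral, fiberIntegral, ← (T k).integral_comp_comm h4]
  refine integral_congr_ae (ae_of_all _ fun κ => ?_)
  simp [kerFun, sum_convVec]

theorem kerOp_mulOp [NormedSpace ℝ Z] [IsScalarTower ℝ ℂ Z]
    {K : (Fin m → Wave d) → Tensor m Y Z} {T : Wave d → X →L[ℂ] Y}
    (hT : IsBddMul T) (hK : IsBddKernel K) (f : Fin m → SpecOf d X) :
    kerOp K (fun j => mulOp T (f j)) =
      kerOp (fun κ => (K κ).compContinuousLinearMap fun j => T (κ j)) f := by
  refine kerOp_apply_congr hK (hK.comp_mul fun _ => hT) ?_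
  filter_upwards [ae_all_iff.2 fun j => ae_eval (coeFn_mulOp hT (f j)) j] with κ h
  simp [kerFun, h]

end Multiplication

/-! ### Spectral theory of the symbol -/

/-- On a finite set, a map that carries the order of one real labelling into the order of an
equivalent one is the identity. -/
theorem eq_self_of_order {α : Type*} [Finite α] {p q : α → ℝ} (hp : Function.Injective p)
    (hpq : ∀ a b, p a < p b ↔ q a < q b) {f : α → α} (hf : ∀ a b, p a < p b → q (f a) < q (f b))
    (a : α) : f a = a := by
  let _ : LinearOrder α := LinearOrder.lift' p hp
  -- A strictly increasing self-map of a finite linear order can move no point, neither up nor down.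
  have hmono : StrictMono f := fun a b hab => (hpq _ _).2 (hf a b hab)
  exact le_antisymm hmono.apply_le hmono.le_apply

theorem exp_apply_of_eigen {E : Type*} [NormedAddCommGroup E] [NormedSpace ℂ E] [CompleteSpace E]
    {T : E →L[ℂ] E} {a : ℂ} {x : E} (h : T x = a • x) :
    NormedSpace.exp T x = Complex.exp a • x := by
  have hpow : ∀ n : ℕ, (T ^ n) x = a ^ n • x := by
    intro n
    induction n with
    | zero => simp
    | succ n ih => rw [pow_succ', show (T * T ^ n) x = T ((T ^ n) x) from rfl, ih, map_smul, h,
        smul_smul, pow_succ]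
  have h1 : HasSum (fun n : ℕ => ((n.factorial : ℂ)⁻¹ • T ^ n) x) (NormedSpace.exp T x) :=
    (NormedSpace.exp_series_hasSum_exp' (𝕂 := ℂ) T).mapL (ContinuousLinearMap.apply ℂ E x)
  have h2 : HasSum (fun n : ℕ => ((n.factorial : ℂ)⁻¹ • a ^ n) • x) (NormedSpace.exp a • x) :=
    (NormedSpace.exp_series_hasSum_exp' (𝕂 := ℂ) a).smul_const x
  rw [Complex.exp_eq_exp_ℂ]
  refine h1.unique ?_
  convert h2 using 2 with n
  rw [_root_.smul_apply, hpow, smul_assoc]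

theorem list_prod_apply_of_eigen {E ι : Type*} [NormedAddCommGroup E] [NormedSpace ℂ E]
    {T : ι → E →L[ℂ] E} {a : ι → ℂ} {x : E} (h : ∀ i, T i x = a i • x) (l : List ι) :
    (l.map T).prod x = (l.map a).prod • x := by
  induction l with
  | nil => simp
  | cons i l ih =>
    rw [List.map_cons, List.prod_cons, List.map_cons, List.prod_cons,
      show (T i * (l.map T).prod) x = T i ((l.map T).prod x) from rfl, ih, map_smul, h, smul_smul, mul_comm]

namespace LinearPart

variable {d J : ℕ} (A : LinearPart d J)

/-- The eigenvalue of a band. -/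
def ev (b : Fin J × ℤˣ) (k : Wave d) : ℝ := A.ω b.1 b.2 k

/-- The eigenvector of a band. -/
def gv (b : Fin J × ℤˣ) (k : Wave d) : Vec J := A.g b.1 b.2 k

/-- The orthogonal projection onto the eigenvector of a band, as an operator. -/
def bandProj (b : Fin J × ℤˣ) (k : Wave d) : Vec J →L[ℂ] Vec J :=
  (innerSL ℂ (A.gv b k)).smulRight (A.gv b k)

/-- The unitary matrix `e^{-itL(k)}`. -/
def flow (t : ℝ) (k : Wave d) : Vec J →L[ℂ] Vec J :=
  NormedSpace.exp ((-(Complex.I * (t : ℂ))) • A.L k)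

variable {A}

theorem bandProj_apply' (b : Fin J × ℤˣ) (k : Wave d) (x : Vec J) :
    A.bandProj b k x = inner ℂ (A.gv b k) x • A.gv b k := rfl

theorem bandCrossing_compl_eventually (hA : A.Admissible) {k : Wave d} (hk : k ∉ A.bandCrossing) :
    ∀ᶠ k' in 𝓝 k, k' ∉ A.bandCrossing :=
  hA.closed.isOpen_compl.mem_nhds hk

theorem continuousAt_L {k : Wave d} (hk : k ∉ A.bandCrossing) : ContinuousAt A.L k := by
  by_contra h
  exact hk (Or.inr (Or.inl h))

theorem ae_notMem_bandCrossing (hA : A.Admissible) :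
    ∀ᵐ k : Wave d, k ∉ A.bandCrossing := measure_eq_zero_iff_ae_notMem.1 hA.null

/-- Hermiticity is assumed at every k, so the exponential is unitary even on the band-crossing set.
-/
theorem norm_flow_le (hA : A.Admissible) (t : ℝ) (k : Wave d) : ‖A.flow t k‖ ≤ 1 := by
  have hu : A.flow t k ∈ unitary (Vec J →L[ℂ] Vec J) := by
    have hs : IsSelfAdjoint (((-t : ℝ) : ℂ) • A.L k) :=
      IsSelfAdjoint.smul (Complex.conj_ofReal _) (hA.hermitian k)
    have := (selfAdjoint.expUnitary (⟨_, hs⟩ : selfAdjoint (Vec J →L[ℂ] Vec J))).2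
    have h2 : A.flow t k = NormedSpace.exp (Complex.I • (((-t : ℝ) : ℂ) • A.L k)) := by
      unfold flow
      rw [smul_smul, Complex.ofReal_neg, mul_neg]
    rw [h2]
    exact this
  refine ContinuousLinearMap.opNorm_le_bound _ zero_le_one fun x => ?_
  rw [ContinuousLinearMap.norm_map_of_mem_unitary hu, one_mul]

variable (A) in
/-- Eigenvalues with a given sign, ordered by the modulus. -/
theorem signed_strictMono (hA : A.Admissible) {k : Wave d} (hk : k ∉ A.bandCrossing) (ζ : ℤˣ) :
    StrictMono (fun n : Fin J => sg ζ * A.ω n ζ k) := by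
  have hle : ∀ n n' : Fin J, n ≤ n' → sg ζ * A.ω n ζ k ≤ sg ζ * A.ω n' ζ k := by
    intro n n' h
    rcases Int.units_eq_one_or ζ with rfl | rfl
    · simpa [sg] using hA.order_pos k hk n n' h
    · simpa [sg] using hA.order_neg k hk n n' h
  intro n n' h
  -- Band crossing only excludes equality of consecutive eigenvalues, so strictness is obtained in
  -- the step from n to n + 1 and weak monotonicity does the rest.
  have hsucc : n.val + 1 < J := lt_of_le_of_lt (Nat.succ_le_of_lt h) n'.isLt
  have h1 := hle n ⟨n.val + 1, hsucc⟩ (Fin.le_def.2 (Nat.le_succ _))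
  have h2 := hle ⟨n.val + 1, hsucc⟩ n' (Fin.le_def.2 (Nat.succ_le_of_lt h))
  refine lt_of_lt_of_le (lt_of_le_of_ne h1 fun h3 => hk (Or.inl ⟨n, ⟨n.val + 1, hsucc⟩, ζ, rfl, ?_⟩))
    h2
  have hs : sg ζ ≠ 0 := by
    rcases Int.units_eq_one_or ζ with rfl | rfl <;> simp [sg]
  exact (mul_left_cancel₀ hs h3).symm

/-- The first band does not vanish off the band-crossing set, and the moduli increase with the band.
Thus the positive and negative bands are separated by zero. -/
theorem signed_pos (hA : A.Admissible) {k : Wave d} (hk : k ∉ A.bandCrossing) (n : Fin J) (ζ : ℤˣ) :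
    0 < sg ζ * A.ω n ζ k := by
  have hJ : 0 < J := n.pos
  have h0 : 0 < sg ζ * A.ω ⟨0, hJ⟩ ζ k := by
    refine lt_of_le_of_ne ?_ fun h => hk (Or.inr (Or.inr ⟨⟨0, hJ⟩, ζ, rfl, ?_⟩))
    · rcases Int.units_eq_one_or ζ with rfl | rfl
      · simpa [sg] using hA.nonneg k hk _
      · simpa [sg] using hA.nonpos k hk _
    · rcases Int.units_eq_one_or ζ with rfl | rfl <;> simpa [sg] using h.symm
  exact h0.trans_le ((A.signed_strictMono hA hk ζ).monotone (Fin.le_def.2 (Nat.zero_le _)))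

/-- The order of the eigenvalues is dictated by the labels (n, ζ) alone, hence is the same at any
two regular points. This identifies bands across different wavevectors. -/
theorem ev_lt_iff (hA : A.Admissible) {k k' : Wave d} (hk : k ∉ A.bandCrossing)
    (hk' : k' ∉ A.bandCrossing) (b b' : Fin J × ℤˣ) : A.ev b k < A.ev b' k ↔ A.ev b k' < A.ev b' k' := by
  obtain ⟨n, ζ⟩ := b
  obtain ⟨n', ζ'⟩ := b'
  have p1 := signed_pos hA hk n ζ
  have p2 := signed_pos hA hk n' ζ'
  have p3 := signed_pos hA hk' n ζ
  have p4 := signed_pos hA hk' n' ζ'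
  have m1 := (A.signed_strictMono hA hk ζ).lt_iff_lt (a := n) (b := n')
  have m2 := (A.signed_strictMono hA hk' ζ).lt_iff_lt (a := n) (b := n')
  have m3 := (A.signed_strictMono hA hk ζ).lt_iff_lt (a := n') (b := n)
  have m4 := (A.signed_strictMono hA hk' ζ).lt_iff_lt (a := n') (b := n)
  simp only [ev]
  rcases Int.units_eq_one_or ζ with rfl | rfl <;> rcases Int.units_eq_one_or ζ' with rfl | rfl <;>
    simp only [sg, Units.val_one, Units.val_neg, Int.cast_one, Int.cast_neg, one_mul, neg_mul,
      neg_lt_neg_iff] at p1 p2 p3 p4 m1 m2 m3 m4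
  · rw [m1, m2]
  · constructor <;> intro <;> linarith
  · constructor <;> intro <;> linarith
  · rw [m3, m4]

theorem ev_injective (hA : A.Admissible) {k : Wave d} (hk : k ∉ A.bandCrossing) :
    Function.Injective fun b => A.ev b k := by
  rintro ⟨n, ζ⟩ ⟨n', ζ'⟩ h
  have p1 := signed_pos hA hk n ζ
  have p2 := signed_pos hA hk n' ζ'
  simp only [ev] at h
  have hζ : ζ = ζ' := by
    rcases Int.units_eq_one_or ζ with rfl | rfl <;>
      rcases Int.units_eq_one_or ζ' with rfl | rfl <;> simp [sg] at p1 p2 ⊢ <;> linarith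
  subst hζ
  rw [Prod.mk.injEq]
  exact ⟨(A.signed_strictMono hA hk ζ).injective (by simp [h]), rfl⟩

theorem L_gv (hA : A.Admissible) {k : Wave d} (hk : k ∉ A.bandCrossing) (b : Fin J × ℤˣ) :
    A.L k (A.gv b k) = (A.ev b k : ℂ) • A.gv b k := hA.eigen k hk b.1 b.2

theorem inner_gv_L (hA : A.Admissible) {k : Wave d} (hk : k ∉ A.bandCrossing) (b : Fin J × ℤˣ)
    (x : Vec J) : inner ℂ (A.gv b k) (A.L k x) = (A.ev b k : ℂ) * inner ℂ (A.gv b k) x := by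
  have hs := (hA.hermitian k).isSymmetric
  rw [← show inner ℂ (A.L k (A.gv b k)) x = inner ℂ (A.gv b k) (A.L k x) from hs _ _,
    L_gv hA hk, inner_smul_left, Complex.conj_ofReal]

theorem orthonormal_gv (hA : A.Admissible) {k : Wave d} (hk : k ∉ A.bandCrossing) :
    Orthonormal ℂ fun b => A.gv b k := by
  refine ⟨fun b => hA.unit k hk b.1 b.2, fun b b' hb => ?_⟩
  have h1 := inner_gv_L hA hk b (A.gv b' k)
  rw [L_gv hA hk, inner_smul_right] at h1
  have h2 : ((A.ev b' k : ℂ) - A.ev b k) * inner ℂ (A.gv b k) (A.gv b' k) = 0 := by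
    rw [sub_mul, h1, sub_self]
  refine (mul_eq_zero.1 h2).resolve_left fun h3 => hb ?_
  rw [sub_eq_zero, Complex.ofReal_inj] at h3
  exact ev_injective hA hk h3.symm

/-- The orthonormal basis of eigenvectors. -/
def eigenbasis (hA : A.Admissible) {k : Wave d} (hk : k ∉ A.bandCrossing) :
    OrthonormalBasis (Fin J × ℤˣ) ℂ (Vec J) :=
  OrthonormalBasis.mk (orthonormal_gv hA hk) (by
    -- There are 2J labels and the space has dimension 2J, so the independent eigenvectors span.
    have h := (orthonormal_gv hA hk).linearIndependent.span_eq_top_of_card_eq_finrank' (by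
      simp [mul_comm])
    exact h.ge)

theorem coe_eigenbasis (hA : A.Admissible) {k : Wave d} (hk : k ∉ A.bandCrossing)
    (b : Fin J × ℤˣ) : eigenbasis hA hk b = A.gv b k := by
  simp [eigenbasis]

theorem sum_bandProj (hA : A.Admissible) {k : Wave d} (hk : k ∉ A.bandCrossing) (x : Vec J) :
    ∑ b, A.bandProj b k x = x := by
  have := (eigenbasis hA hk).sum_repr' x
  simp only [coe_eigenbasis] at this
  exact this

theorem bandProj_gv (hA : A.Admissible) {k : Wave d} (hk : k ∉ A.bandCrossing)
    (b b' : Fin J × ℤˣ) : A.bandProj b k (A.gv b' k) = if b = b' then A.gv b' k else 0 := by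
  rw [bandProj_apply', orthonormal_iff_ite.1 (orthonormal_gv hA hk) b b']
  split_ifs with h
  · rw [h, one_smul]
  · rw [zero_smul]

theorem bandProj_bandProj (hA : A.Admissible) {k : Wave d} (hk : k ∉ A.bandCrossing)
    (b b' : Fin J × ℤˣ) (x : Vec J) :
    A.bandProj b k (A.bandProj b' k x) = if b = b' then A.bandProj b' k x else 0 := by
  rw [bandProj_apply' b' k x, map_smul, bandProj_gv hA hk]
  split_ifs <;> simp

theorem norm_bandProj_le (hA : A.Admissible) {k : Wave d} (hk : k ∉ A.bandCrossing)
    (b : Fin J × ℤˣ) : ‖A.bandProj b k‖ ≤ 1 := by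
  have h : ‖A.gv b k‖ = 1 := hA.unit k hk b.1 b.2
  rw [bandProj, ContinuousLinearMap.norm_smulRight_apply, innerSL_apply_norm, h, one_mul]

theorem flow_bandProj (hA : A.Admissible) {k : Wave d} (hk : k ∉ A.bandCrossing)
    (b : Fin J × ℤˣ) (t : ℝ) (x : Vec J) :
    A.flow t k (A.bandProj b k x) =
      Complex.exp (-(Complex.I * t) * A.ev b k) • A.bandProj b k x := by
  refine exp_apply_of_eigen ?_
  rw [bandProj_apply', map_smul, _root_.smul_apply, L_gv hA hk]
  simp only [smul_smul]
  congr 1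
  ring

theorem bandProj_flow (hA : A.Admissible) {k : Wave d} (hk : k ∉ A.bandCrossing)
    (b : Fin J × ℤˣ) (t : ℝ) (x : Vec J) :
    A.bandProj b k (A.flow t k x) =
      Complex.exp (-(Complex.I * t) * A.ev b k) • A.bandProj b k x := by
  conv_lhs => rw [← sum_bandProj hA hk x]
  simp only [map_sum, flow_bandProj hA hk, map_smul, bandProj_bandProj hA hk]
  simp

/-- Near an approximate eigenvalue there is an eigenvalue. -/
theorem exists_ev_near (hA : A.Admissible) {k : Wave d} (hk : k ∉ A.bandCrossing) {x : Vec J}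
    (hx : ‖x‖ = 1) {a r : ℝ} (hr : ‖A.L k x - (a : ℂ) • x‖ < r) : ∃ b, |A.ev b k - a| < r := by
  by_contra! h
  have hr0 : 0 < r := (norm_nonneg _).trans_lt hr
  have h1 : ∀ b, inner ℂ (A.gv b k) (A.L k x - (a : ℂ) • x) =
      ((A.ev b k - a : ℝ) : ℂ) * inner ℂ (A.gv b k) x := by
    intro b
    rw [inner_sub_right, inner_gv_L hA hk, inner_smul_right, Complex.ofReal_sub, sub_mul]
  have h2 := (eigenbasis hA hk).sum_sq_norm_inner_right (A.L k x - (a : ℂ) • x)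
  have h3 := (eigenbasis hA hk).sum_sq_norm_inner_right x
  simp only [coe_eigenbasis, h1, norm_mul, mul_pow, Complex.norm_real, Real.norm_eq_abs] at h2 h3
  -- By Parseval, a residual of a vector whose spectrum is at distance at least r from a has norm at
  -- least r‖x‖.
  have h4 : r ^ 2 * ‖x‖ ^ 2 ≤ ‖A.L k x - (a : ℂ) • x‖ ^ 2 := by
    rw [← h2, ← h3, Finset.mul_sum]
    gcongr with b
    exact h b
  rw [hx, one_pow, mul_one] at h4
  exact absurd (lt_of_pow_lt_pow_left₀ 2 hr0.le (h4.trans_lt (by gcongr : _ < r ^ 2))) (lt_irrefl _)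

/-- Only the matrix is assumed continuous. Perturbation gives, for each eigenvalue at `k₀`, some
eigenvalue at k close to it; this assignment respects the strict order of the labels, so it must be
the identity on labels. -/
theorem continuousAt_ev (hA : A.Admissible) {k₀ : Wave d} (hk₀ : k₀ ∉ A.bandCrossing)
    (b : Fin J × ℤˣ) : ContinuousAt (A.ev b) k₀ := by
  have hinj := ev_injective hA hk₀
  obtain ⟨γ, hγ, hgap⟩ : ∃ γ > 0, ∀ b b', A.ev b k₀ < A.ev b' k₀ → A.ev b k₀ + γ < A.ev b' k₀ := by
    have : ∀ᶠ γ in 𝓝[>] (0 : ℝ), ∀ b b', A.ev b k₀ < A.ev b' k₀ → A.ev b k₀ + γ < A.ev b' k₀ := by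
      refine eventually_all.2 fun b => eventually_all.2 fun b' => ?_
      by_cases h : A.ev b k₀ < A.ev b' k₀
      · have : ∀ᶠ γ in 𝓝 (0 : ℝ), A.ev b k₀ + γ < A.ev b' k₀ := by
          have hc : ContinuousAt (fun γ : ℝ => A.ev b k₀ + γ) 0 := by fun_prop
          exact hc.eventually_lt continuousAt_const (by simpa using h)
        filter_upwards [nhdsWithin_le_nhds this] with γ hγ _ using hγ
      · exact Eventually.of_forall fun γ h' => absurd h' h
    obtain ⟨γ, h1, h2⟩ := (this.and self_mem_nhdsWithin).exists
    exact ⟨γ, h2, h1⟩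
  rw [Metric.continuousAt_iff']
  intro ε hε
  -- Displacements below half the spectral gap cannot reverse the order of two eigenvalues.
  have hpos : 0 < min ε (γ / 2) := by positivity
  have hL : ∀ᶠ k in 𝓝 k₀, ‖A.L k - A.L k₀‖ < min ε (γ / 2) := by
    exact (tendsto_iff_norm_sub_tendsto_zero.1 (continuousAt_L hk₀)).eventually_lt_const hpos
  filter_upwards [hL, bandCrossing_compl_eventually hA hk₀] with k hk hkσ
  have hex : ∀ b, ∃ b', |A.ev b' k - A.ev b k₀| < min ε (γ / 2) := by
    intro b
    have hu : ‖A.gv b k₀‖ = 1 := hA.unit k₀ hk₀ b.1 b.2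
    refine exists_ev_near hA hkσ hu (lt_of_le_of_lt ?_ hk)
    rw [← L_gv hA hk₀, ← _root_.sub_apply]
    simpa [hu] using (A.L k - A.L k₀).le_opNorm (A.gv b k₀)
  choose f hf using hex
  have hid := eq_self_of_order (p := fun b => A.ev b k₀) (q := fun b => A.ev b k) hinj
    (fun b b' => ev_lt_iff hA hk₀ hkσ b b') (f := f) (fun b b' h => by
      have h1 := abs_lt.1 ((hf b).trans_le (min_le_right _ _))
      have h2 := abs_lt.1 ((hf b').trans_le (min_le_right _ _))
      have h3 := hgap b b' h
      linarith)
  have := hf b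
  rw [hid] at this
  rw [Real.dist_eq]
  exact this.trans_le (min_le_left _ _)

/-- Lagrange interpolation: both sides agree on the eigenbasis. The eigenvectors are chosen
independently at each k and need not be measurable, but this formula uses only the matrix and its
eigenvalues, so the projections are continuous. -/
theorem bandProj_eq_list_prod (hA : A.Admissible) {k : Wave d} (hk : k ∉ A.bandCrossing)
    (b : Fin J × ℤˣ) : A.bandProj b k =
      (((Finset.univ.erase b).toList.map fun b' =>
        ((A.ev b k - A.ev b' k : ℝ) : ℂ)⁻¹ • (A.L k - (A.ev b' k : ℂ) • 1)).prod) := by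
  have hext : ∀ T T' : Vec J →L[ℂ] Vec J, (∀ b, T (A.gv b k) = T' (A.gv b k)) → T = T' := by
    intro T T' h
    ext1 x
    rw [← (eigenbasis hA hk).sum_repr' x]
    simp only [map_sum, map_smul, coe_eigenbasis, h]
  refine hext _ _ fun c => ?_
  have hT : ∀ b', (((A.ev b k - A.ev b' k : ℝ) : ℂ)⁻¹ • (A.L k - (A.ev b' k : ℂ) • 1)) (A.gv c k) =
      (((A.ev b k - A.ev b' k : ℝ) : ℂ)⁻¹ * ((A.ev c k - A.ev b' k : ℝ) : ℂ)) • A.gv c k := by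
    intro b'
    rw [_root_.smul_apply, _root_.sub_apply, L_gv hA hk, _root_.smul_apply,
      one_apply_eq_self, ← sub_smul, smul_smul, Complex.ofReal_sub (A.ev c k)]
  rw [list_prod_apply_of_eigen hT, bandProj_gv hA hk, Finset.prod_map_toList]
  split_ifs with h
  · subst h
    rw [Finset.prod_eq_one, one_smul]
    intro b' hb'
    refine inv_mul_cancel₀ ?_
    rw [Ne, Complex.ofReal_eq_zero, sub_eq_zero]
    exact fun h => (Finset.ne_of_mem_erase hb') (ev_injective hA hk h.symm)
  · rw [Finset.prod_eq_zero (i := c) (Finset.mem_erase.2 ⟨Ne.symm h, Finset.mem_univ _⟩) (by simp),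
      zero_smul]

theorem continuousOn_L : ContinuousOn A.L A.bandCrossingᶜ :=
  fun _ hk => (continuousAt_L hk).continuousWithinAt

theorem continuousOn_ev (hA : A.Admissible) (b : Fin J × ℤˣ) :
    ContinuousOn (A.ev b) A.bandCrossingᶜ :=
  fun _ hk => (continuousAt_ev hA hk b).continuousWithinAt

theorem continuousOn_bandProj (hA : A.Admissible) (b : Fin J × ℤˣ) :
    ContinuousOn (A.bandProj b) A.bandCrossingᶜ := by
  have : ContinuousOn (fun k => ((Finset.univ.erase b).toList.map fun b' =>
      ((A.ev b k - A.ev b' k : ℝ) : ℂ)⁻¹ • (A.L k - (A.ev b' k : ℂ) • 1)).prod)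
      A.bandCrossingᶜ := by
    refine continuousOn_list_prod _ fun b' hb' => ?_
    have hb : b' ≠ b := Finset.ne_of_mem_erase (Finset.mem_toList.1 hb')
    have hinv : ContinuousOn (fun k => ((A.ev b k - A.ev b' k : ℝ) : ℂ)⁻¹) A.bandCrossingᶜ := by
      refine ContinuousOn.inv₀ ?_ ?_
      rotate_left
      · intro k hk
        rw [Ne, Complex.ofReal_eq_zero, sub_eq_zero]
        exact fun h => hb (ev_injective hA hk h.symm)
      exact Complex.continuous_ofReal.comp_continuousOn
        ((continuousOn_ev hA b).sub (continuousOn_ev hA b'))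
    refine hinv.fun_smul (continuousOn_L.sub (ContinuousOn.fun_smul ?_ continuousOn_const))
    exact Complex.continuous_ofReal.comp_continuousOn (continuousOn_ev hA b')
  exact this.congr fun k hk => bandProj_eq_list_prod hA hk b

theorem continuous_exp : Continuous fun T : Vec J →L[ℂ] Vec J => NormedSpace.exp T := by
  let _ := NormedAlgebra.restrictScalars ℚ ℂ (Vec J →L[ℂ] Vec J)
  exact NormedSpace.exp_continuous

theorem continuousOn_flow (t : ℝ) : ContinuousOn (A.flow t) A.bandCrossingᶜ :=
  continuous_exp.comp_continuousOn (continuousOn_const.fun_smul continuousOn_L)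

theorem continuous_flow_time (k : Wave d) : Continuous fun t => A.flow t k := by
  refine continuous_exp.comp (Continuous.fun_smul ?_ continuous_const)
  fun_prop

/-- The complement of the band-crossing set is open and has full measure, so regularity there
suffices for measurability. -/
theorem aesm_of_continuousOn (hA : A.Admissible) {E : Type*} [TopologicalSpace E]
    [TopologicalSpace.PseudoMetrizableSpace E] {f : Wave d → E}
    (hf : ContinuousOn f A.bandCrossingᶜ) : AEStronglyMeasurable f volume := by
  have h := hf.aestronglyMeasurable (μ := volume) hA.closed.isOpen_compl.measurableSet
  have h2 : ∀ᵐ k : Wave d, k ∈ A.bandCrossingᶜ := ae_notMem_bandCrossing hA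
  rwa [Measure.restrict_eq_self_of_ae_mem h2] at h

end LinearPart

/-! ### The nonlinearity as an integral operator -/

namespace LinearPart

variable {d J : ℕ} {A : LinearPart d J}

theorem isBddMul_flow (hA : A.Admissible) (t : ℝ) : IsBddMul (A.flow t) :=
  ⟨aesm_of_continuousOn hA (continuousOn_flow t), 1, ae_of_all _ fun k => norm_flow_le hA t k⟩

theorem isBddMul_bandProj (hA : A.Admissible) (b : Fin J × ℤˣ) : IsBddMul (A.bandProj b) :=
  ⟨aesm_of_continuousOn hA (continuousOn_bandProj hA b), 1, by
    filter_upwards [ae_notMem_bandCrossing hA] with k hk using norm_bandProj_le hA hk b⟩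

theorem propagator_eq (hA : A.Admissible) (t : ℝ) (f : Spec d J) :
    propagator A t f = mulOp (A.flow t) f := by
  have h := integrable_mul_apply (isBddMul_flow hA t) f
  rw [mulOp_apply (isBddMul_flow hA t), propagator, asL1]
  exact dif_pos h

theorem norm_propagator_le (hA : A.Admissible) (t : ℝ) (f : Spec d J) :
    ‖propagator A t f‖ ≤ ‖f‖ := by
  rw [propagator_eq hA]
  simpa using norm_mulOp_le (isBddMul_flow hA t) (ae_of_all _ fun k => norm_flow_le hA t k) f

theorem propagator_sub (hA : A.Admissible) (t : ℝ) (f g : Spec d J) :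
    propagator A t (f - g) = propagator A t f - propagator A t g := by
  simp only [propagator_eq hA, map_sub]

theorem propagator_smul (hA : A.Admissible) (t c : ℝ) (f : Spec d J) :
    propagator A t (c • f) = c • propagator A t f := by
  simp only [propagator_eq hA]
  exact (mulOp (A.flow t)).map_smul_of_tower c f

/-- The tuples of wavevectors that avoid the band-crossing points, with their sum. -/
def goodTuples (A : LinearPart d J) (m : ℕ) : Set (Fin m → Wave d) :=
  {κ | (∑ j, κ j) ∉ A.bandCrossing ∧ ∀ j, κ j ∉ A.bandCrossing}

variable {m : ℕ}

theorem isOpen_goodTuples (hA : A.Admissible) : IsOpen (A.goodTuples m) := by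
  have h1 : IsOpen {κ : Fin m → Wave d | (∑ j, κ j) ∉ A.bandCrossing} :=
    hA.closed.isOpen_compl.preimage (f := fun κ : Fin m → Wave d => ∑ j, κ j) (by fun_prop)
  have h2 : IsOpen {κ : Fin m → Wave d | ∀ j, κ j ∉ A.bandCrossing} := by
    rw [ofPred_forall]
    exact isOpen_iInter_of_finite fun j =>
      hA.closed.isOpen_compl.preimage (f := fun κ : Fin m → Wave d => κ j) (by fun_prop)
  exact h1.inter h2

theorem ae_mem_goodTuples [NeZero m] (hA : A.Admissible) : ∀ᵐ κ, κ ∈ A.goodTuples m := by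
  filter_upwards [ae_sum (m := m) (ae_notMem_bandCrossing hA),
    ae_all_iff.2 fun j : Fin m => ae_eval (ae_notMem_bandCrossing hA) j] with κ h1 h2
  exact ⟨h1, h2⟩

end LinearPart

open LinearPart

/-! ### The nonlinearity in the interaction picture -/

section Interaction

variable {d J m : ℕ} {A : LinearPart d J} {χ : Susceptibility d J m} {C : ℝ}

/-- The normalized susceptibility on tuples of wavevectors. -/
def normalizedTensor (χ : Susceptibility d J m) (κ : Fin m → Wave d) : Tensor m (Vec J) (Vec J) :=
  ((((2 * Real.pi) ^ ((m - 1) * d))⁻¹ : ℝ) : ℂ) • χ (∑ j, κ j) κ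

theorem norm_normalizedTensor_le (hχ : χ.Admissible A C) {κ : Fin m → Wave d}
    (hκ : κ ∈ A.goodTuples m) : ‖normalizedTensor χ κ‖ ≤ C := by
  have h0 : (0 : ℝ) ≤ ((2 * Real.pi) ^ ((m - 1) * d))⁻¹ := by positivity
  rw [normalizedTensor, norm_smul, Complex.norm_real, Real.norm_of_nonneg h0]
  exact hχ.bound _ _ hκ.1 hκ.2

theorem aesm_of_continuousOn_goodTuples [NeZero m] (hA : A.Admissible) {E : Type*}
    [TopologicalSpace E] [TopologicalSpace.PseudoMetrizableSpace E] {f : (Fin m → Wave d) → E}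
    (hf : ContinuousOn f (A.goodTuples m)) : AEStronglyMeasurable f volume := by
  have h := hf.aestronglyMeasurable (μ := volume) (isOpen_goodTuples hA).measurableSet
  rwa [Measure.restrict_eq_self_of_ae_mem (ae_mem_goodTuples hA)] at h

variable [NeZero m]

theorem isBddKernel_normalizedTensor (hA : A.Admissible) (hχ : χ.Admissible A C) :
    IsBddKernel (normalizedTensor χ) := by
  refine ⟨aesm_of_continuousOn_goodTuples hA (continuousOn_const.fun_smul ?_), C, ?_⟩
  · have hc : Continuous fun κ : Fin m → Wave d => ((∑ j, κ j, κ) : Wave d × (Fin m → Wave d)) := by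
      fun_prop
    exact hχ.smooth.continuousOn.comp hc.continuousOn fun κ hκ => hκ
  · filter_upwards [ae_mem_goodTuples hA] with κ hκ using norm_normalizedTensor_le hχ hκ

theorem nonlin_eq (hA : A.Admissible) (hχ : χ.Admissible A C) (U : Spec d J) :
    nonlin χ U = kerOp (normalizedTensor χ) fun _ => U := by
  have hK := isBddKernel_normalizedTensor hA hχ
  have hfun : (fun k => ((2 * Real.pi) ^ ((m - 1) * d))⁻¹ •
      ∫ κ : Fin (m - 1) → Wave d, χ k (convVec m k κ) fun j => U (convVec m k κ j)) =
      fiberIntegral m (kerFun (normalizedTensor χ) fun _ => U) := by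
    funext k
    rw [fiberIntegral, ← integral_smul]
    refine integral_congr_ae (ae_of_all _ fun κ => ?_)
    simp only [kerFun, normalizedTensor, sum_convVec]
    rw [_root_.smul_apply, Complex.coe_smul]
  rw [nonlin, hfun, kerOp_apply hK, asL1]
  exact dif_pos (integrable_fiberIntegral (integrable_kerFun hK _))

/-- The kernel of the nonlinearity in the interaction picture. -/
def interactionKernel (A : LinearPart d J) (χ : Susceptibility d J m) (t : ℝ)
    (κ : Fin m → Wave d) : Tensor m (Vec J) (Vec J) :=
  (A.flow (-t) (∑ j, κ j)).compContinuousMultilinearMap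
    ((normalizedTensor χ κ).compContinuousLinearMap fun j => A.flow t (κ j))

theorem isBddKernel_interactionKernel (hA : A.Admissible) (hχ : χ.Admissible A C) (t : ℝ) :
    IsBddKernel (interactionKernel A χ t) :=
  IsBddKernel.mul_comp (isBddMul_flow hA (-t))
    ((isBddKernel_normalizedTensor hA hχ).comp_mul fun _ => isBddMul_flow hA t)

theorem norm_interactionKernel_le (hA : A.Admissible) (hχ : χ.Admissible A C) (t : ℝ)
    {κ : Fin m → Wave d} (hκ : κ ∈ A.goodTuples m) : ‖interactionKernel A χ t κ‖ ≤ C := by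
  have h := norm_normalizedTensor_le hχ hκ
  have hC : 0 ≤ C := (norm_nonneg _).trans h
  refine (ContinuousLinearMap.norm_compContinuousMultilinearMap_le _ _).trans ?_
  have h2 := ContinuousMultilinearMap.norm_compContinuousLinearMap_le (normalizedTensor χ κ)
    fun j => A.flow t (κ j)
  have h3 : ∏ j, ‖A.flow t (κ j)‖ ≤ 1 :=
    Finset.prod_le_one (fun _ _ => norm_nonneg _) fun j _ => norm_flow_le hA t _
  calc _ ≤ 1 * (C * 1) := by
        refine mul_le_mul (norm_flow_le hA _ _) (h2.trans ?_) (norm_nonneg _) zero_le_one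
        gcongr
    _ = C := by ring

/-- Continuity in time holds for each tuple separately, without uniformity since the symbol may be
unbounded; dominated convergence then makes the operator strongly continuous. -/
theorem continuous_interactionKernel (κ : Fin m → Wave d) :
    Continuous fun t => interactionKernel A χ t κ := by
  have h1 : Continuous fun t => A.flow (-t) (∑ j, κ j) :=
    (continuous_flow_time _).comp continuous_neg
  have h2 : Continuous fun t =>
      (normalizedTensor χ κ).compContinuousLinearMap fun j => A.flow t (κ j) :=
    continuous_compContinuousLinearMap.comp
      (continuous_const.prodMk (continuous_pi fun j => continuous_flow_time (κ j)))
  exact ((ContinuousLinearMap.compContinuousMultilinearMapL ℂ (fun _ : Fin m => Vec J)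
    (Vec J) (Vec J)).isBoundedBilinearMap.continuous).comp (h1.prodMk h2)

theorem propagator_nonlin_propagator (hA : A.Admissible) (hχ : χ.Admissible A C) (t : ℝ)
    (u : Spec d J) : propagator A (-t) (nonlin χ (propagator A t u)) =
      kerOp (interactionKernel A χ t) fun _ => u := by
  have hK := isBddKernel_normalizedTensor hA hχ
  rw [propagator_eq hA, nonlin_eq hA hχ, propagator_eq hA, kerOp_mulOp (isBddMul_flow hA t) hK,
    mulOp_kerOp (isBddMul_flow hA (-t)) (hK.comp_mul fun _ => isBddMul_flow hA t)]
  rfl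

theorem isPowerField_interaction (hA : A.Admissible) (hχ : χ.Admissible A C) {C' : ℝ}
    (hC' : 0 ≤ C') (hCC' : C ≤ C') :
    IsPowerField (fun t (u : Spec d J) => kerOp (interactionKernel A χ t) fun _ => u) C' m := by
  have hb : ∀ t, ∀ᵐ κ, ‖interactionKernel A χ t κ‖ ≤ C' := fun t => by
    filter_upwards [ae_mem_goodTuples hA] with κ hκ
    exact (norm_interactionKernel_le hA hχ t hκ).trans hCC'
  have hK := isBddKernel_interactionKernel hA hχ
  exact IsPowerField.of_multilinear hC' (fun t => norm_kerOp_le (hK t) hC' (hb t)) fun x =>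
    continuous_kerOp_apply hK hb (ae_of_all _ fun κ => continuous_interactionKernel κ) _

/-- F-solutions in terms of the rescaled slow variable. -/
theorem IsFSolution.exists_slow (hA : A.Admissible) (hχ : χ.Admissible A C) {T ρ γ : ℝ}
    (hγ : 0 < γ) (hγρ : γ ^ m = γ * ρ) {h : Spec d J} {V : ℝ → Wave d → Vec J}
    {Vhat : ℝ → Spec d J} (hV : IsFSolution A χ T (γ • h) V Vhat) :
    ∃ v : ℝ → Spec d J, ContinuousOn v (Icc 0 T) ∧
      (∀ t ∈ Icc 0 T, γ⁻¹ • Vhat t = propagator A t (v t)) ∧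
      ∀ t ∈ Icc 0 T, v t =
        h + ρ • ∫ t' in (0 : ℝ)..t, kerOp (interactionKernel A χ t') fun _ => v t' := by
  obtain ⟨-, u, hu, hVu, hint⟩ := hV
  refine ⟨fun t => γ⁻¹ • u t, hu.const_smul γ⁻¹, fun t ht => ?_, fun t ht => ?_⟩
  · rw [hVu t ht, propagator_smul hA]
  · have hscale : ∀ t', (kerOp (interactionKernel A χ t') fun _ => γ⁻¹ • u t') =
        (γ ^ m)⁻¹ • kerOp (interactionKernel A χ t') fun _ => u t' := by
      intro t'
      have := (kerOp (interactionKernel A χ t')).map_smul_univ (fun _ => ((γ⁻¹ : ℝ) : ℂ))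
        fun _ => u t'
      rw [Finset.prod_const, Finset.card_univ, Fintype.card_fin, ← Complex.ofReal_pow, inv_pow]
        at this
      exact this
    change γ⁻¹ • u t = _
    simp only [hscale]
    rw [hint t ht, intervalIntegral.integral_smul, smul_add, smul_smul, inv_mul_cancel₀ hγ.ne',
      one_smul]
    simp only [propagator_nonlin_propagator hA hχ]
    congr 1
    -- The scalar in front of the integral is (γ^m)⁻¹ before the scaling is undone; with γ^m = γρ
    -- the product ρ(γ^m)⁻¹ equals γ⁻¹.
    rw [smul_smul, hγρ]
    rcases eq_or_ne ρ 0 with rfl | hρ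
    · exact absurd hγρ (by simp [hγ.ne'])
    · congr 1
      field_simp

theorem exists_isFSolution (hA : A.Admissible) (hχ : χ.Admissible A C) {T ρ γ : ℝ}
    (hγρ : γ ^ m = γ * ρ) {h : Spec d J} {v : ℝ → Spec d J} (hv : ContinuousOn v (Icc 0 T))
    (hint : ∀ t ∈ Icc 0 T, v t =
      h + ρ • ∫ t' in (0 : ℝ)..t, kerOp (interactionKernel A χ t') fun _ => v t') :
    ∃ V Vhat, IsFSolution A χ T (γ • h) V Vhat := by
  -- The function in physical space is left to unification with its defining inverse Fourier
  -- integral.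
  refine ⟨_, fun t => propagator A t (γ • v t), fun t _ r => rfl, fun t => γ • v t,
    hv.const_smul γ, fun t _ => rfl, fun t ht => ?_⟩
  have hscale : ∀ t', (kerOp (interactionKernel A χ t') fun _ => γ • v t') =
      (γ ^ m) • kerOp (interactionKernel A χ t') fun _ => v t' := by
    intro t'
    have := (kerOp (interactionKernel A χ t')).map_smul_univ (fun _ => ((γ : ℝ) : ℂ))
      fun _ => v t'
    rw [Finset.prod_const, Finset.card_univ, Fintype.card_fin, ← Complex.ofReal_pow] at this
    exact this
  simp only [propagator_nonlin_propagator hA hχ, hscale]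
  rw [intervalIntegral.integral_smul, hγρ, mul_smul, ← smul_add, ← hint t ht]

end Interaction

/-! ### Oscillating kernels -/

section Oscillation

variable {d m : ℕ} {Y Z : Type*} [NormedAddCommGroup Y] [NormedSpace ℂ Y] [NormedAddCommGroup Z]
  [NormedSpace ℂ Z]

/-- The factor `e^{itφ}`. -/
def osc (t φ : ℝ) : ℂ := Complex.exp (Complex.I * t * φ)

/-- The primitive `e^{itφ} / (iφ)` of `e^{itφ}` in time. -/
def oscPrim (t φ : ℝ) : ℂ := osc t φ / (Complex.I * φ)

theorem norm_osc (t φ : ℝ) : ‖osc t φ‖ = 1 := by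
  rw [osc, show Complex.I * t * φ = ((t * φ : ℝ) : ℂ) * Complex.I by push_cast; ring]
  exact Complex.norm_exp_ofReal_mul_I _

theorem norm_oscPrim (t φ : ℝ) : ‖oscPrim t φ‖ = |φ|⁻¹ := by
  rw [oscPrim, norm_div, norm_osc, norm_mul, Complex.norm_I, Complex.norm_real, Real.norm_eq_abs,
    one_mul, one_div]

/-- The second-order Taylor remainder of e^{ihφ} is at most (hφ)²; division by |φ| leaves |φ|h². The
bound depends only on the upper bound of the phase, hence is uniform over tuples. -/
theorem norm_oscPrim_sub_le {t h φ B : ℝ} (hφ : φ ≠ 0) (hB : |φ| ≤ B) (hh : |h| * B ≤ 1) :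
    ‖oscPrim (t + h) φ - oscPrim t φ - h * osc t φ‖ ≤ B * h ^ 2 := by
  have hφ' : (φ : ℂ) ≠ 0 := by exact_mod_cast hφ
  have hI := Complex.I_ne_zero
  have h1 : oscPrim (t + h) φ - oscPrim t φ - h * osc t φ =
      oscPrim t φ * (Complex.exp (Complex.I * h * φ) - 1 - Complex.I * h * φ) := by
    have : osc (t + h) φ = osc t φ * Complex.exp (Complex.I * h * φ) := by
      rw [osc, osc, ← Complex.exp_add]
      congr 1
      push_cast
      ring
    rw [oscPrim, oscPrim, this]
    field_simp
  have h2 : ‖Complex.I * h * φ‖ = |h| * |φ| := by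
    rw [norm_mul, norm_mul, Complex.norm_I, Complex.norm_real, Complex.norm_real, one_mul]
    rfl
  have h3 : ‖Complex.I * h * φ‖ ≤ 1 := by
    rw [h2]
    refine le_trans ?_ hh
    gcongr
  have h4 : 0 < |φ| := abs_pos.2 hφ
  rw [h1, norm_mul, norm_oscPrim]
  calc |φ|⁻¹ * ‖Complex.exp (Complex.I * h * φ) - 1 - Complex.I * h * φ‖
      ≤ |φ|⁻¹ * (|h| * |φ|) ^ 2 := by
        gcongr
        rw [← h2]
        exact Complex.norm_exp_sub_one_sub_id_le h3
    _ = |φ| * h ^ 2 := by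
        rw [mul_pow, sq_abs]
        field_simp
    _ ≤ B * h ^ 2 := by gcongr

variable {φ : (Fin m → Wave d) → ℝ} {K : (Fin m → Wave d) → Tensor m Y Z} {a B : ℝ}

theorem IsBddKernel.osc_smul (hK : IsBddKernel K) (hφ : AEStronglyMeasurable φ volume) (t : ℝ) :
    IsBddKernel fun κ => osc t (φ κ) • K κ := by
  refine hK.smul_fun (B := 1) ?_ (ae_of_all _ fun κ => Or.inr (norm_osc _ _).le)
  have : Continuous fun x : ℝ => osc t x := by
    unfold osc
    fun_prop
  exact this.comp_aestronglyMeasurable hφ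

theorem IsBddKernel.oscPrim_smul (hK : IsBddKernel K) (hφ : AEStronglyMeasurable φ volume)
    (ha : 0 < a) (hb : ∀ᵐ κ, K κ = 0 ∨ a ≤ |φ κ| ∧ |φ κ| ≤ B) (t : ℝ) :
    IsBddKernel fun κ => oscPrim t (φ κ) • K κ := by
  refine hK.smul_fun (B := a⁻¹) ?_ ?_
  · have h1 : Measurable fun x : ℝ => oscPrim t x := by
      unfold oscPrim osc
      fun_prop
    exact (h1.comp_aemeasurable hφ.aemeasurable).aestronglyMeasurable
  · filter_upwards [hb] with κ h
    refine h.imp_right fun h => ?_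
    rw [norm_oscPrim]
    gcongr
    exact h.1

variable [NeZero m] [NormedSpace ℝ Z] [IsScalarTower ℝ ℂ Z]

theorem norm_kerOp_oscPrim_le (hK : IsBddKernel K) (hφ : AEStronglyMeasurable φ volume)
    (ha : 0 < a) (hb : ∀ᵐ κ, K κ = 0 ∨ a ≤ |φ κ| ∧ |φ κ| ≤ B) {C : ℝ} (hC0 : 0 ≤ C)
    (hC : ∀ᵐ κ, ‖K κ‖ ≤ C) (t : ℝ) : ‖kerOp fun κ => oscPrim t (φ κ) • K κ‖ ≤ C / a := by
  refine norm_kerOp_le (hK.oscPrim_smul hφ ha hb t) (by positivity) ?_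
  filter_upwards [hb, hC] with κ h1 h2
  rcases h1 with h1 | h1
  · rw [h1, smul_zero, norm_zero]
    positivity
  · rw [norm_smul, norm_oscPrim, mul_comm, div_eq_mul_inv]
    gcongr
    exact h1.1

/-- The derivative exists in operator norm, which the product rule along a moving state requires.
This is where the phase must be bounded above; its lower bound makes the primitive a bounded kernel.
-/
theorem hasDerivAt_kerOp_oscPrim (hK : IsBddKernel K) (hφ : AEStronglyMeasurable φ volume)
    (ha : 0 < a) (hb : ∀ᵐ κ, K κ = 0 ∨ a ≤ |φ κ| ∧ |φ κ| ≤ B) (t : ℝ) :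
    HasDerivAt (fun t => kerOp fun κ => oscPrim t (φ κ) • K κ)
      (kerOp fun κ => osc t (φ κ) • K κ) t := by
  obtain ⟨C, hC⟩ := hK.bdd
  rw [hasDerivAt_iff_isLittleO_nhds_zero]
  refine Asymptotics.IsBigO.trans_isLittleO (g := fun h : ℝ => h ^ 2) ?_
    (Asymptotics.isLittleO_pow_id one_lt_two)
  refine Asymptotics.IsBigO.of_bound (max B 0 * max C 0) ?_
  have hsmall : ∀ᶠ h : ℝ in 𝓝 0, |h| * max B 0 ≤ 1 := by
    have hc : Continuous fun h : ℝ => |h| * max B 0 := by fun_prop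
    have := hc.tendsto 0
    simp only [abs_zero, zero_mul] at this
    exact (this.eventually_lt_const one_pos).mono fun _ h => h.le
  filter_upwards [hsmall] with h hh
  have hp := hK.oscPrim_smul hφ ha hb
  have ho := hK.osc_smul hφ t
  have e1 : (h • kerOp fun κ => osc t (φ κ) • K κ) =
      kerOp fun κ => (h : ℂ) • osc t (φ κ) • K κ := by
    rw [kerOp_smul ho]
    exact (algebraMap_smul ℂ h _).symm
  have hsub : IsBddKernel fun κ => oscPrim (t + h) (φ κ) • K κ - oscPrim t (φ κ) • K κ := by
    simpa [sub_eq_add_neg] using (hp (t + h)).add ((hp t).smul (-1))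
  have hsub2 : IsBddKernel fun κ => (oscPrim (t + h) (φ κ) • K κ - oscPrim t (φ κ) • K κ) -
      (h : ℂ) • osc t (φ κ) • K κ := by
    simpa [sub_eq_add_neg] using hsub.add ((ho.smul (h : ℂ)).smul (-1))
  rw [e1, ← kerOp_sub (hp (t + h)) (hp t), ← kerOp_sub hsub (ho.smul (h : ℂ))]
  refine (norm_kerOp_le hsub2 (C := max B 0 * h ^ 2 * max C 0) (by positivity) ?_).trans ?_
  · filter_upwards [hb, hC] with κ h1 h2
    rcases h1 with h1 | h1
    · simp only [h1, smul_zero, sub_zero, norm_zero]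
      positivity
    · rw [smul_smul, ← sub_smul, ← sub_smul, norm_smul]
      gcongr
      · exact norm_oscPrim_sub_le (abs_pos.1 (ha.trans_le h1.1)) (h1.2.trans (le_max_left _ _)) hh
      · exact h2.trans (le_max_left _ _)
  · rw [Real.norm_of_nonneg (sq_nonneg h)]
    exact le_of_eq (by ring)

end Oscillation

/-! ### The system of packet components -/

/-- Packets with centers `c` and bands `b`, together with a localization radius for which packets
with different centers are separated and the phases of the nonresonant interactions are bounded
from both sides. -/
structure PacketFamily {d J : ℕ} (A : LinearPart d J) (m : ℕ) (I : Type*) where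
  c : I → Wave d
  b : I → Fin J × ℤˣ
  δ : ℝ
  low : ℝ
  high : ℝ
  δ_pos : 0 < δ
  low_pos : 0 < low
  inj : ∀ i i', c i = c i' → b i = b i' → i = i'
  sep : ∀ k i i', ‖k - c i‖ ≤ δ → ‖k - c i'‖ ≤ δ → c i = c i'
  phase_bound : ∀ (q : Fin m → I) (b' : Fin J × ℤˣ), (∀ i, c i = ∑ j, c (q j) → b i ≠ b') →
    ∀ κ : Fin m → Wave d, (∀ j, ‖κ j - c (q j)‖ ≤ δ) →
      low ≤ |A.ev b' (∑ j, κ j) - ∑ j, A.ev (b (q j)) (κ j)| ∧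
        |A.ev b' (∑ j, κ j) - ∑ j, A.ev (b (q j)) (κ j)| ≤ high

/-- A bounded weight, submultiplicative for sums of `m` terms, with `1 / W ≤ θ` outside of the ball
of radius `r`. -/
structure IsWeight {d : ℕ} (m : ℕ) (W : Wave d → ℝ) (r θ : ℝ) : Prop where
  measurable : Measurable W
  one_le : ∀ η, 1 ≤ W η
  bdd : ∃ B, ∀ η, W η ≤ B
  submul : ∀ η : Fin m → Wave d, W (∑ j, η j) ≤ ∏ j, W (η j)
  tail : ∀ η, r < ‖η‖ → (W η)⁻¹ ≤ θ

open Classical in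
/-- The indicator function of the closed ball of radius `r`. -/
def ballInd {d : ℕ} (r : ℝ) (η : Wave d) : ℝ := if ‖η‖ ≤ r then 1 else 0

theorem ballInd_nonneg {d : ℕ} (r : ℝ) (η : Wave d) : 0 ≤ ballInd r η := by
  unfold ballInd; split_ifs <;> simp

theorem ballInd_le_one {d : ℕ} (r : ℝ) (η : Wave d) : ballInd r η ≤ 1 := by
  unfold ballInd; split_ifs <;> simp

theorem ballInd_mul_self {d : ℕ} (r : ℝ) (η : Wave d) : ballInd r η * ballInd r η = ballInd r η := by
  unfold ballInd; split_ifs <;> simp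

theorem ballInd_of_le {d : ℕ} {r : ℝ} {η : Wave d} (h : ‖η‖ ≤ r) : ballInd r η = 1 := if_pos h

theorem ballInd_of_lt {d : ℕ} {r : ℝ} {η : Wave d} (h : r < ‖η‖) : ballInd r η = 0 :=
  if_neg h.not_ge

theorem measurable_ballInd {d : ℕ} (r : ℝ) : Measurable (ballInd r : Wave d → ℝ) :=
  Measurable.ite (measurableSet_le measurable_norm measurable_const) measurable_const
    measurable_const

/-- The state space of a system of packets. -/
abbrev PacketVec (J : ℕ) (I : Type*) := PiLp 1 fun _ : I => Vec J

section PacketVec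

variable {J : ℕ} {I : Type*} [Fintype I]

/-- The component of a packet. -/
def packetProj (J : ℕ) (i : I) : PacketVec J I →L[ℂ] Vec J := PiLp.proj 1 (fun _ : I => Vec J) i

open Classical in
/-- A state with a single nonzero component. -/
def packetInj (J : ℕ) (i : I) : Vec J →L[ℂ] PacketVec J I :=
  (PiLp.continuousLinearEquiv 1 ℂ fun _ : I => Vec J).symm.toContinuousLinearMap ∘L
    ContinuousLinearMap.single ℂ (fun _ : I => Vec J) i

theorem packetProj_apply (i : I) (y : PacketVec J I) : packetProj J i y = y i := rfl

open Classical in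
theorem packetInj_apply (i i' : I) (x : Vec J) :
    packetInj J i x i' = if i' = i then x else 0 := by
  simp [packetInj]

end PacketVec

theorem IsBddMul.const {d : ℕ} {Y Z : Type*} [NormedAddCommGroup Y] [NormedSpace ℂ Y]
    [NormedAddCommGroup Z] [NormedSpace ℂ Z] (L : Y →L[ℂ] Z) : IsBddMul fun _ : Wave d => L :=
  ⟨aestronglyMeasurable_const, ‖L‖, ae_of_all _ fun _ => le_rfl⟩

theorem IsBddMul.real_smul {d : ℕ} {Y Z : Type*} [NormedAddCommGroup Y] [NormedSpace ℂ Y]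
    [NormedAddCommGroup Z] [NormedSpace ℂ Z] {T : Wave d → Y →L[ℂ] Z} (hT : IsBddMul T)
    {a : Wave d → ℝ} (ha : Measurable a) {B : ℝ} (hB : ∀ k, |a k| ≤ B) :
    IsBddMul fun k => (a k : ℂ) • T k := by
  obtain ⟨C, hC⟩ := hT.bdd
  refine ⟨(Complex.measurable_ofReal.comp ha).aestronglyMeasurable.smul hT.aesm, B * C, ?_⟩
  filter_upwards [hC] with k h
  have := (abs_nonneg _).trans (hB k)
  rw [norm_smul, Complex.norm_real, Real.norm_eq_abs]
  gcongr
  exact hB k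

theorem IsBddMul.sum {d : ℕ} {Y Z ι : Type*} [NormedAddCommGroup Y] [NormedSpace ℂ Y]
    [NormedAddCommGroup Z] [NormedSpace ℂ Z] (s : Finset ι) {T : ι → Wave d → Y →L[ℂ] Z}
    (hT : ∀ i ∈ s, IsBddMul (T i)) : IsBddMul fun k => ∑ i ∈ s, T i k := by
  choose! C hC using fun i (hi : i ∈ s) => (hT i hi).bdd
  refine ⟨Finset.aestronglyMeasurable_fun_sum _ fun i hi => (hT i hi).aesm, ∑ i ∈ s, C i, ?_⟩
  have : ∀ᵐ k, ∀ i ∈ s, ‖T i k‖ ≤ C i := (ae_ball_iff s.countable_toSet).2 fun i hi => hC i hi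
  filter_upwards [this] with k h
  exact (norm_sum_le _ _).trans (Finset.sum_le_sum h)

namespace IsWeight

variable {d m : ℕ} {W : Wave d → ℝ} {r θ : ℝ}

theorem pos (hW : IsWeight m W r θ) (η : Wave d) : 0 < W η := one_pos.trans_le (hW.one_le η)

theorem inv_le_one (hW : IsWeight m W r θ) (η : Wave d) : (W η)⁻¹ ≤ 1 :=
  inv_le_one_of_one_le₀ (hW.one_le η)

end IsWeight

theorem norm_packetInj {J : ℕ} {I : Type*} [Fintype I] (i : I) (x : Vec J) :
    ‖packetInj J i x‖ = ‖x‖ := by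
  classical
  rw [PiLp.norm_eq_of_L1, Finset.sum_eq_single i]
  · simp [packetInj_apply]
  · intro i' _ h
    simp [packetInj_apply, h]
  · simp

theorem packetProj_packetInj {J : ℕ} {I : Type*} [Fintype I] [DecidableEq I] (i i' : I)
    (x : Vec J) : packetProj J i' (packetInj J i x) = if i' = i then x else 0 := by
  rw [packetProj_apply, packetInj_apply]
  congr

theorem sum_norm_packetProj {J : ℕ} {I : Type*} [Fintype I] (y : PacketVec J I) :
    ∑ i, ‖packetProj J i y‖ = ‖y‖ := (PiLp.norm_eq_of_L1 y).symm

/-! ### The kernels of the packet system, their bounds and the decomposition -/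

namespace PacketFamily

variable {d J m : ℕ} {A : LinearPart d J} {I : Type*} [Fintype I] (F : PacketFamily A m I)

/-- The localized projection onto the band of a packet. -/
def locProj (i : I) (k : Wave d) : Vec J →L[ℂ] Vec J :=
  (ballInd F.δ (k - F.c i) : ℂ) • A.bandProj (F.b i) k

/-- The contribution of a component of the weighted state to the solution. -/
def inputMul (W : Wave d → ℝ) (i : I) (k : Wave d) : PacketVec J I →L[ℂ] Vec J :=
  (((W (k - F.c i))⁻¹ : ℝ) : ℂ) • (F.locProj i k ∘L packetProj J i)

/-- The solution as a function of the weighted state. -/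
def collect (W : Wave d → ℝ) (k : Wave d) : PacketVec J I →L[ℂ] Vec J :=
  ∑ i, F.inputMul W i k

/-- The localized and weighted component of a vector. -/
def outputMul (W : Wave d → ℝ) (i : I) (k : Wave d) : Vec J →L[ℂ] PacketVec J I :=
  (W (k - F.c i) : ℂ) • (packetInj J i ∘L F.locProj i k)

/-- The part of the band of a packet outside of its ball. -/
def tailMul (i : I) (k : Wave d) : Vec J →L[ℂ] Vec J :=
  ((1 - ballInd F.δ (k - F.c i) : ℝ) : ℂ) • A.bandProj (F.b i) k

open Classical in
/-- The interactions with output centered at a packet. -/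
def resSet : Finset ((Fin m → I) × I) :=
  Finset.univ.filter fun p => F.c p.2 = ∑ j, F.c (p.1 j)

open Classical in
/-- The interactions with an output band that belongs to no packet. -/
def nonresSet : Finset ((Fin m → I) × (Fin J × ℤˣ)) :=
  Finset.univ.filter fun p => ∀ i, F.c i = ∑ j, F.c (p.1 j) → F.b i ≠ p.2

/-- The phase of an interaction. -/
def phase (p : (Fin m → I) × (Fin J × ℤˣ)) (κ : Fin m → Wave d) : ℝ :=
  A.ev p.2 (∑ j, κ j) - ∑ j, A.ev (F.b (p.1 j)) (κ j)

variable (χ : Susceptibility d J m) (W : Wave d → ℝ)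

/-- The interaction of given packets. -/
def inputKernel (t : ℝ) (q : Fin m → I) (κ : Fin m → Wave d) : Tensor m (PacketVec J I) (Vec J) :=
  (interactionKernel A χ t κ).compContinuousLinearMap fun j => F.inputMul W (q j) (κ j)

/-- The kernel of the system of packet components. -/
def systemKernel (t : ℝ) (κ : Fin m → Wave d) : Tensor m (PacketVec J I) (PacketVec J I) :=
  ∑ p ∈ F.resSet, (F.outputMul W p.2 (∑ j, κ j)).compContinuousMultilinearMap
    (F.inputKernel χ W t p.1 κ)

/-- The interactions of packets with output in the band of a packet, outside of its ball. -/
def tailKernel (t : ℝ) (κ : Fin m → Wave d) : Tensor m (PacketVec J I) (Vec J) :=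
  ∑ p ∈ F.resSet, (F.tailMul p.2 (∑ j, κ j)).compContinuousMultilinearMap
    (F.inputKernel χ W t p.1 κ)

/-- The interaction of given packets into a given band, without the oscillating factor. -/
def baseKernel (p : (Fin m → I) × (Fin J × ℤˣ)) (κ : Fin m → Wave d) :
    Tensor m (PacketVec J I) (Vec J) :=
  (A.bandProj p.2 (∑ j, κ j)).compContinuousMultilinearMap
    ((normalizedTensor χ κ).compContinuousLinearMap fun j => F.inputMul W (p.1 j) (κ j))

/-- The nonresonant interactions. -/
def nonresKernel (t : ℝ) (κ : Fin m → Wave d) : Tensor m (PacketVec J I) (Vec J) :=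
  ∑ p ∈ F.nonresSet, osc t (F.phase p κ) • F.baseKernel χ W p κ

/-- The primitive in time of the nonresonant interactions. -/
def primKernel (t : ℝ) (κ : Fin m → Wave d) : Tensor m (PacketVec J I) (Vec J) :=
  ∑ p ∈ F.nonresSet, oscPrim t (F.phase p κ) • F.baseKernel χ W p κ

variable {χ W} {C r θ : ℝ}

/-! Measurability. -/

theorem measurable_sub_center (i : I) : Measurable fun k : Wave d => k - F.c i :=
  measurable_id.sub_const _

theorem isBddMul_locProj (hA : A.Admissible) (i : I) : IsBddMul (F.locProj i) :=
  (isBddMul_bandProj hA (F.b i)).real_smul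
    ((measurable_ballInd F.δ).comp (F.measurable_sub_center i)) (B := 1) fun k => by
      rw [abs_of_nonneg (ballInd_nonneg _ _)]
      exact ballInd_le_one _ _

theorem isBddMul_tailMul (hA : A.Admissible) (i : I) : IsBddMul (F.tailMul i) :=
  (isBddMul_bandProj hA (F.b i)).real_smul
    (((measurable_ballInd F.δ).comp (F.measurable_sub_center i)).const_sub 1) (B := 1) fun k => by
      rw [abs_of_nonneg (sub_nonneg.2 (ballInd_le_one _ _))]
      exact sub_le_self _ (ballInd_nonneg _ _)

theorem isBddMul_inputMul (hA : A.Admissible) (hW : IsWeight m W r θ) (i : I) :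
    IsBddMul (F.inputMul W i) :=
  ((F.isBddMul_locProj hA i).comp (IsBddMul.const _)).real_smul
    ((hW.measurable.comp (F.measurable_sub_center i)).inv) (B := 1) fun k => by
      rw [abs_of_nonneg (inv_nonneg.2 (hW.pos _).le)]
      exact hW.inv_le_one _

theorem isBddMul_collect (hA : A.Admissible) (hW : IsWeight m W r θ) : IsBddMul (F.collect W) :=
  IsBddMul.sum _ fun i _ => F.isBddMul_inputMul hA hW i

theorem isBddMul_outputMul (hA : A.Admissible) (hW : IsWeight m W r θ) (i : I) :
    IsBddMul (F.outputMul W i) := by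
  obtain ⟨B, hB⟩ := hW.bdd
  refine ((IsBddMul.const _).comp (F.isBddMul_locProj hA i)).real_smul
    (hW.measurable.comp (F.measurable_sub_center i)) (B := B) fun k => ?_
  rw [abs_of_nonneg (hW.pos _).le]
  exact hB _

variable [NeZero m]

theorem isBddKernel_inputKernel (hA : A.Admissible) (hχ : χ.Admissible A C)
    (hW : IsWeight m W r θ) (t : ℝ) (q : Fin m → I) : IsBddKernel (F.inputKernel χ W t q) :=
  (isBddKernel_interactionKernel hA hχ t).comp_mul fun j => F.isBddMul_inputMul hA hW (q j)

theorem isBddKernel_systemKernel (hA : A.Admissible) (hχ : χ.Admissible A C)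
    (hW : IsWeight m W r θ) (t : ℝ) : IsBddKernel (F.systemKernel χ W t) :=
  IsBddKernel.sum _ fun p _ => IsBddKernel.mul_comp (F.isBddMul_outputMul hA hW p.2)
    (F.isBddKernel_inputKernel hA hχ hW t p.1)

theorem isBddKernel_tailKernel (hA : A.Admissible) (hχ : χ.Admissible A C)
    (hW : IsWeight m W r θ) (t : ℝ) : IsBddKernel (F.tailKernel χ W t) :=
  IsBddKernel.sum _ fun p _ => IsBddKernel.mul_comp (F.isBddMul_tailMul hA p.2)
    (F.isBddKernel_inputKernel hA hχ hW t p.1)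

theorem isBddKernel_baseKernel (hA : A.Admissible) (hχ : χ.Admissible A C)
    (hW : IsWeight m W r θ) (p : (Fin m → I) × (Fin J × ℤˣ)) :
    IsBddKernel (F.baseKernel χ W p) :=
  IsBddKernel.mul_comp (isBddMul_bandProj hA p.2) ((isBddKernel_normalizedTensor hA hχ).comp_mul
    fun j => F.isBddMul_inputMul hA hW (p.1 j))

theorem aesm_phase (hA : A.Admissible) (p : (Fin m → I) × (Fin J × ℤˣ)) :
    AEStronglyMeasurable (F.phase p) volume := by
  refine (aesm_comp_sum (aesm_of_continuousOn hA (continuousOn_ev hA p.2))).sub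
    (Finset.aestronglyMeasurable_fun_sum _ fun j _ => ?_)
  exact (aesm_of_continuousOn hA (continuousOn_ev hA (F.b (p.1 j)))).comp_quasiMeasurePreserving
    (Measure.quasiMeasurePreserving_eval _ j)

theorem continuous_systemKernel (κ : Fin m → Wave d) :
    Continuous fun t => F.systemKernel χ W t κ := by
  refine continuous_finsetSum _ fun p _ => ?_
  have h1 : Continuous fun t => F.inputKernel χ W t p.1 κ :=
    continuous_compContinuousLinearMap.comp
      ((continuous_interactionKernel κ).prodMk continuous_const)
  exact ((ContinuousLinearMap.compContinuousMultilinearMapL ℂ (fun _ : Fin m => PacketVec J I)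
    (Vec J) (PacketVec J I)) (F.outputMul W p.2 (∑ j, κ j))).continuous.comp h1

/-! Bounds. -/

theorem norm_inputMul_apply_le (hA : A.Admissible) (hW : IsWeight m W r θ) {k : Wave d}
    (hk : k ∉ A.bandCrossing) (i : I) (y : PacketVec J I) :
    ‖F.inputMul W i k y‖ ≤ (W (k - F.c i))⁻¹ * ‖packetProj J i y‖ := by
  have h1 : ‖A.bandProj (F.b i) k (packetProj J i y)‖ ≤ ‖packetProj J i y‖ := by
    simpa using (A.bandProj (F.b i) k).le_of_opNorm_le (norm_bandProj_le hA hk _)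
      (packetProj J i y)
  have h2 : 0 ≤ (W (k - F.c i))⁻¹ := inv_nonneg.2 (hW.pos _).le
  rw [inputMul, _root_.smul_apply, norm_smul, Complex.norm_real, Real.norm_of_nonneg h2,
    ContinuousLinearMap.comp_apply, locProj, _root_.smul_apply, norm_smul, Complex.norm_real,
    Real.norm_of_nonneg (ballInd_nonneg _ _)]
  gcongr
  calc _ ≤ 1 * ‖packetProj J i y‖ := by
        gcongr
        exact ballInd_le_one _ _
    _ = _ := one_mul _

theorem norm_collect_le (hA : A.Admissible) (hW : IsWeight m W r θ) {k : Wave d}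
    (hk : k ∉ A.bandCrossing) : ‖F.collect W k‖ ≤ 1 := by
  refine ContinuousLinearMap.opNorm_le_bound _ zero_le_one fun y => ?_
  rw [collect, _root_.sum_apply, one_mul, ← sum_norm_packetProj]
  refine (norm_sum_le _ _).trans (Finset.sum_le_sum fun i _ => ?_)
  refine (F.norm_inputMul_apply_le hA hW hk i y).trans ?_
  exact mul_le_of_le_one_left (norm_nonneg _) (hW.inv_le_one _)

/-- Balls that meet have the same center, and packets with a common center have different bands;
there are only 2J bands. This keeps the number of packets out of the existence time. -/
theorem sum_ballInd_le (k : Wave d) : ∑ i, ballInd F.δ (k - F.c i) ≤ 2 * J := by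
  classical
  have h1 : ∑ i, ballInd F.δ (k - F.c i) =
      ((Finset.univ.filter fun i => ‖k - F.c i‖ ≤ F.δ).card : ℝ) := by
    rw [Finset.card_filter, Nat.cast_sum]
    refine Finset.sum_congr rfl fun i _ => ?_
    unfold ballInd
    split_ifs <;> simp
  have h2 : (Finset.univ.filter fun i => ‖k - F.c i‖ ≤ F.δ).card ≤
      (Finset.univ : Finset (Fin J × ℤˣ)).card := by
    refine Finset.card_le_card_of_injOn F.b (fun _ _ => Finset.mem_univ _) fun i hi i' hi' h => ?_
    rw [Finset.mem_coe, Finset.mem_filter] at hi hi'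
    exact F.inj i i' (F.sep k i i' hi.2 hi'.2) h
  rw [h1]
  have h3 : (Finset.univ : Finset (Fin J × ℤˣ)).card = 2 * J := by
    simp [Finset.card_univ, mul_comm]
  rw [h3] at h2
  exact_mod_cast h2

/-- The deviations from the input centers add up to the deviation of the output from the sum of the
centers, so submultiplicativity turns the inverse input weights into one inverse output weight. -/
theorem norm_tensor_inputMul_le (hA : A.Admissible) (hW : IsWeight m W r θ)
    {κ : Fin m → Wave d} (hκ : κ ∈ A.goodTuples m) {K : Tensor m (Vec J) (Vec J)} (hK : ‖K‖ ≤ C)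
    (q : Fin m → I) (y : Fin m → PacketVec J I) :
    ‖K fun j => F.inputMul W (q j) (κ j) (y j)‖ ≤
      (W (∑ j, κ j - ∑ j, F.c (q j)))⁻¹ * (C * ∏ j, ‖packetProj J (q j) (y j)‖) := by
  have hC : 0 ≤ C := (norm_nonneg _).trans hK
  have h1 : ∏ j, ‖F.inputMul W (q j) (κ j) (y j)‖ ≤
      (∏ j, W (κ j - F.c (q j)))⁻¹ * ∏ j, ‖packetProj J (q j) (y j)‖ := by
    rw [← Finset.prod_inv_distrib, ← Finset.prod_mul_distrib]
    exact Finset.prod_le_prod (fun _ _ => norm_nonneg _) fun j _ =>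
      F.norm_inputMul_apply_le hA hW (hκ.2 j) (q j) (y j)
  have h2 : (∏ j, W (κ j - F.c (q j)))⁻¹ ≤ (W (∑ j, κ j - ∑ j, F.c (q j)))⁻¹ := by
    refine inv_anti₀ (hW.pos _) ?_
    rw [← Finset.sum_sub_distrib]
    exact hW.submul fun j => κ j - F.c (q j)
  calc ‖K fun j => F.inputMul W (q j) (κ j) (y j)‖
      ≤ C * ∏ j, ‖F.inputMul W (q j) (κ j) (y j)‖ := K.le_of_opNorm_le hK _
    _ ≤ C * ((W (∑ j, κ j - ∑ j, F.c (q j)))⁻¹ * ∏ j, ‖packetProj J (q j) (y j)‖) := by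
        gcongr
        exact h1.trans (by gcongr)
    _ = _ := by ring

theorem norm_packetProj_le (i : I) (y : PacketVec J I) : ‖packetProj J i y‖ ≤ ‖y‖ := by
  rw [← sum_norm_packetProj y]
  exact Finset.single_le_sum (f := fun i => ‖packetProj J i y‖) (fun _ _ => norm_nonneg _)
    (Finset.mem_univ i)

theorem prod_norm_packetProj_le (q : Fin m → I) (y : Fin m → PacketVec J I) :
    ∏ j, ‖packetProj J (q j) (y j)‖ ≤ ∏ j, ‖y j‖ :=
  Finset.prod_le_prod (fun _ _ => norm_nonneg _) fun j _ => norm_packetProj_le (q j) (y j)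

/-- The inverse weight gained from the inputs cancels the output weight exactly, since the output
center is the sum of the input centers. The bound is therefore independent of the weight, and hence
of β. -/
theorem norm_systemKernel_le (hA : A.Admissible) (hχ : χ.Admissible A C) (hW : IsWeight m W r θ)
    (t : ℝ) {κ : Fin m → Wave d} (hκ : κ ∈ A.goodTuples m) :
    ‖F.systemKernel χ W t κ‖ ≤ 2 * J * C := by
  classical
  have hI := norm_interactionKernel_le hA hχ t hκ
  have hC : 0 ≤ C := (norm_nonneg _).trans hI
  refine ContinuousMultilinearMap.opNorm_le_bound (by positivity) fun y => ?_
  set k := ∑ j, κ j with hk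
  have hterm : ∀ p ∈ F.resSet, ‖((F.outputMul W p.2 k).compContinuousMultilinearMap
      (F.inputKernel χ W t p.1 κ)) y‖ ≤
        ballInd F.δ (k - F.c p.2) * (C * ∏ j, ‖packetProj J (p.1 j) (y j)‖) := by
    intro p hp
    have hc : F.c p.2 = ∑ j, F.c (p.1 j) := (Finset.mem_filter.1 hp).2
    have h1 := F.norm_tensor_inputMul_le hA hW hκ hI p.1 y
    rw [← hc] at h1
    have h2 : ‖A.bandProj (F.b p.2) k (F.inputKernel χ W t p.1 κ y)‖ ≤
        ‖F.inputKernel χ W t p.1 κ y‖ := by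
      simpa using (A.bandProj (F.b p.2) k).le_of_opNorm_le (norm_bandProj_le hA hκ.1 _) _
    have hWk := hW.pos (k - F.c p.2)
    rw [ContinuousLinearMap.compContinuousMultilinearMap_coe, Function.comp_apply, outputMul,
      _root_.smul_apply, norm_smul, Complex.norm_real, Real.norm_of_nonneg hWk.le,
      ContinuousLinearMap.comp_apply, norm_packetInj, locProj, _root_.smul_apply, norm_smul,
      Complex.norm_real, Real.norm_of_nonneg (ballInd_nonneg _ _)]
    have hb := ballInd_nonneg F.δ (k - F.c p.2)
    calc W (k - F.c p.2) * (ballInd F.δ (k - F.c p.2) *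
          ‖A.bandProj (F.b p.2) k (F.inputKernel χ W t p.1 κ y)‖)
        ≤ W (k - F.c p.2) * (ballInd F.δ (k - F.c p.2) *
          ((W (k - F.c p.2))⁻¹ * (C * ∏ j, ‖packetProj J (p.1 j) (y j)‖))) := by
          gcongr
          exact h2.trans h1
      _ = _ := by field_simp
  rw [systemKernel, _root_.sum_apply]
  refine (norm_sum_le _ _).trans ((Finset.sum_le_sum hterm).trans ?_)
  -- After the weights have cancelled, the condition on the centers may be dropped, and the sum over
  -- input strings and output packets factorizes.
  refine (Finset.sum_le_univ_sum_of_nonneg fun p => ?_).trans ?_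
  · have := ballInd_nonneg F.δ (k - F.c p.2)
    positivity
  rw [Fintype.sum_prod_type_right]
  simp only [← Finset.mul_sum]
  rw [← Finset.sum_mul, mul_assoc]
  -- The ℓ¹ norm on packet states is what makes the sum over all input strings an exact product,
  -- with no combinatorial factor.
  have hprod : ∑ q : Fin m → I, ∏ j, ‖packetProj J (q j) (y j)‖ = ∏ j, ‖y j‖ := by
    simp only [← sum_norm_packetProj (y _)]
    rw [Finset.prod_univ_sum, Fintype.piFinset_univ]
  rw [hprod]
  have := F.sum_ballInd_le k
  gcongr

/-- Here no output weight has to be cancelled, so outside of the δ-ball the inverse weight remains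
and is at most θ. The number of interactions enters only the constant of the error, not the
existence time. -/
theorem norm_tailKernel_le (hA : A.Admissible) (hχ : χ.Admissible A C) (hW : IsWeight m W r θ)
    (hr : r ≤ F.δ) (hθ : 0 ≤ θ) (t : ℝ) {κ : Fin m → Wave d} (hκ : κ ∈ A.goodTuples m) :
    ‖F.tailKernel χ W t κ‖ ≤ F.resSet.card * C * θ := by
  have hI := norm_interactionKernel_le hA hχ t hκ
  have hC : 0 ≤ C := (norm_nonneg _).trans hI
  refine ContinuousMultilinearMap.opNorm_le_bound (by positivity) fun y => ?_
  set k := ∑ j, κ j with hk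
  rw [tailKernel, _root_.sum_apply]
  have hterm : ∀ p ∈ F.resSet, ‖((F.tailMul p.2 k).compContinuousMultilinearMap
      (F.inputKernel χ W t p.1 κ)) y‖ ≤ C * θ * ∏ j, ‖y j‖ := by
    intro p hp
    have hc : F.c p.2 = ∑ j, F.c (p.1 j) := (Finset.mem_filter.1 hp).2
    rw [ContinuousLinearMap.compContinuousMultilinearMap_coe, Function.comp_apply, tailMul,
      _root_.smul_apply, norm_smul, Complex.norm_real]
    rcases le_or_gt ‖k - F.c p.2‖ F.δ with h | h
    · rw [ballInd_of_le h, sub_self, norm_zero, zero_mul]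
      positivity
    · have h1 := F.norm_tensor_inputMul_le hA hW hκ hI p.1 y
      rw [← hc] at h1
      have h2 : ‖A.bandProj (F.b p.2) k (F.inputKernel χ W t p.1 κ y)‖ ≤
          ‖F.inputKernel χ W t p.1 κ y‖ := by
        simpa using (A.bandProj (F.b p.2) k).le_of_opNorm_le (norm_bandProj_le hA hκ.1 _) _
      rw [ballInd_of_lt h, sub_zero, norm_one, one_mul]
      refine h2.trans (h1.trans ?_)
      have h3 := hW.tail _ (hr.trans_lt h)
      have h4 := prod_norm_packetProj_le p.1 y
      have h5 : 0 ≤ ∏ j, ‖packetProj J (p.1 j) (y j)‖ := Finset.prod_nonneg fun _ _ => norm_nonneg _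
      rw [mul_comm C θ, mul_assoc]
      exact mul_le_mul h3 (mul_le_mul_of_nonneg_left h4 hC) (mul_nonneg hC h5) hθ
  refine (norm_sum_le _ _).trans ((Finset.sum_le_card_nsmul _ _ _ hterm).trans ?_)
  rw [nsmul_eq_mul]
  exact le_of_eq (by ring)

theorem norm_baseKernel_le (hA : A.Admissible) (hχ : χ.Admissible A C) (hW : IsWeight m W r θ)
    (p : (Fin m → I) × (Fin J × ℤˣ)) {κ : Fin m → Wave d} (hκ : κ ∈ A.goodTuples m) :
    ‖F.baseKernel χ W p κ‖ ≤ C := by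
  have hI := norm_normalizedTensor_le hχ hκ
  have hC : 0 ≤ C := (norm_nonneg _).trans hI
  refine ContinuousMultilinearMap.opNorm_le_bound hC fun y => ?_
  have h2 := (A.bandProj p.2 (∑ j, κ j)).le_of_opNorm_le (norm_bandProj_le hA hκ.1 p.2)
    (normalizedTensor χ κ fun j => F.inputMul W (p.1 j) (κ j) (y j))
  rw [one_mul] at h2
  have h5 : 0 ≤ ∏ j, ‖packetProj J (p.1 j) (y j)‖ := Finset.prod_nonneg fun _ _ => norm_nonneg _
  refine h2.trans ((F.norm_tensor_inputMul_le hA hW hκ hI p.1 y).trans ?_)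
  exact (mul_le_of_le_one_left (mul_nonneg hC h5) (hW.inv_le_one _)).trans
    (mul_le_mul_of_nonneg_left (prod_norm_packetProj_le p.1 y) hC)

/-- The input multipliers are supported in the δ-balls, exactly where the phase bounds are
available; elsewhere one argument of the tensor is zero. -/
theorem baseKernel_eq_zero_or (p : (Fin m → I) × (Fin J × ℤˣ)) (hp : p ∈ F.nonresSet)
    (κ : Fin m → Wave d) :
    F.baseKernel χ W p κ = 0 ∨ F.low ≤ |F.phase p κ| ∧ |F.phase p κ| ≤ F.high := by
  by_cases h : ∀ j, ‖κ j - F.c (p.1 j)‖ ≤ F.δ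
  · exact Or.inr (F.phase_bound p.1 p.2 (Finset.mem_filter.1 hp).2 κ h)
  · left
    push Not at h
    obtain ⟨j, hj⟩ := h
    ext1 y
    have h0 : F.inputMul W (p.1 j) (κ j) (y j) = 0 := by
      rw [inputMul, locProj, ballInd_of_lt hj]
      simp
    have h1 : (normalizedTensor χ κ fun j => F.inputMul W (p.1 j) (κ j) (y j)) = 0 :=
      ContinuousMultilinearMap.map_coord_zero _ j h0
    change A.bandProj p.2 (∑ j, κ j)
      (normalizedTensor χ κ fun j => F.inputMul W (p.1 j) (κ j) (y j)) = 0
    rw [h1, map_zero]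

/-! The decomposition of the nonlinearity. -/

theorem collect_outputMul (hA : A.Admissible) (hW : IsWeight m W r θ) {k : Wave d}
    (hk : k ∉ A.bandCrossing) (i : I) (x : Vec J) :
    F.collect W k (F.outputMul W i k x) = F.locProj i k x := by
  classical
  rw [collect, _root_.sum_apply, Finset.sum_eq_single i]
  · have hW' : (W (k - F.c i) : ℂ) ≠ 0 := by exact_mod_cast (hW.pos _).ne'
    simp only [inputMul, outputMul, _root_.smul_apply, ContinuousLinearMap.comp_apply, map_smul,
      packetProj_packetInj, if_true, smul_smul]
    rw [Complex.ofReal_inv, mul_inv_cancel₀ hW', one_smul]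
    simp only [locProj, _root_.smul_apply, map_smul, bandProj_bandProj hA hk, if_true, smul_smul,
      ← Complex.ofReal_mul, ballInd_mul_self]
  · intro i' _ hi'
    simp [inputMul, outputMul, packetProj_packetInj, hi']
  · simp

/-- Inputs and output lie in single bands, on which the flow is scalar; the whole time dependence
collapses to one exponential of the difference of frequencies. -/
theorem osc_smul_baseKernel (hA : A.Admissible) (t : ℝ) (p : (Fin m → I) × (Fin J × ℤˣ))
    {κ : Fin m → Wave d} (hκ : κ ∈ A.goodTuples m) (y : Fin m → PacketVec J I) :
    A.bandProj p.2 (∑ j, κ j) (F.inputKernel χ W t p.1 κ y) =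
      osc t (F.phase p κ) • F.baseKernel χ W p κ y := by
  have hflow : ∀ j, A.flow t (κ j) (F.inputMul W (p.1 j) (κ j) (y j)) =
      Complex.exp (-(Complex.I * t) * A.ev (F.b (p.1 j)) (κ j)) •
        F.inputMul W (p.1 j) (κ j) (y j) := by
    intro j
    simp only [inputMul, locProj, _root_.smul_apply, ContinuousLinearMap.comp_apply, map_smul,
      flow_bandProj hA (hκ.2 j)]
    simp only [smul_smul]
    congr 1
    ring
  change A.bandProj p.2 (∑ j, κ j) (A.flow (-t) (∑ j, κ j) (normalizedTensor χ κ fun j =>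
    A.flow t (κ j) (F.inputMul W (p.1 j) (κ j) (y j)))) = osc t (F.phase p κ) •
      A.bandProj p.2 (∑ j, κ j) (normalizedTensor χ κ fun j => F.inputMul W (p.1 j) (κ j) (y j))
  rw [bandProj_flow hA hκ.1]
  simp only [hflow]
  rw [(normalizedTensor χ κ).map_smul_univ (fun j =>
    Complex.exp (-(Complex.I * t) * A.ev (F.b (p.1 j)) (κ j))), map_smul, smul_smul,
    ← Complex.exp_sum, ← Complex.exp_add, osc, phase]
  congr 2
  push_cast
  rw [← Finset.mul_sum]
  ring

/-- Expand the inputs over strings of packets and the output over all bands. A band is either that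
of a packet centered at the sum of the input centers, and then the output is split by its ball, or
it belongs to the nonresonant part. Interactions of the first kind are all kept, even if their phase
does not vanish. -/
theorem interactionKernel_comp_collect (hA : A.Admissible) (hW : IsWeight m W r θ) (t : ℝ)
    {κ : Fin m → Wave d} (hκ : κ ∈ A.goodTuples m) :
    ((interactionKernel A χ t κ).compContinuousLinearMap fun j => F.collect W (κ j)) =
      (F.collect W (∑ j, κ j)).compContinuousMultilinearMap (F.systemKernel χ W t κ) +
        F.nonresKernel χ W t κ + F.tailKernel χ W t κ := by
  classical
  ext1 y
  set k := ∑ j, κ j with hk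
  set z : (Fin m → I) → Vec J := fun q => F.inputKernel χ W t q κ y with hz
  have h1 : ((interactionKernel A χ t κ).compContinuousLinearMap fun j => F.collect W (κ j)) y =
      ∑ q, z q := by
    rw [ContinuousMultilinearMap.compContinuousLinearMap_apply]
    simp only [collect, _root_.sum_apply]
    rw [ContinuousMultilinearMap.map_sum]
    rfl
  have h2 : ((F.collect W k).compContinuousMultilinearMap (F.systemKernel χ W t κ)) y =
      ∑ p ∈ F.resSet, F.locProj p.2 k (z p.1) := by
    rw [ContinuousLinearMap.compContinuousMultilinearMap_coe, Function.comp_apply, systemKernel,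
      _root_.sum_apply, map_sum]
    exact Finset.sum_congr rfl fun p _ => F.collect_outputMul hA hW hκ.1 p.2 _
  have h3 : F.nonresKernel χ W t κ y = ∑ p ∈ F.nonresSet, A.bandProj p.2 k (z p.1) := by
    rw [nonresKernel, _root_.sum_apply]
    exact Finset.sum_congr rfl fun p _ => (F.osc_smul_baseKernel hA t p hκ y).symm
  have h4 : F.tailKernel χ W t κ y = ∑ p ∈ F.resSet, F.tailMul p.2 k (z p.1) := by
    rw [tailKernel, _root_.sum_apply]
    rfl
  have h5 : ∀ i x, F.locProj i k x + F.tailMul i k x = A.bandProj (F.b i) k x := by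
    intro i x
    rw [locProj, tailMul, _root_.smul_apply, _root_.smul_apply, ← add_smul, Complex.ofReal_sub,
      Complex.ofReal_one, add_sub_cancel, one_smul]
  rw [_root_.add_apply, _root_.add_apply, h1, h2, h3, h4, add_right_comm, ← Finset.sum_add_distrib]
  simp only [h5]
  rw [resSet, nonresSet, Finset.sum_filter, Finset.sum_filter, Fintype.sum_prod_type,
    Fintype.sum_prod_type, ← Finset.sum_add_distrib]
  refine Finset.sum_congr rfl fun q _ => ?_
  conv_lhs => rw [← sum_bandProj hA hκ.1 (z q)]
  simp only
  rw [← Finset.sum_filter, ← Finset.sum_filter]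
  -- For a fixed center, packets and their bands correspond one to one, so no band is counted twice.
  have h6 : ∑ i ∈ Finset.univ.filter (fun i => F.c i = ∑ j, F.c (q j)), A.bandProj (F.b i) k (z q) =
      ∑ b ∈ Finset.univ.filter (fun b => ¬ ∀ i, F.c i = ∑ j, F.c (q j) → F.b i ≠ b),
        A.bandProj b k (z q) := by
    refine Finset.sum_bij (fun i _ => F.b i) ?_ ?_ ?_ ?_
    · intro i hi
      simp only [Finset.mem_filter, Finset.mem_univ, true_and] at hi ⊢
      exact fun h => h i hi rfl
    · intro i hi i' hi' h
      simp only [Finset.mem_filter, Finset.mem_univ, true_and] at hi hi'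
      exact F.inj i i' (hi.trans hi'.symm) h
    · intro b hb
      simp only [Finset.mem_filter, Finset.mem_univ, true_and] at hb
      push Not at hb
      obtain ⟨i, hi, hib⟩ := hb
      exact ⟨i, by simpa using hi, hib⟩
    · intro i _
      rfl
  rw [h6, add_comm]
  exact (Finset.sum_filter_add_sum_filter_not _ _ _).symm

end PacketFamily

/-! ### Approximation by a normal form -/

/-- The constant in the normal form estimate. -/
def normalFormConst (C τ M p e₁ e₂ : ℝ) (m : ℕ) : ℝ :=
  (1 + p + τ * (e₁ + e₂ + C * m * (M + p) ^ (m - 1) * p)) *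
    Real.exp (τ * (C * m * (M + p) ^ (m - 1))) + p

theorem normalFormConst_nonneg {C τ M p e₁ e₂ : ℝ} (m : ℕ) (hC : 0 ≤ C) (hτ : 0 ≤ τ) (hM : 0 ≤ M)
    (hp : 0 ≤ p) (he₁ : 0 ≤ e₁) (he₂ : 0 ≤ e₂) : 0 ≤ normalFormConst C τ M p e₁ e₂ m := by
  unfold normalFormConst
  positivity

/-- The residual has size ρ(ρ + θ); the factor ρ compensates the long time, as ρT ≤ τ. -/
theorem normalForm_arith {τ p E G ρ θ D T a b c : ℝ} (hE : 0 ≤ E) (hp : 0 ≤ p) (hG : 0 ≤ G)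
    (hρ : 0 ≤ ρ) (hθ : 0 ≤ θ) (hD : 0 ≤ D) (hτ : 0 ≤ τ) (hρT : ρ * T ≤ τ)
    (ha : a ≤ (D + ρ * p + ρ * (E * (ρ + θ)) * T) * G) (hb : b ≤ ρ * p) (hc : c ≤ a + b) :
    c ≤ ((1 + p + τ * E) * G + p) * (ρ + θ + D) := by
  have c1 : ρ * (E * (ρ + θ)) * T ≤ τ * E * (ρ + θ) := by
    calc _ = ρ * T * (E * (ρ + θ)) := by ring
      _ ≤ τ * (E * (ρ + θ)) := by gcongr
      _ = _ := by ring
  have c2 : 0 ≤ p * (θ + D) := by positivity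
  have c3 : 0 ≤ τ * E * D := by positivity
  have c4 : D + ρ * p + ρ * (E * (ρ + θ)) * T ≤ (1 + p + τ * E) * (ρ + θ + D) := by
    nlinarith
  have c5 : (D + ρ * p + ρ * (E * (ρ + θ)) * T) * G ≤ (1 + p + τ * E) * (ρ + θ + D) * G := by
    gcongr
  linarith

section NormalForm

variable {E E₂ : Type*} [NormedAddCommGroup E] [NormedSpace ℝ E] [CompleteSpace E]
  [NormedAddCommGroup E₂] [NormedSpace ℝ E₂] [CompleteSpace E₂]

/-- Let `x` solve `x' = ρ N₂(x)`, and let `N₁(L x) - L N₂(x)` be, up to small errors, the time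
derivative of a bounded expression `P`. Then `L x` is close to the solution of `v' = ρ N₁(v)`. -/
theorem norm_sub_le_of_normalForm {N₁ : ℝ → E → E} {N₂ : ℝ → E₂ → E₂} {L : E₂ →L[ℝ] E}
    {P tail : ℝ → E₂ → E} {m : ℕ} {C C₂ τ M p e₁ e₂ ρ θ T : ℝ}
    (hN₁ : IsPowerField N₁ C m) (hN₂ : IsPowerField N₂ C₂ m) (hL : ∀ y, ‖L y‖ ≤ ‖y‖)
    (hρ : 0 ≤ ρ) (hρ1 : ρ ≤ 1) (hT : 0 ≤ T) (hτ : 0 ≤ τ) (hρT : ρ * T ≤ τ) (hθ : 0 ≤ θ)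
    (hM : 0 ≤ M) (hp : 0 ≤ p) (he₁ : 0 ≤ e₁) (he₂ : 0 ≤ e₂)
    (hPc : Continuous fun a : ℝ × E₂ => P a.1 a.2) (hPb : ∀ t y, ‖y‖ ≤ M → ‖P t y‖ ≤ p)
    (htail : ∀ t y, ‖y‖ ≤ M → ‖tail t y‖ ≤ e₁ * θ)
    (hPd : ∀ t (x : ℝ → E₂) (x' : E₂), HasDerivWithinAt x x' (Ici t) t → ‖x t‖ ≤ M →
      ‖x'‖ ≤ ρ * (C₂ * M ^ m) → ∃ e, ‖e‖ ≤ e₂ * ρ ∧ HasDerivWithinAt (fun s => P s (x s))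
        (N₁ t (L (x t)) - L (N₂ t (x t)) - tail t (x t) + e) (Ici t) t)
    {h : E} {x₀ : E₂} {v : ℝ → E} {x : ℝ → E₂} (hv : ContinuousOn v (Icc 0 T))
    (hvM : ∀ t ∈ Icc 0 T, ‖v t‖ ≤ M)
    (hvint : ∀ t ∈ Icc 0 T, v t = h + ρ • ∫ t' in (0 : ℝ)..t, N₁ t' (v t'))
    (hx : ContinuousOn x (Icc 0 T)) (hxM : ∀ t ∈ Icc 0 T, ‖x t‖ ≤ M)
    (hxint : ∀ t ∈ Icc 0 T, x t = x₀ + ρ • ∫ t' in (0 : ℝ)..t, N₂ t' (x t')) :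
    ∀ t ∈ Icc 0 T,
      ‖v t - L (x t)‖ ≤ normalFormConst C τ M p e₁ e₂ m * (ρ + θ + ‖h - L x₀‖) := by
  have hC := hN₁.nonneg
  have hC₂ := hN₂.nonneg
  have hM₁ : 0 ≤ M + p := by positivity
  have hMM₁ : M ≤ M + p := le_add_of_nonneg_right hp
  have hxd := hN₂.hasDerivWithinAt_of_integral_eq hx hxint
  have hvd := hN₁.hasDerivWithinAt_of_integral_eq hv hvint
  -- The normal form change of variable: the derivative of the correction ρP supplies the terms by
  -- which L x fails to solve the equation of v.
  set z := fun t => L (x t) + ρ • P t (x t) with hz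
  have hzL : ∀ t ∈ Icc 0 T, ‖z t - L (x t)‖ ≤ ρ * p := by
    intro t ht
    rw [hz]
    simp only [add_sub_cancel_left]
    rw [norm_smul, Real.norm_of_nonneg hρ]
    gcongr
    exact hPb t _ (hxM t ht)
  have hLM : ∀ t ∈ Icc 0 T, ‖L (x t)‖ ≤ M := fun t ht => (hL _).trans (hxM t ht)
  have hzM : ∀ t ∈ Icc 0 T, ‖z t‖ ≤ M + p := by
    intro t ht
    have h1 : ‖z t‖ ≤ ‖z t - L (x t)‖ + ‖L (x t)‖ := by
      simpa using norm_add_le (z t - L (x t)) (L (x t))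
    have h2 : ρ * p ≤ 1 * p := by gcongr
    have h3 := hzL t ht
    have h4 := hLM t ht
    linarith
  set e₃ := C * m * (M + p) ^ (m - 1) * p with he₃
  have he₃0 : 0 ≤ e₃ := by positivity
  -- After cancellation the residual, up to the factor ρ, consists of the differentiated states in P
  -- (`e₂ * ρ`), the tail (`e₁ * θ`) and the change of N₁ between L x and z (`e₃ * ρ`).
  have hex : ∀ t ∈ Ico 0 T, ∃ z' : E, HasDerivWithinAt z z' (Ici t) t ∧
      ‖z' - ρ • N₁ t (z t)‖ ≤ ρ * ((e₁ + e₂ + e₃) * (ρ + θ)) := by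
    intro t ht
    have ht' : t ∈ Icc 0 T := ⟨ht.1, ht.2.le⟩
    have hx'n : ‖ρ • N₂ t (x t)‖ ≤ ρ * (C₂ * M ^ m) := by
      rw [norm_smul, Real.norm_of_nonneg hρ]
      gcongr
      refine (hN₂.norm_le t (x t)).trans ?_
      gcongr
      exact hxM t ht'
    obtain ⟨e, hen, he⟩ := hPd t x _ (hxd t ht) (hxM t ht') hx'n
    have hd1 : HasDerivWithinAt (fun t => L (x t)) (L (ρ • N₂ t (x t))) (Ici t) t :=
      L.hasFDerivAt.comp_hasDerivWithinAt t (hxd t ht)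
    refine ⟨_, hd1.add (he.const_smul ρ), ?_⟩
    have hkey : L (ρ • N₂ t (x t)) +
        ρ • (N₁ t (L (x t)) - L (N₂ t (x t)) - tail t (x t) + e) - ρ • N₁ t (z t) =
        ρ • (e - tail t (x t) + (N₁ t (L (x t)) - N₁ t (z t))) := by
      rw [L.map_smul, ← smul_add, ← smul_sub]
      congr 1
      abel
    rw [hkey, norm_smul, Real.norm_of_nonneg hρ]
    gcongr
    have b2 := htail t _ (hxM t ht')
    have b3 : ‖N₁ t (L (x t)) - N₁ t (z t)‖ ≤ e₃ * ρ := by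
      refine (hN₁.norm_sub_le_of_le ((hLM t ht').trans hMM₁) (hzM t ht') t).trans ?_
      have := hzL t ht'
      rw [norm_sub_rev] at this
      calc _ ≤ C * m * (M + p) ^ (m - 1) * (ρ * p) := by gcongr
        _ = e₃ * ρ := by rw [he₃]; ring
    have b4 := norm_add_le (e - tail t (x t)) (N₁ t (L (x t)) - N₁ t (z t))
    have b5 := norm_sub_le e (tail t (x t))
    have b6 : 0 ≤ e₁ * ρ := by positivity
    have b7 : 0 ≤ (e₂ + e₃) * θ := by positivity
    linarith
  choose! z' hzd hz'b using hex
  have hzc : ContinuousOn z (Icc 0 T) :=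
    (L.continuous.comp_continuousOn hx).add
      ((hPc.comp_continuousOn (continuousOn_id.prodMk hx)).const_smul ρ)
  have h0T : (0 : ℝ) ∈ Icc 0 T := ⟨le_rfl, hT⟩
  have hv0 : v 0 = h := by rw [hvint 0 h0T]; simp
  have hx0 : x 0 = x₀ := by rw [hxint 0 h0T]; simp
  have hinit : ‖v 0 - z 0‖ ≤ ‖h - L x₀‖ + ρ * p := by
    have h1 := hzL 0 h0T
    rw [hx0, norm_sub_rev] at h1
    rw [hv0]
    refine (norm_sub_le_norm_sub_add_norm_sub h (L x₀) (z 0)).trans ?_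
    linarith
  intro t ht
  have hfin := hN₁.norm_sub_le_of_approx hρ hM₁ (by positivity)
    (by positivity : 0 ≤ ρ * ((e₁ + e₂ + e₃) * (ρ + θ))) hv hzc hvd hzd
    (fun t ht => (hvM t ht).trans hMM₁) hzM hz'b hinit t ht
  have hexp : Real.exp (ρ * T * (C * m * (M + p) ^ (m - 1))) ≤
      Real.exp (τ * (C * m * (M + p) ^ (m - 1))) := by
    gcongr
  refine normalForm_arith (by positivity) hp (Real.exp_pos _).le hρ hθ (norm_nonneg _) hτ hρT
    (hfin.trans ?_) (hzL t ht) (norm_sub_le_norm_sub_add_norm_sub (v t) (z t) (L (x t)))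
  gcongr

end NormalForm

/-! ### Approximation of the solution by the packet system -/

namespace PacketFamily

variable {d J m : ℕ} {A : LinearPart d J} {I : Type*} [Fintype I] (F : PacketFamily A m I)
  [NeZero m] {χ : Susceptibility d J m} {W : Wave d → ℝ} {C r θ : ℝ}

theorem kerOp_primKernel (hA : A.Admissible) (hχ : χ.Admissible A C) (hW : IsWeight m W r θ)
    (t : ℝ) : kerOp (F.primKernel χ W t) =
      ∑ p ∈ F.nonresSet, kerOp fun κ => oscPrim t (F.phase p κ) • F.baseKernel χ W p κ :=
  kerOp_sum _ fun p hp => (F.isBddKernel_baseKernel hA hχ hW p).oscPrim_smul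
    (F.aesm_phase hA p) F.low_pos (ae_of_all _ fun κ => F.baseKernel_eq_zero_or p hp κ) t

theorem isBddKernel_nonresKernel (hA : A.Admissible) (hχ : χ.Admissible A C)
    (hW : IsWeight m W r θ) (t : ℝ) : IsBddKernel (F.nonresKernel χ W t) :=
  IsBddKernel.sum _ fun p _ =>
    (F.isBddKernel_baseKernel hA hχ hW p).osc_smul (F.aesm_phase hA p) t

theorem norm_kerOp_primKernel_le (hA : A.Admissible) (hχ : χ.Admissible A C) (hC : 0 ≤ C)
    (hW : IsWeight m W r θ) (t : ℝ) :
    ‖kerOp (F.primKernel χ W t)‖ ≤ F.nonresSet.card * (C / F.low) := by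
  rw [F.kerOp_primKernel hA hχ hW]
  refine (norm_sum_le _ _).trans ((Finset.sum_le_card_nsmul _ _ (C / F.low) fun p hp => ?_).trans
    (nsmul_eq_mul _ _).le)
  refine norm_kerOp_oscPrim_le (F.isBddKernel_baseKernel hA hχ hW p) (F.aesm_phase hA p) F.low_pos
    (ae_of_all _ fun κ => F.baseKernel_eq_zero_or p hp κ) hC ?_ t
  filter_upwards [ae_mem_goodTuples hA] with κ hκ using F.norm_baseKernel_le hA hχ hW p hκ

theorem hasDerivAt_kerOp_primKernel (hA : A.Admissible) (hχ : χ.Admissible A C)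
    (hW : IsWeight m W r θ) (t : ℝ) :
    HasDerivAt (fun t => kerOp (F.primKernel χ W t)) (kerOp (F.nonresKernel χ W t)) t := by
  have h1 : kerOp (F.nonresKernel χ W t) =
      ∑ p ∈ F.nonresSet, kerOp fun κ => osc t (F.phase p κ) • F.baseKernel χ W p κ :=
    kerOp_sum _ fun p _ => (F.isBddKernel_baseKernel hA hχ hW p).osc_smul (F.aesm_phase hA p) t
  simp only [F.kerOp_primKernel hA hχ hW, h1]
  exact HasDerivAt.fun_sum fun p hp => hasDerivAt_kerOp_oscPrim
    (F.isBddKernel_baseKernel hA hχ hW p) (F.aesm_phase hA p) F.low_pos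
    (ae_of_all _ fun κ => F.baseKernel_eq_zero_or p hp κ) t

theorem isPowerField_system (hA : A.Admissible) (hχ : χ.Admissible A C) (hC : 0 ≤ C)
    (hW : IsWeight m W r θ) :
    IsPowerField (fun t (x : SpecOf d (PacketVec J I)) => kerOp (F.systemKernel χ W t) fun _ => x)
      (2 * J * C) m := by
  have hb : ∀ t, ∀ᵐ κ, ‖F.systemKernel χ W t κ‖ ≤ 2 * J * C := fun t => by
    filter_upwards [ae_mem_goodTuples hA] with κ hκ using F.norm_systemKernel_le hA hχ hW t hκ
  have hK := F.isBddKernel_systemKernel hA hχ hW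
  have h0 : 0 ≤ 2 * J * C := by positivity
  exact IsPowerField.of_multilinear h0 (fun t => norm_kerOp_le (hK t) h0 (hb t)) fun x =>
    continuous_kerOp_apply hK hb (ae_of_all _ fun κ => F.continuous_systemKernel κ) _

theorem kerOp_interaction_collect (hA : A.Admissible) (hχ : χ.Admissible A C)
    (hW : IsWeight m W r θ) (t : ℝ) (x : SpecOf d (PacketVec J I)) :
    (kerOp (interactionKernel A χ t) fun _ => mulOp (F.collect W) x) =
      mulOp (F.collect W) (kerOp (F.systemKernel χ W t) fun _ => x) +
        (kerOp (F.nonresKernel χ W t) fun _ => x) + kerOp (F.tailKernel χ W t) fun _ => x := by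
  have hT := F.isBddMul_collect hA hW
  have hK := isBddKernel_interactionKernel hA hχ t
  have h1 := F.isBddKernel_systemKernel hA hχ hW t
  have h2 := F.isBddKernel_nonresKernel hA hχ hW t
  have h3 := F.isBddKernel_tailKernel hA hχ hW t
  have h4 := IsBddKernel.mul_comp hT h1
  rw [kerOp_mulOp hT hK, mulOp_kerOp hT h1,
    kerOp_congr (hK.comp_mul fun _ => hT) ((h4.add h2).add h3) (by
      filter_upwards [ae_mem_goodTuples hA] with κ hκ
      exact F.interactionKernel_comp_collect hA hW t hκ),
    kerOp_add (h4.add h2) h3, kerOp_add h4 h2]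
  rfl

theorem norm_kerOp_tail_le (hA : A.Admissible) (hχ : χ.Admissible A C) (hC : 0 ≤ C)
    (hW : IsWeight m W r θ) (hr : r ≤ F.δ) (hθ : 0 ≤ θ) (t : ℝ) {M : ℝ}
    {x : SpecOf d (PacketVec J I)} (hx : ‖x‖ ≤ M) :
    ‖kerOp (F.tailKernel χ W t) fun _ => x‖ ≤ F.resSet.card * C * θ * M ^ m := by
  have h : ‖kerOp (F.tailKernel χ W t)‖ ≤ F.resSet.card * C * θ := by
    refine norm_kerOp_le (F.isBddKernel_tailKernel hA hχ hW t) (by positivity) ?_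
    filter_upwards [ae_mem_goodTuples hA] with κ hκ
      using F.norm_tailKernel_le hA hχ hW hr hθ t hκ
  refine ((kerOp (F.tailKernel χ W t)).le_of_opNorm_le h _).trans ?_
  rw [Finset.prod_const, Finset.card_univ, Fintype.card_fin]
  gcongr

theorem norm_mulOp_collect_le (hA : A.Admissible) (hW : IsWeight m W r θ)
    (x : SpecOf d (PacketVec J I)) : ‖mulOp (F.collect W) x‖ ≤ ‖x‖ := by
  have := norm_mulOp_le (F.isBddMul_collect hA hW) (C := 1) (by
    filter_upwards [ae_notMem_bandCrossing hA] with k hk using F.norm_collect_le hA hW hk) x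
  simpa using this

/-- The solution is approximated by the collected components of the packet system. -/
theorem exists_approx (hA : A.Admissible) (hχ : χ.Admissible A C) (hC : 0 ≤ C) {R τ : ℝ}
    (hR : 0 ≤ R) (hτ : 0 ≤ τ) (hsmall : τ * (2 * J * C * (R + 1) ^ m) ≤ 1) :
    ∃ Kc : ℝ, 0 ≤ Kc ∧ ∀ (W : Wave d → ℝ) (r θ ρ T : ℝ), IsWeight m W r θ → r ≤ F.δ → 0 ≤ θ →
      0 ≤ ρ → ρ ≤ 1 → 0 ≤ T → ρ * T ≤ τ →
      ∀ (h : Spec d J) (x₀ : SpecOf d (PacketVec J I)), ‖x₀‖ ≤ R →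
      ∀ v : ℝ → Spec d J, ContinuousOn v (Icc 0 T) → (∀ t ∈ Icc 0 T, ‖v t‖ ≤ R + 1) →
      (∀ t ∈ Icc 0 T, v t =
        h + ρ • ∫ t' in (0 : ℝ)..t, kerOp (interactionKernel A χ t') fun _ => v t') →
      ∃ x : ℝ → SpecOf d (PacketVec J I), ∀ t ∈ Icc 0 T, ‖x t‖ ≤ R + 1 ∧
        ‖v t - mulOp (F.collect W) (x t)‖ ≤
          Kc * (ρ + θ + ‖h - mulOp (F.collect W) x₀‖) := by
  set q := F.nonresSet.card * (C / F.low) with hq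
  have hq0 : 0 ≤ q := by have := F.low_pos; positivity
  have hM : 0 ≤ R + 1 := by positivity
  -- The two constants of the normal form estimate: the tail bound on the ball of radius R + 1, and
  -- the product rule bound, in which one argument of the primitive is replaced by the velocity of
  -- the packet state.
  have he₁ : 0 ≤ F.resSet.card * C * (R + 1) ^ m := by positivity
  have he₂ : 0 ≤ m * (q * ((R + 1) ^ (m - 1) * (2 * J * C * (R + 1) ^ m))) := by positivity
  refine ⟨normalFormConst C τ (R + 1) (q * (R + 1) ^ m) _ _ m,
    normalFormConst_nonneg m hC hτ hM (by positivity) he₁ he₂, ?_⟩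
  intro W r θ ρ T hW hr hθ hρ hρ1 hT hρT h x₀ hx₀ v hv hvM hvint
  have hN₁ := isPowerField_interaction hA hχ hC le_rfl
  have hN₂ := F.isPowerField_system hA hχ hC hW
  have hsm : ρ * T * (2 * J * C * (R + 1) ^ m) ≤ 1 := le_trans (by gcongr) hsmall
  obtain ⟨x, -, hxc, hxM, hxint⟩ := hN₂.exists_solution hρ hT hR hsm hx₀
  have hQd := F.hasDerivAt_kerOp_primKernel hA hχ hW
  have hQn := F.norm_kerOp_primKernel_le hA hχ hC hW
  have hQc : Continuous fun t => kerOp (F.primKernel χ W t) :=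
    continuous_iff_continuousAt.2 fun t => (hQd t).continuousAt
  refine ⟨x, fun t ht => ⟨hxM t ht, ?_⟩⟩
  refine norm_sub_le_of_normalForm (L := (mulOp (F.collect W)).restrictScalars ℝ)
    (P := fun t y => kerOp (F.primKernel χ W t) fun _ => y)
    (tail := fun t y => kerOp (F.tailKernel χ W t) fun _ => y)
    hN₁ hN₂ (F.norm_mulOp_collect_le hA hW) hρ hρ1 hT hτ hρT hθ hM (by positivity) he₁ he₂
    ?_ ?_ ?_ ?_ hv hvM hvint hxc hxM hxint t ht
  · exact (continuous_eval (F := Tensor m (SpecOf d (PacketVec J I)) (Spec d J))).comp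
      ((hQc.comp continuous_fst).prodMk (continuous_pi fun _ => continuous_snd))
  · intro t y hy
    refine ((kerOp (F.primKernel χ W t)).le_of_opNorm_le (hQn t) _).trans ?_
    rw [Finset.prod_const, Finset.card_univ, Fintype.card_fin]
    gcongr
  · intro t y hy
    exact (F.norm_kerOp_tail_le hA hχ hC hW hr hθ t hy).trans (le_of_eq (by ring))
  · intro t x x' hx' hxt hx'n
    obtain ⟨e, he, hen⟩ := exists_hasDerivWithinAt_multilinear (hQd t) hx' (hQn t) hxt hx'n
    refine ⟨e, hen.trans (le_of_eq (by ring)), ?_⟩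
    -- The explicit time derivative of the primitive is the nonresonant part, which the
    -- decomposition expresses as the defect required by the normal form lemma.
    have hkey := F.kerOp_interaction_collect hA hχ hW t (x t)
    have hkey2 : (kerOp (interactionKernel A χ t) fun _ => mulOp (F.collect W) (x t)) -
        mulOp (F.collect W) (kerOp (F.systemKernel χ W t) fun _ => x t) -
        (kerOp (F.tailKernel χ W t) fun _ => x t) = kerOp (F.nonresKernel χ W t) fun _ => x t := by
      rw [hkey]
      abel
    rw [← hkey2] at he
    exact he

end PacketFamily

/-! ### The packet family of a resonance invariant spectrum -/

theorem sg_mul_self (ζ : ℤˣ) : sg ζ * sg ζ = 1 := by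
  rcases Int.units_eq_one_or ζ with rfl | rfl <;> simp [sg]

theorem sg_mul (ζ ζ' : ℤˣ) : sg (ζ * ζ') = sg ζ * sg ζ' := by
  simp [sg]

/-- A family of packets without nonresonant interactions of vanishing phase has a localization
radius with uniform bounds for the phases. -/
theorem PacketFamily.exists_of_centers {d J m : ℕ} {A : LinearPart d J} {I : Type*} [Finite I]
    (c : I → Wave d) (b : I → Fin J × ℤˣ) (inj : ∀ i i', c i = c i' → b i = b i' → i = i')
    (hcont : ∀ i, ContinuousAt (A.ev (b i)) (c i))
    (hout : ∀ (q : Fin m → I) (b' : Fin J × ℤˣ), (∀ i, c i = ∑ j, c (q j) → b i ≠ b') →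
      ContinuousAt (A.ev b') (∑ j, c (q j)) ∧
        A.ev b' (∑ j, c (q j)) - ∑ j, A.ev (b (q j)) (c (q j)) ≠ 0) :
    ∃ F : PacketFamily A m I, F.c = c ∧ F.b = b := by
  let P := {p : (Fin m → I) × (Fin J × ℤˣ) // ∀ i, c i = ∑ j, c (p.1 j) → b i ≠ p.2}
  let Φ : P → (Fin m → Wave d) → ℝ := fun p κ =>
    |A.ev p.1.2 (∑ j, κ j) - ∑ j, A.ev (b (p.1.1 j)) (κ j)|
  let κ₀ : P → Fin m → Wave d := fun p j => c (p.1.1 j)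
  have hpos : ∀ p, 0 < Φ p (κ₀ p) := fun p => abs_pos.2 (hout p.1.1 p.1.2 p.2).2
  have hΦ : ∀ p, ContinuousAt (Φ p) (κ₀ p) := by
    intro p
    refine ContinuousAt.abs (ContinuousAt.sub ?_ ?_)
    · exact ContinuousAt.comp' (f := fun κ : Fin m → Wave d => ∑ j, κ j)
        (hout p.1.1 p.1.2 p.2).1 (by fun_prop)
    · refine tendsto_finsetSum _ fun j _ => ?_
      exact ContinuousAt.comp' (f := fun κ : Fin m → Wave d => κ j)
        (hcont (p.1.1 j)) (continuousAt_apply j _)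
  -- There are finitely many strings and bands, so one radius keeps each phase within a factor two
  -- of its nonzero modulus at the centers.
  have h1 : ∀ᶠ δ in 𝓝[>] (0 : ℝ), ∀ p, ∀ κ : Fin m → Wave d, (∀ j, ‖κ j - c (p.1.1 j)‖ ≤ δ) →
      Φ p (κ₀ p) / 2 < Φ p κ ∧ Φ p κ < 2 * Φ p (κ₀ p) := by
    refine eventually_all.2 fun p => ?_
    have h := (hΦ p).eventually (Ioo_mem_nhds (a := Φ p (κ₀ p) / 2) (b := 2 * Φ p (κ₀ p))
      (by linarith [hpos p]) (by linarith [hpos p]))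
    obtain ⟨r, hr, hball⟩ := Metric.eventually_nhds_iff.1 h
    filter_upwards [Ioo_mem_nhdsGT hr] with δ hδ κ hκ
    refine hball (lt_of_le_of_lt ((dist_pi_le_iff hδ.1.le).2 fun j => ?_) hδ.2)
    rw [dist_eq_norm]
    exact hκ j
  have h2 : ∀ᶠ δ in 𝓝[>] (0 : ℝ), ∀ p : I × I, c p.1 ≠ c p.2 → 2 * δ < ‖c p.1 - c p.2‖ := by
    refine eventually_all.2 fun p => ?_
    by_cases hp : c p.1 = c p.2
    · exact Eventually.of_forall fun δ h => absurd hp h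
    · have : 0 < ‖c p.1 - c p.2‖ / 2 := half_pos (norm_pos_iff.2 (sub_ne_zero.2 hp))
      filter_upwards [Ioo_mem_nhdsGT this] with δ hδ _
      linarith [hδ.2]
  obtain ⟨δ, hδ1, hδ2, hδ0⟩ := (h1.and (h2.and self_mem_nhdsWithin)).exists
  have h3 : ∀ᶠ a in 𝓝[>] (0 : ℝ), ∀ p, a < Φ p (κ₀ p) / 2 :=
    eventually_all.2 fun p => by
      filter_upwards [Ioo_mem_nhdsGT (half_pos (hpos p))] with a ha using ha.2
  obtain ⟨low, hlow, hlow0⟩ := (h3.and self_mem_nhdsWithin).exists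
  obtain ⟨high, hhigh⟩ := (Set.finite_range fun p => 2 * Φ p (κ₀ p)).bddAbove
  refine ⟨⟨c, b, δ, low, high, hδ0, hlow0, inj, fun k i i' h h' => ?_, fun q b' hq κ hκ => ?_⟩,
    rfl, rfl⟩
  · by_contra hne
    have := hδ2 (i, i') hne
    have h4 : ‖c i - c i'‖ ≤ ‖k - c i‖ + ‖k - c i'‖ := by
      rw [norm_sub_rev k (c i)]
      simpa using norm_add_le (c i - k) (k - c i')
    linarith
  · have h4 := hδ1 ⟨(q, b'), hq⟩ κ hκ
    exact ⟨((hlow ⟨(q, b'), hq⟩).trans h4.1).le,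
      h4.2.le.trans (hhigh ⟨⟨(q, b'), hq⟩, rfl⟩)⟩

/-! ### The packets attached to a spectrum and their phases -/

section Spectrum

variable {d J m : ℕ} {A : LinearPart d J}

theorem omega_sg_smul (hA : A.Admissible) {k : Wave d} (hk : k ∉ A.bandCrossing) (n : Fin J)
    (ζ : ℤˣ) : A.ω n ζ (sg ζ • k) = sg ζ * A.ω n 1 k := by
  rcases Int.units_eq_one_or ζ with rfl | rfl
  · simp [sg]
  · simpa [sg] using hA.symm k hk n 1

theorem omega_eq_sg_mul (hA : A.Admissible) {k : Wave d} (hk : k ∉ A.bandCrossing) (n : Fin J)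
    (ζ : ℤˣ) : A.ω n ζ k = sg ζ * A.ω n 1 (sg ζ • k) := by
  rcases Int.units_eq_one_or ζ with rfl | rfl
  · simp [sg]
  · have := hA.symm k hk n (-1)
    simp only [neg_neg] at this
    simp [sg, this]

/-- Only k is known to be regular; -k might be a band-crossing point. Continuity of the negative
bands at -k is transported from the positive ones at k by the symmetry of the eigenvalues. -/
theorem continuousAt_omega_sg_smul (hA : A.Admissible) {k : Wave d} (hk : k ∉ A.bandCrossing)
    (n : Fin J) (ζ : ℤˣ) : ContinuousAt (A.ω n ζ) (sg ζ • k) := by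
  have h1 : ContinuousAt (fun k' => sg ζ * A.ω n 1 (sg ζ • k')) (sg ζ • k) := by
    refine continuousAt_const.mul ?_
    refine ContinuousAt.comp' (g := A.ω n 1) (f := fun k' => sg ζ • k') ?_ (by fun_prop)
    rw [smul_smul, sg_mul_self, one_smul]
    exact continuousAt_ev hA hk (n, 1)
  refine h1.congr ?_
  have h2 : ContinuousAt (fun k' : Wave d => sg ζ • k') (sg ζ • k) := by fun_prop
  have h3 : A.bandCrossingᶜ ∈ 𝓝 (sg ζ • (sg ζ • k)) := by
    rw [smul_smul, sg_mul_self, one_smul]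
    exact hA.closed.isOpen_compl.mem_nhds hk
  filter_upwards [h2.eventually h3] with k' hk'
  rw [← omega_sg_smul hA hk', smul_smul, sg_mul_self, one_smul]

/-- The indices of the packets of a spectrum: a pair and a sign. -/
abbrev PacketIndex (S : Finset (Fin J × Wave d)) := {p // p ∈ S} × ℤˣ

variable {S : Finset (Fin J × Wave d)}

/-- The center `ζ k_*` of a packet. -/
def packetCenter (i : PacketIndex S) : Wave d := sg i.2 • i.1.1.2

/-- The band `(n, ζ)` of a packet. -/
def packetBand (i : PacketIndex S) : Fin J × ℤˣ := (i.1.1.1, i.2)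

/-- Packets may share a center, for instance when k_* = 0 or when S contains k_* and -k_*; the band
records the sign, which recovers k_* from the center. -/
theorem packetIndex_ext {i i' : PacketIndex S} (h1 : packetCenter i = packetCenter i')
    (h2 : packetBand i = packetBand i') : i = i' := by
  obtain ⟨⟨⟨n, k⟩, hp⟩, ζ⟩ := i
  obtain ⟨⟨⟨n', k'⟩, hp'⟩, ζ'⟩ := i'
  simp only [packetBand, Prod.mk.injEq] at h2
  obtain ⟨rfl, rfl⟩ := h2
  have h3 := congrArg (fun x => sg ζ • x) h1
  simp only [packetCenter, smul_smul, sg_mul_self, one_smul] at h3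
  subst h3
  rfl

/-- A nonresonant interaction with zero phase at the centers would, by the symmetry of the
eigenvalues, satisfy the resonance equation. Its output pair would then lie in S, and its center and
band would be those of a packet. -/
theorem ResonanceInvariant.exists_packetFamily (hA : A.Admissible)
    (hS : ∀ p ∈ S, p.2 ∉ A.bandCrossing) (hout : outK m S ∩ A.bandCrossing = ∅)
    (hres : ResonanceInvariant A m S) :
    ∃ F : PacketFamily A m (PacketIndex S), F.c = packetCenter ∧ F.b = packetBand := by
  refine PacketFamily.exists_of_centers _ _ (fun i i' => packetIndex_ext)
    (fun i => continuousAt_omega_sg_smul hA (hS _ i.1.2) _ _) fun q b' hq => ?_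
  set ζs : Fin m → ℤˣ := fun j => (q j).2
  set p : Fin m → Fin J × Wave d := fun j => (q j).1.1
  have hp : ∀ j, p j ∈ S := fun j => (q j).1.2
  have hsum : ∑ j, packetCenter (q j) = kappa ζs p := rfl
  have hk : kappa ζs p ∉ A.bandCrossing := fun h =>
    (Set.ext_iff.1 hout _).1 ⟨⟨ζs, p, hp, rfl⟩, h⟩
  rw [hsum] at hq ⊢
  refine ⟨continuousAt_ev hA hk b', fun h0 => ?_⟩
  have hmem : (b'.1, sg b'.2 • kappa ζs p) ∈ outRes A m S := by
    -- The output spectrum is closed under ϰ ↦ ζϰ: multiply all signs of the string by ζ.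
    refine ⟨⟨fun j => b'.2 * ζs j, p, hp, ?_⟩, b'.2, ζs, p, hp, rfl, ?_⟩
    · simp only [kappa, Finset.smul_sum, sg_mul, smul_smul]
    · have h1 : A.ev b' (kappa ζs p) = sg b'.2 * A.ω b'.1 1 (sg b'.2 • kappa ζs p) :=
        omega_eq_sg_mul hA hk _ _
      have h2 : ∀ j, A.ev (packetBand (q j)) (packetCenter (q j)) =
          sg (ζs j) * A.ω (p j).1 1 (p j).2 := fun j => omega_sg_smul hA (hS _ (hp j)) _ _
      simp only [h1, h2] at h0
      linarith
  have hmemS : (b'.1, sg b'.2 • kappa ζs p) ∈ S := by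
    have h1 := Set.mem_union_right (S : Set (Fin J × Wave d)) hmem
    rw [show (S : Set (Fin J × Wave d)) ∪ outRes A m S = S from hres] at h1
    exact h1
  refine hq (⟨_, hmemS⟩, b'.2) ?_ rfl
  change sg b'.2 • sg b'.2 • kappa ζs p = _
  rw [smul_smul, sg_mul_self, one_smul]

end Spectrum

/-! ### Truncated exponential weights -/

section ExpWeight

variable {d m : ℕ} {a K : ℝ}

/-- An exponential weight, truncated at the height `K`. -/
def expWeight (a K : ℝ) (η : Wave d) : ℝ := min (Real.exp (a * ‖η‖)) K

theorem one_le_expWeight (ha : 0 ≤ a) (hK : 1 ≤ K) (η : Wave d) : 1 ≤ expWeight a K η :=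
  le_min (Real.one_le_exp (by positivity)) hK

/-- Truncation at K ≥ 1 preserves submultiplicativity: if one factor is already K, the product
exceeds the cap. The cap keeps multiplication by the weight bounded on L¹. -/
theorem expWeight_add_le (ha : 0 ≤ a) (hK : 1 ≤ K) (η η' : Wave d) :
    expWeight a K (η + η') ≤ expWeight a K η * expWeight a K η' := by
  have h1 := one_le_expWeight ha hK η
  have h2 := one_le_expWeight ha hK η'
  have h3 : expWeight a K (η + η') ≤ K := min_le_right _ _
  by_cases h4 : expWeight a K η = K
  · rw [h4]
    exact h3.trans (le_mul_of_one_le_right (by linarith) h2)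
  by_cases h5 : expWeight a K η' = K
  · rw [h5]
    exact h3.trans (le_mul_of_one_le_left (by linarith) h1)
  have h6 : expWeight a K η = Real.exp (a * ‖η‖) := (min_choice _ _).resolve_right h4
  have h7 : expWeight a K η' = Real.exp (a * ‖η'‖) := (min_choice _ _).resolve_right h5
  rw [h6, h7, ← Real.exp_add, ← mul_add]
  refine (min_le_left _ _).trans ?_
  gcongr
  exact norm_add_le _ _

theorem isWeight_expWeight (ha : 0 ≤ a) (hK : 1 ≤ K) {r : ℝ} (hr : K ≤ Real.exp (a * r)) :
    IsWeight m (expWeight a K : Wave d → ℝ) r K⁻¹ where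
  measurable := by unfold expWeight; fun_prop
  one_le := one_le_expWeight ha hK
  bdd := ⟨K, fun η => min_le_right _ _⟩
  submul η := by
    induction (Finset.univ : Finset (Fin m)) using Finset.cons_induction with
    | empty => simp [expWeight]
    | cons j s hj ih =>
      rw [Finset.sum_cons, Finset.prod_cons]
      refine (expWeight_add_le ha hK _ _).trans ?_
      exact mul_le_mul_of_nonneg_left ih (by linarith [one_le_expWeight ha hK (η j)])
  tail η h := by
    refine inv_anti₀ (by linarith) (le_min (hr.trans ?_) le_rfl)
    gcongr

theorem expWeight_le {η : Wave d} (h : a * ‖η‖ ≤ 1) : expWeight a K η ≤ 3 :=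
  (min_le_left _ _).trans ((Real.exp_le_exp.2 h).trans Real.exp_one_lt_three.le)

/-- Small localization radii are admissible for the weights. -/
theorem eventually_rpow_le_exp {ε ε' s : ℝ} (hε : ε < ε') :
    ∀ᶠ β in 𝓝[>] (0 : ℝ), β ^ (-s) ≤ Real.exp (β ^ (-(1 - ε)) * β ^ (1 - ε')) := by
  have hδ : 0 < ε' - ε := by linarith
  -- With y = β^{-(ε'-ε)}, the product of the rate and the outer radius, this power of y is exactly
  -- β^{-s}.
  have h1 : ∀ᶠ y in atTop, y ^ (s / (ε' - ε)) ≤ Real.exp y := by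
    filter_upwards [(isLittleO_rpow_exp_atTop (s / (ε' - ε))).bound one_pos,
      eventually_ge_atTop 0] with y hy hy0
    simpa [abs_of_nonneg (Real.rpow_nonneg hy0 _)] using hy
  have h2 : Tendsto (fun β : ℝ => (β⁻¹) ^ (ε' - ε)) (𝓝[>] 0) atTop :=
    (tendsto_rpow_atTop hδ).comp tendsto_inv_nhdsGT_zero
  filter_upwards [h2.eventually h1, self_mem_nhdsWithin] with β h hβ
  have hβ : 0 < β := hβ
  rw [← Real.rpow_mul (by positivity), mul_div_cancel₀ _ hδ.ne', Real.inv_rpow hβ.le,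
    Real.inv_rpow hβ.le, ← Real.rpow_neg hβ.le, ← Real.rpow_neg hβ.le] at h
  rw [← Real.rpow_add hβ]
  convert h using 3
  ring

end ExpWeight

/-! ### Initial data and components of a packet family -/

/-- The spectrum of a function lies in a band, in the ball of radius `r` around `c`. -/
def IsLocalized {d J : ℕ} (A : LinearPart d J) (b : Fin J × ℤˣ) (c : Wave d) (r : ℝ)
    (f : Spec d J) : Prop :=
  ∀ᵐ k, f k = ballInd r (k - c) • A.bandProj b k (f k)

theorem IsBddMul.sub {d : ℕ} {Y Z : Type*} [NormedAddCommGroup Y] [NormedSpace ℂ Y]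
    [NormedAddCommGroup Z] [NormedSpace ℂ Z] {T T' : Wave d → Y →L[ℂ] Z} (hT : IsBddMul T)
    (hT' : IsBddMul T') : IsBddMul fun k => T k - T' k := by
  obtain ⟨C, hC⟩ := hT.bdd
  obtain ⟨C', hC'⟩ := hT'.bdd
  refine ⟨hT.aesm.sub hT'.aesm, C + C', ?_⟩
  filter_upwards [hC, hC'] with k h h'
  exact (norm_sub_le _ _).trans (add_le_add h h')

namespace PacketFamily

variable {d J m : ℕ} {A : LinearPart d J} {I : Type*} [Fintype I] (F : PacketFamily A m I)
  {W : Wave d → ℝ} {r θ : ℝ} [NeZero m]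

/-- The weighted components of a vector in balls of radius `r`. -/
def initMul (W : Wave d → ℝ) (r : ℝ) (k : Wave d) : Vec J →L[ℂ] PacketVec J I :=
  ∑ i, (ballInd r (k - F.c i) : ℂ) • F.outputMul W i k

theorem isBddMul_initMul (hA : A.Admissible) (hW : IsWeight m W r θ) (r' : ℝ) :
    IsBddMul (F.initMul W r') :=
  IsBddMul.sum _ fun i _ => (F.isBddMul_outputMul hA hW i).real_smul
    ((measurable_ballInd r').comp (F.measurable_sub_center i)) (B := 1) fun k => by
      rw [abs_of_nonneg (ballInd_nonneg _ _)]
      exact ballInd_le_one _ _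

theorem norm_initMul_le (hA : A.Admissible) (hW : IsWeight m W r θ) {r' B : ℝ}
    (hB : ∀ η, ‖η‖ ≤ r' → W η ≤ B) (hB0 : 0 ≤ B) {k : Wave d} (hk : k ∉ A.bandCrossing) :
    ‖F.initMul W r' k‖ ≤ B * (2 * J) := by
  refine ContinuousLinearMap.opNorm_le_bound _ (by positivity) fun x => ?_
  rw [initMul, _root_.sum_apply]
  have h : ∀ i, ‖((ballInd r' (k - F.c i) : ℂ) • F.outputMul W i k) x‖ ≤
      B * ballInd F.δ (k - F.c i) * ‖x‖ := by
    intro i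
    rw [outputMul, locProj, _root_.smul_apply, _root_.smul_apply, ContinuousLinearMap.comp_apply,
      _root_.smul_apply, map_smul, norm_smul, norm_smul, norm_smul, norm_packetInj,
      Complex.norm_real, Complex.norm_real, Complex.norm_real,
      Real.norm_of_nonneg (ballInd_nonneg _ _), Real.norm_of_nonneg (ballInd_nonneg _ _),
      Real.norm_of_nonneg (hW.pos _).le, ← mul_assoc, ← mul_assoc]
    have h1 : ballInd r' (k - F.c i) * W (k - F.c i) ≤ B := by
      rcases le_or_gt ‖k - F.c i‖ r' with h | h
      · rw [ballInd_of_le h, one_mul]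
        exact hB _ h
      · rw [ballInd_of_lt h, zero_mul]
        exact hB0
    have h2 : ‖A.bandProj (F.b i) k x‖ ≤ ‖x‖ := by
      simpa using (A.bandProj (F.b i) k).le_of_opNorm_le (norm_bandProj_le hA hk _) x
    have h3 := ballInd_nonneg F.δ (k - F.c i)
    gcongr
  refine (norm_sum_le _ _).trans ((Finset.sum_le_sum fun i _ => h i).trans ?_)
  rw [← Finset.sum_mul, ← Finset.mul_sum]
  have := F.sum_ballInd_le k
  gcongr

theorem collect_initMul (hA : A.Admissible) (hW : IsWeight m W r θ) {r' : ℝ} (hr : r' ≤ F.δ)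
    {k : Wave d} (hk : k ∉ A.bandCrossing) (x : Vec J) :
    F.collect W k (F.initMul W r' k x) =
      ∑ i, ballInd r' (k - F.c i) • A.bandProj (F.b i) k x := by
  rw [initMul, _root_.sum_apply, map_sum]
  refine Finset.sum_congr rfl fun i _ => ?_
  rw [_root_.smul_apply, map_smul, F.collect_outputMul hA hW hk, locProj, _root_.smul_apply,
    Complex.coe_smul, Complex.coe_smul]
  rcases le_or_gt ‖k - F.c i‖ r' with h | h
  · rw [ballInd_of_le h, ballInd_of_le (h.trans hr), one_smul, one_smul]
  · rw [ballInd_of_lt h, zero_smul, zero_smul]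

/-- Cross terms vanish: different bands are orthogonal, and packets of the same band have disjoint
balls. -/
theorem sum_localized (hA : A.Admissible) {r' : ℝ} (hr : r' ≤ F.δ) {k : Wave d}
    (hk : k ∉ A.bandCrossing) {y : I → Vec J}
    (hy : ∀ i, y i = ballInd r' (k - F.c i) • A.bandProj (F.b i) k (y i)) :
    ∑ i, ballInd r' (k - F.c i) • A.bandProj (F.b i) k (∑ i', y i') = ∑ i, y i := by
  classical
  refine Finset.sum_congr rfl fun i _ => ?_
  rw [map_sum, Finset.smul_sum, Finset.sum_eq_single i]
  · exact (hy i).symm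
  · intro i' _ hne
    rw [hy i', (A.bandProj (F.b i) k).map_smul_of_tower, bandProj_bandProj hA hk]
    split_ifs with hb
    · rcases le_or_gt ‖k - F.c i‖ r' with h | h
      · rcases le_or_gt ‖k - F.c i'‖ r' with h' | h'
        · exact absurd (F.inj _ _ (F.sep k i' i (h'.trans hr) (h.trans hr)) hb.symm) hne
        · rw [ballInd_of_lt h', zero_smul, smul_zero]
      · rw [ballInd_of_lt h, zero_smul]
    · rw [smul_zero, smul_zero]
  · simp

/-- The components are recovered from their sum by projections, so the weighted state is controlled
by the norm of the sum. The separate constants of the wavepackets thus do not enter the existence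
time. -/
theorem exists_initial (hA : A.Admissible) (hW : IsWeight m W r θ) {r' B : ℝ}
    (hr : r' ≤ F.δ) (hB : ∀ η, ‖η‖ ≤ r' → W η ≤ B) (hB0 : 0 ≤ B) {f : I → Spec d J}
    (hf : ∀ i, IsLocalized A (F.b i) (F.c i) r' (f i)) :
    ∃ x₀ : SpecOf d (PacketVec J I), ‖x₀‖ ≤ B * (2 * J) * ‖∑ i, f i‖ ∧
      mulOp (F.collect W) x₀ = ∑ i, f i := by
  refine ⟨mulOp (F.initMul W r') (∑ i, f i), norm_mulOp_le (F.isBddMul_initMul hA hW r') ?_ _, ?_⟩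
  · filter_upwards [ae_notMem_bandCrossing hA] with k hk using F.norm_initMul_le hA hW hB hB0 hk
  · have h1 := F.isBddMul_collect hA hW
    have h2 := F.isBddMul_initMul hA hW r'
    rw [mulOp_mulOp h1 h2]
    refine Lp.ext ?_
    filter_upwards [coeFn_mulOp (h1.comp h2) (∑ i, f i), Lp.coeFn_finsetSum Finset.univ f,
      ae_all_iff.2 hf, ae_notMem_bandCrossing hA] with k h3 h4 h5 hk
    rw [h3, ContinuousLinearMap.comp_apply, F.collect_initMul hA hW hr hk, h4,
      Finset.sum_apply, F.sum_localized hA hr hk h5]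

/-- The component of the solution in the ball of radius `r` of a packet. -/
def componentMul (W : Wave d → ℝ) (r t : ℝ) (i : I) (k : Wave d) : PacketVec J I →L[ℂ] Vec J :=
  (ballInd r (k - F.c i) : ℂ) • (A.flow t k ∘L F.inputMul W i k)

theorem isBddMul_componentMul (hA : A.Admissible) (hW : IsWeight m W r θ) (r' t : ℝ)
    (i : I) : IsBddMul (F.componentMul W r' t i) :=
  ((isBddMul_flow hA t).comp (F.isBddMul_inputMul hA hW i)).real_smul
    ((measurable_ballInd r').comp (F.measurable_sub_center i)) (B := 1) fun k => by
      rw [abs_of_nonneg (ballInd_nonneg _ _)]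
      exact ballInd_le_one _ _

theorem norm_flow_inputMul_le (hA : A.Admissible) (hW : IsWeight m W r θ) {k : Wave d}
    (hk : k ∉ A.bandCrossing) (t : ℝ) (i : I) (y : PacketVec J I) :
    ‖A.flow t k (F.inputMul W i k y)‖ ≤ (W (k - F.c i))⁻¹ * ‖y‖ := by
  have h1 := (A.flow t k).le_of_opNorm_le (norm_flow_le hA t k) (F.inputMul W i k y)
  have h2 := F.norm_inputMul_apply_le hA hW hk i y
  have h3 : ‖packetProj J i y‖ ≤ ‖y‖ := by
    rw [← sum_norm_packetProj y]
    exact Finset.single_le_sum (f := fun i => ‖packetProj J i y‖) (fun _ _ => norm_nonneg _)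
      (Finset.mem_univ i)
  rw [one_mul] at h1
  refine h1.trans (h2.trans ?_)
  have := inv_nonneg.2 (hW.pos (k - F.c i)).le
  gcongr

theorem norm_componentMul_le (hA : A.Admissible) (hW : IsWeight m W r θ) {k : Wave d}
    (hk : k ∉ A.bandCrossing) (r' t : ℝ) (i : I) : ‖F.componentMul W r' t i k‖ ≤ 1 := by
  refine ContinuousLinearMap.opNorm_le_bound _ zero_le_one fun y => ?_
  rw [componentMul, _root_.smul_apply, norm_smul, Complex.norm_real,
    Real.norm_of_nonneg (ballInd_nonneg _ _)]
  have h1 := F.norm_flow_inputMul_le hA hW hk t i y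
  have h2 : (W (k - F.c i))⁻¹ * ‖y‖ ≤ 1 * ‖y‖ := by
    have := hW.inv_le_one (k - F.c i)
    gcongr
  exact (mul_le_of_le_one_left (norm_nonneg _) (ballInd_le_one _ _)).trans (h1.trans h2)

theorem componentMul_localized (hA : A.Admissible) {k : Wave d} (hk : k ∉ A.bandCrossing)
    (r' t : ℝ) (i : I) (y : PacketVec J I) :
    F.componentMul W r' t i k y =
      ballInd r' (k - F.c i) • A.bandProj (F.b i) k (F.componentMul W r' t i k y) := by
  have h : A.bandProj (F.b i) k (A.flow t k (F.inputMul W i k y)) =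
      A.flow t k (F.inputMul W i k y) := by
    rw [inputMul, locProj, _root_.smul_apply, ContinuousLinearMap.comp_apply, _root_.smul_apply]
    simp only [map_smul]
    rw [flow_bandProj hA hk, map_smul, bandProj_bandProj hA hk, if_pos rfl]
  rw [componentMul, _root_.smul_apply, map_smul, ContinuousLinearMap.comp_apply, h,
    Complex.coe_smul, smul_smul, ballInd_mul_self]

/-- What is lost by shrinking the δ-balls to radius r carries an inverse weight at most θ: a bounded
weighted state becomes localization of the solution. -/
theorem norm_flow_collect_sub_le (hA : A.Admissible) (hW : IsWeight m W r θ) (hθ : 0 ≤ θ)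
    {k : Wave d} (hk : k ∉ A.bandCrossing) (t : ℝ) :
    ‖A.flow t k ∘L F.collect W k - ∑ i, F.componentMul W r t i k‖ ≤ Fintype.card I * θ := by
  refine ContinuousLinearMap.opNorm_le_bound _ (by positivity) fun y => ?_
  have h : (A.flow t k ∘L F.collect W k - ∑ i, F.componentMul W r t i k) y =
      ∑ i, (1 - ballInd r (k - F.c i)) • A.flow t k (F.inputMul W i k y) := by
    rw [_root_.sub_apply, ContinuousLinearMap.comp_apply, collect, _root_.sum_apply,
      _root_.sum_apply, map_sum, ← Finset.sum_sub_distrib]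
    refine Finset.sum_congr rfl fun i _ => ?_
    rw [componentMul, _root_.smul_apply, ContinuousLinearMap.comp_apply, sub_smul, one_smul,
      Complex.coe_smul]
  have h1 : ∀ i, ‖(1 - ballInd r (k - F.c i)) • A.flow t k (F.inputMul W i k y)‖ ≤ θ * ‖y‖ := by
    intro i
    rcases le_or_gt ‖k - F.c i‖ r with h | h
    · rw [ballInd_of_le h, sub_self, zero_smul, norm_zero]
      positivity
    · rw [ballInd_of_lt h, sub_zero, one_smul]
      refine (F.norm_flow_inputMul_le hA hW hk t i y).trans ?_
      have := hW.tail _ h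
      gcongr
  rw [h]
  refine (norm_sum_le _ _).trans ((Finset.sum_le_sum fun i _ => h1 i).trans (le_of_eq ?_))
  rw [Finset.sum_const, Finset.card_univ, nsmul_eq_mul, mul_assoc]

theorem exists_components (hA : A.Admissible) (hW : IsWeight m W r θ) (hθ : 0 ≤ θ)
    (t : ℝ) (x : SpecOf d (PacketVec J I)) :
    ∃ f : I → Spec d J, (∀ i, ‖f i‖ ≤ ‖x‖) ∧ (∀ i, IsLocalized A (F.b i) (F.c i) r (f i)) ∧
      ‖propagator A t (mulOp (F.collect W) x) - ∑ i, f i‖ ≤ Fintype.card I * θ * ‖x‖ := by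
  have hc := F.isBddMul_componentMul hA hW r t
  have hcol := F.isBddMul_collect hA hW
  have hfl := isBddMul_flow hA t
  refine ⟨fun i => mulOp (F.componentMul W r t i) x, fun i => ?_, fun i => ?_, ?_⟩
  · have h : ∀ᵐ k, ‖F.componentMul W r t i k‖ ≤ 1 := by
      filter_upwards [ae_notMem_bandCrossing hA] with k hk using
        F.norm_componentMul_le hA hW hk r t i
    simpa using norm_mulOp_le (hc i) h x
  · filter_upwards [coeFn_mulOp (hc i) x, ae_notMem_bandCrossing hA] with k h hk
    rw [h]
    exact F.componentMul_localized hA hk r t i _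
  · have hsum := IsBddMul.sum Finset.univ fun i _ => hc i
    have hD : IsBddMul fun k => A.flow t k ∘L F.collect W k - ∑ i, F.componentMul W r t i k :=
      (hfl.comp hcol).sub hsum
    have heq : propagator A t (mulOp (F.collect W) x) - ∑ i, mulOp (F.componentMul W r t i) x =
        mulOp (fun k => A.flow t k ∘L F.collect W k - ∑ i, F.componentMul W r t i k) x := by
      rw [propagator_eq hA, mulOp_mulOp hfl hcol]
      refine Lp.ext ?_
      filter_upwards [coeFn_mulOp hD x, coeFn_mulOp (hfl.comp hcol) x,
        Lp.coeFn_sub (mulOp (fun k => A.flow t k ∘L F.collect W k) x)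
          (∑ i, mulOp (F.componentMul W r t i) x),
        Lp.coeFn_finsetSum Finset.univ fun i => mulOp (F.componentMul W r t i) x,
        ae_all_iff.2 fun i => coeFn_mulOp (hc i) x] with k h1 h2 h3 h4 h5
      rw [h1, h3, Pi.sub_apply, h2, h4, Finset.sum_apply, _root_.sub_apply,
        _root_.sum_apply]
      simp only [h5]
    rw [heq]
    refine norm_mulOp_le hD ?_ x
    filter_upwards [ae_notMem_bandCrossing hA] with k hk using
      F.norm_flow_collect_sub_le hA hW hθ hk t

end PacketFamily

/-! ### Multi-wavepackets in terms of localized components -/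

section Wavepackets

variable {d J : ℕ} {A : LinearPart d J} {S : Finset (Fin J × Wave d)} {ε s : ℝ}
  {h : ℝ → Spec d J}

theorem cutoff_rpow_smul {β : ℝ} (hβ : 0 < β) (a : ℝ) (η : Wave d) :
    cutoff (β ^ (-a) • η) = ballInd (β ^ a) η := by
  have h1 : ‖β ^ (-a) • η‖ ≤ 1 ↔ ‖η‖ ≤ β ^ a := by
    rw [norm_smul, Real.norm_of_nonneg (Real.rpow_nonneg hβ.le _), Real.rpow_neg hβ.le,
      inv_mul_le_iff₀ (Real.rpow_pos_of_pos hβ _), mul_one]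
  simp only [cutoff, ballInd, h1]

theorem IsMultiWavepacket.exists_localized (hh : IsMultiWavepacket A ε s S h) :
    ∃ (f : PacketIndex S → ℝ → Spec d J) (K : ℝ), 0 ≤ K ∧ ∀ᶠ β in 𝓝[>] (0 : ℝ),
      (∀ i, IsLocalized A (packetBand i) (packetCenter i) (β ^ (1 - ε)) (f i β)) ∧
        ‖h β - ∑ i, f i β‖ ≤ K * β ^ s := by
  obtain ⟨hl, hw, β₁, hβ₁, hsum⟩ := hh
  choose β₀ hβ₀ hC hs D hdec hloc C' hC' hD using fun p : {p // p ∈ S} => hw p.1 p.2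
  refine ⟨fun i => hs i.1 i.2, ∑ p, C' p, Finset.sum_nonneg fun p _ => (hC' p).le, ?_⟩
  have hall : ∀ᶠ β in 𝓝[>] (0 : ℝ), ∀ p, β ∈ Ioo 0 (β₀ p) :=
    eventually_all.2 fun p => Ioo_mem_nhdsGT (hβ₀ p)
  filter_upwards [hall, Ioo_mem_nhdsGT hβ₁] with β h1 h2
  refine ⟨fun i => ?_, ?_⟩
  · filter_upwards [hloc i.1 β (h1 i.1) i.2] with k hk
    rw [cutoff_rpow_smul h2.1] at hk
    exact hk
  · have h3 : h β - ∑ i : PacketIndex S, hs i.1 i.2 β = ∑ p, D p β := by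
      rw [hsum β h2, ← Finset.sum_coe_sort S, Fintype.sum_prod_type, ← Finset.sum_sub_distrib]
      refine Finset.sum_congr rfl fun p _ => ?_
      rw [hdec p β (h1 p), UnitsInt.univ, Finset.sum_pair (by decide)]
      abel
    rw [h3, Finset.sum_mul]
    exact (norm_sum_le _ _).trans (Finset.sum_le_sum fun p _ => hD p β (h1 p))

/-- The components are chosen for each β separately, since no regularity in β is required of a
wavepacket. -/
theorem IsMultiWavepacket.of_localized (hs : 0 < s) (hS : S.Nonempty) {M K : ℝ} (hK : 0 ≤ K)
    (hf : ∀ᶠ β in 𝓝[>] (0 : ℝ), ∃ f : PacketIndex S → Spec d J, (∀ i, ‖f i‖ ≤ M) ∧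
      (∀ i, IsLocalized A (packetBand i) (packetCenter i) (β ^ (1 - ε)) (f i)) ∧
        ‖h β - ∑ i, f i‖ ≤ K * β ^ s) : IsMultiWavepacket A ε s S h := by
  classical
  obtain ⟨f, hf⟩ := hf.choice
  obtain ⟨β₀, hβ₀, hf⟩ := mem_nhdsGT_iff_exists_Ioo_subset.1 (hf.and (Ioo_mem_nhdsGT one_pos))
  obtain ⟨p₀, hp₀⟩ := hS
  let hs' : Fin J × Wave d → ℤˣ → ℝ → Spec d J := fun p ζ β =>
    if hp : p ∈ S then f β (⟨p, hp⟩, ζ) else 0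
  -- The whole remainder is assigned to one arbitrary pair, which is why the spectrum has to be
  -- nonempty.
  let D : Fin J × Wave d → ℝ → Spec d J := fun p β => if p = p₀ then h β - ∑ i, f β i else 0
  have hD : ∀ p, ∀ β ∈ Ioo 0 β₀, ‖D p β‖ ≤ (K + 1) * β ^ s := by
    intro p β hβ
    have h0 : 0 ≤ β ^ s := Real.rpow_nonneg hβ.1.le s
    by_cases hp : p = p₀
    · simp only [D, if_pos hp]
      refine (hf hβ).1.2.2.trans ?_
      gcongr
      linarith
    · simp only [D, if_neg hp, norm_zero]
      positivity
  refine ⟨fun p β => hs' p (-1) β + hs' p 1 β + D p β, fun p hp => ⟨β₀, hβ₀, ?_, ?_⟩, β₀, hβ₀, ?_⟩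
  · refine ⟨|M| + |M| + (K + 1), by positivity, fun β hβ => ?_⟩
    have h1 : ∀ ζ, ‖hs' p ζ β‖ ≤ |M| := fun ζ => by
      simp only [hs', dif_pos hp]
      exact ((hf hβ).1.1 _).trans (le_abs_self M)
    have h2 : ‖D p β‖ ≤ K + 1 := by
      refine (hD p β hβ).trans (mul_le_of_le_one_right (by linarith) ?_)
      exact Real.rpow_le_one hβ.1.le (hf hβ).2.2.le hs.le
    exact (norm_add_le _ _).trans (add_le_add ((norm_add_le _ _).trans
      (add_le_add (h1 _) (h1 _))) h2)
  · refine ⟨hs' p, D p, fun β _ => rfl, fun β hβ ζ => ?_, K + 1, by linarith, hD p⟩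
    simp only [hs', dif_pos hp]
    filter_upwards [(hf hβ).1.2.1 (⟨p, hp⟩, ζ)] with k hk
    rw [cutoff_rpow_smul hβ.1]
    exact hk
  · intro β hβ
    have h1 : ∑ p ∈ S, D p β = h β - ∑ i, f β i := by
      simp only [D, Finset.sum_ite_eq', if_pos hp₀]
    have h2 : ∑ p ∈ S, (hs' p (-1) β + hs' p 1 β) = ∑ i, f β i := by
      rw [← Finset.sum_coe_sort S, Fintype.sum_prod_type]
      refine Finset.sum_congr rfl fun p _ => ?_
      rw [UnitsInt.univ, Finset.sum_pair (by decide), add_comm]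
      simp only [hs', dif_pos p.2]
    rw [Finset.sum_add_distrib, h1, h2]
    abel

theorem isMultiWavepacket_empty (hh : ∀ᶠ β in 𝓝[>] (0 : ℝ), h β = 0) :
    IsMultiWavepacket A ε s ∅ h := by
  obtain ⟨β₀, hβ₀, hf⟩ := mem_nhdsGT_iff_exists_Ioo_subset.1 hh
  exact ⟨fun _ _ => 0, by simp, β₀, hβ₀, fun β hβ => by simpa using hf hβ⟩

end Wavepackets

/-! ### Persistence of wavepackets -/

section Persistence

variable {d J m : ℕ} [NeZero m] {A : LinearPart d J} {χ : Susceptibility d J m} {C : ℝ}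

theorem Susceptibility.Admissible.mono {C' : ℝ} (hχ : χ.Admissible A C) (h : C ≤ C') :
    χ.Admissible A C' :=
  ⟨hχ.smooth, fun k κ hk hκ => (hχ.bound k κ hk hκ).trans h⟩

theorem exists_bounded_slow (hA : A.Admissible) (hχ : χ.Admissible A C) (hC : 0 ≤ C)
    {R ρ T : ℝ} (hR : 0 ≤ R) (hρ : 0 ≤ ρ) (hT : 0 ≤ T) (hsmall : ρ * T * (C * (R + 1) ^ m) ≤ 1)
    {h : Spec d J} (hh : ‖h‖ ≤ R) :
    ∃ v : ℝ → Spec d J, ContinuousOn v (Icc 0 T) ∧ (∀ t ∈ Icc 0 T, ‖v t‖ ≤ R + 1) ∧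
      ∀ t ∈ Icc 0 T, v t =
        h + ρ • ∫ t' in (0 : ℝ)..t, kerOp (interactionKernel A χ t') fun _ => v t' := by
  obtain ⟨v, -, hv⟩ := (isPowerField_interaction hA hχ hC le_rfl).exists_solution hρ hT hR hsmall hh
  exact ⟨v, hv⟩

/-- The components of a solution with localized initial components. -/
theorem PacketFamily.exists_components_slow {I : Type*} [Fintype I] (F : PacketFamily A m I)
    (hA : A.Admissible) (hχ : χ.Admissible A C) (hC : 0 ≤ C) {R R' τ B : ℝ} (hR : 0 ≤ R)
    (hB : 0 ≤ B) (hR' : R ≤ R') (hBR : B * (2 * J) * (R + 1) ≤ R') (hτ : 0 ≤ τ)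
    (hsmall : τ * (C * (R' + 1) ^ m) ≤ 1) (hsmall' : τ * (2 * J * C * (R' + 1) ^ m) ≤ 1) :
    ∃ K : ℝ, 0 ≤ K ∧ ∀ (W : Wave d → ℝ) (r r' θ ρ T : ℝ), IsWeight m W r θ → r ≤ F.δ →
      r' ≤ F.δ → (∀ η, ‖η‖ ≤ r' → W η ≤ B) → 0 ≤ θ → 0 ≤ ρ → ρ ≤ 1 → 0 ≤ T → ρ * T ≤ τ →
      ∀ (h : Spec d J) (f : I → Spec d J), ‖h‖ ≤ R →
      (∀ i, IsLocalized A (F.b i) (F.c i) r' (f i)) → ‖h - ∑ i, f i‖ ≤ 1 →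
      ∀ v : ℝ → Spec d J, ContinuousOn v (Icc 0 T) →
      (∀ t ∈ Icc 0 T, v t =
        h + ρ • ∫ t' in (0 : ℝ)..t, kerOp (interactionKernel A χ t') fun _ => v t') →
      ∀ t ∈ Icc 0 T, ∃ g : I → Spec d J, (∀ i, ‖g i‖ ≤ R' + 1) ∧
        (∀ i, IsLocalized A (F.b i) (F.c i) r (g i)) ∧
        ‖propagator A t (v t) - ∑ i, g i‖ ≤ K * (ρ + θ + ‖h - ∑ i, f i‖) := by
  have hR0 : 0 ≤ R' := hR.trans hR'
  obtain ⟨Kc, hKc, happrox⟩ := F.exists_approx hA hχ hC hR0 hτ hsmall'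
  refine ⟨Kc + Fintype.card I * (R' + 1), by positivity, ?_⟩
  intro W r r' θ ρ T hW hr hr' hWB hθ hρ hρ1 hT hρT h f hh hf hhf v hv hvint t ht
  obtain ⟨x₀, hx₀, hcol⟩ := F.exists_initial hA hW hr' hWB hB hf
  have hx₀R : ‖x₀‖ ≤ R' := by
    refine hx₀.trans (le_trans ?_ hBR)
    gcongr
    calc ‖∑ i, f i‖ = ‖h - (h - ∑ i, f i)‖ := by rw [sub_sub_cancel]
      _ ≤ ‖h‖ + ‖h - ∑ i, f i‖ := norm_sub_le _ _
      _ ≤ R + 1 := add_le_add hh hhf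
  have hsm : ρ * T * (C * (R' + 1) ^ m) ≤ 1 := le_trans (by gcongr) hsmall
  -- The given solution has no a priori bound; by uniqueness it coincides with the bounded one built
  -- here.
  obtain ⟨w, hw, hwR, hwint⟩ := exists_bounded_slow hA hχ hC hR0 hρ hT hsm (hh.trans hR')
  have hvw : ∀ t ∈ Icc 0 T, v t = w t :=
    (isPowerField_interaction hA hχ hC le_rfl).eq_of_integral_eq hρ hv hw hvint hwint
  obtain ⟨x, hx⟩ := happrox W r θ ρ T hW hr hθ hρ hρ1 hT hρT h x₀ hx₀R v hv
    (fun t ht => (hvw t ht).symm ▸ hwR t ht) hvint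
  obtain ⟨hxR, hxa⟩ := hx t ht
  obtain ⟨g, hg, hgl, hga⟩ := F.exists_components hA hW hθ t (x t)
  refine ⟨g, fun i => (hg i).trans hxR, hgl, ?_⟩
  rw [hcol] at hxa
  have h1 : ‖propagator A t (v t) - propagator A t (mulOp (F.collect W) (x t))‖ ≤
      Kc * (ρ + θ + ‖h - ∑ i, f i‖) := by
    rw [← propagator_sub hA]
    exact (norm_propagator_le hA t _).trans hxa
  have h2 : Fintype.card I * θ * ‖x t‖ ≤
      Fintype.card I * (R' + 1) * (ρ + θ + ‖h - ∑ i, f i‖) := by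
    have h3 := norm_nonneg (h - ∑ i, f i)
    calc Fintype.card I * θ * ‖x t‖ ≤ Fintype.card I * θ * (R' + 1) := by gcongr
      _ = Fintype.card I * (R' + 1) * θ := by ring
      _ ≤ _ := by gcongr; linarith
  calc _ ≤ _ := norm_sub_le_norm_sub_add_norm_sub _ (propagator A t (mulOp (F.collect W) (x t))) _
    _ ≤ _ := add_le_add h1 (hga.trans h2)
    _ = _ := by ring

/-- Needed for the empty spectrum, where no packet can absorb a remainder and the solution must
vanish exactly. -/
theorem slow_eq_zero (hA : A.Admissible) (hχ : χ.Admissible A C) (hC : 0 ≤ C) {ρ T : ℝ}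
    (hρ : 0 ≤ ρ) {v : ℝ → Spec d J} (hv : ContinuousOn v (Icc 0 T))
    (hvint : ∀ t ∈ Icc 0 T, v t =
      0 + ρ • ∫ t' in (0 : ℝ)..t, kerOp (interactionKernel A χ t') fun _ => v t') :
    ∀ t ∈ Icc 0 T, v t = 0 := by
  refine (isPowerField_interaction hA hχ hC le_rfl).eq_of_integral_eq (x₀ := 0) (w := fun _ => 0)
    hρ hv continuousOn_const hvint fun t ht => ?_
  have h : ∀ t', (kerOp (interactionKernel A χ t') fun _ => (0 : Spec d J)) = 0 := fun t' =>
    (kerOp (interactionKernel A χ t')).map_zero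
  simp [h]

end Persistence

theorem tendsto_rpow_nhdsGT_zero {a : ℝ} (ha : 0 < a) :
    Tendsto (fun β : ℝ => β ^ a) (𝓝[>] 0) (𝓝 0) := by
  have h := (Real.continuousAt_rpow_const 0 a (Or.inr ha.le)).tendsto
  rw [Real.zero_rpow ha.ne'] at h
  exact h.mono_left nhdsWithin_le_nhds

/-- At small localization parameters the truncated exponential weight separates the radii
`β ^ (1 - ε)` and `β ^ (1 - ε')`. -/
theorem eventually_isWeight {d m : ℕ} {ε ε' s δ : ℝ} (hε : ε < ε') (hε' : ε' < 1) (hs : 0 < s)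
    (hδ : 0 < δ) : ∀ᶠ β in 𝓝[>] (0 : ℝ), ∃ W : Wave d → ℝ,
      IsWeight m W (β ^ (1 - ε')) (β ^ s) ∧ β ^ (1 - ε') ≤ δ ∧ β ^ (1 - ε) ≤ δ ∧
        ∀ η, ‖η‖ ≤ β ^ (1 - ε) → W η ≤ 3 := by
  have hsmall : ∀ a : ℝ, 0 < a → ∀ᶠ β in 𝓝[>] (0 : ℝ), β ^ a < δ := fun a ha =>
    (tendsto_rpow_nhdsGT_zero ha).eventually_lt_const hδ
  filter_upwards [eventually_rpow_le_exp (s := s) hε, hsmall (1 - ε') (by linarith),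
    hsmall (1 - ε) (by linarith), Ioo_mem_nhdsGT one_pos] with β h1 h2 h3 hβ
  have h4 : 1 ≤ β ^ (-s) := Real.one_le_rpow_of_pos_of_le_one_of_nonpos hβ.1 hβ.2.le (by linarith)
  -- Rate β^{-(1-ε)} and cap β^{-s}: the exponent is at most 1 on the inner ball, so the weight is
  -- below e < 3 there, and the cap is reached at the outer radius.
  have h5 := isWeight_expWeight (d := d) (m := m) (Real.rpow_nonneg hβ.1.le _) h4 h1
  rw [← Real.rpow_neg hβ.1.le (-s), neg_neg] at h5
  refine ⟨_, h5, h2.le, h3.le, fun η hη => expWeight_le ?_⟩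
  rw [Real.rpow_neg hβ.1.le, inv_mul_le_iff₀ (Real.rpow_pos_of_pos hβ.1 _), mul_one]
  exact hη

end

/-! ### Choice of the constants and conclusion -/

theorem corollary1 (d J m : ℕ) (hm : 2 ≤ m) (Cχ R : ℝ) :
    ∃ τstar > (0 : ℝ),
      ∀ (A : LinearPart d J) (χ : Susceptibility d J m), A.Admissible → χ.Admissible A Cχ →
      ∀ (S : Finset (Fin J × Wave d)),
        (∀ p ∈ S, p.2 ∉ A.bandCrossing) → outK m S ∩ A.bandCrossing = ∅ →
        ResonanceInvariant A m S →
      ∀ (ε s : ℝ), 0 < ε → ε < 1 → 0 < s →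
      ∀ (ρ : ℝ → ℝ) (C : ℝ), (∀ᶠ β in 𝓝[>] (0 : ℝ), 0 < ρ β ∧ ρ β ≤ C * β ^ s) →
      ∀ (h : ℝ → Spec d J), IsMultiWavepacket A ε s S h →
        (∀ᶠ β in 𝓝[>] (0 : ℝ), ‖h β‖ ≤ R) →
        -- F-solutions exist on the whole time interval
        (∀ᶠ β in 𝓝[>] (0 : ℝ), ∃ V Vhat,
          IsFSolution A χ (τstar / ρ β) (ρ β ^ (1 / ((m : ℝ) - 1)) • h β) V Vhat) ∧
        -- and every family of F-solutions remains a multi-wavepacket, at all times `t = t(β)`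
        ∀ (V : ℝ → ℝ → Wave d → Vec J) (Vhat : ℝ → ℝ → Spec d J),
          (∀ᶠ β in 𝓝[>] (0 : ℝ),
            IsFSolution A χ (τstar / ρ β) (ρ β ^ (1 / ((m : ℝ) - 1)) • h β) (V β) (Vhat β)) →
          ∀ t : ℝ → ℝ, (∀ᶠ β in 𝓝[>] (0 : ℝ), t β ∈ Icc 0 (τstar / ρ β)) →
          ∀ ε' : ℝ, ε < ε' → ε' < 1 →
            IsMultiWavepacket A ε' s S
              (fun β => ρ β ^ (-(1 / ((m : ℝ) - 1))) • Vhat β (t β)) := by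
  have : NeZero m := ⟨by omega⟩
  set R₀ : ℝ := max R 0
  set C₀ : ℝ := max Cχ 0
  have hR₀ : 0 ≤ R₀ := le_max_right _ _
  have hC₀ : 0 ≤ C₀ := le_max_right _ _
  -- This bounds both the initial data and the weighted initial packet state: weight at most 3 on
  -- the initial balls, at most 2J overlapping packets, and a sum of localized parts of norm at most
  -- R₀ + 1.
  set R₁ : ℝ := 3 * (2 * J) * (R₀ + 1) + R₀
  have hR₁ : R₀ ≤ R₁ := le_add_of_nonneg_left (by positivity)
  have hBR : 3 * (2 * J) * (R₀ + 1) ≤ R₁ := le_add_of_nonneg_right hR₀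
  have hR₁0 : 0 ≤ R₁ := hR₀.trans hR₁
  set Q : ℝ := C₀ * (R₁ + 1) ^ m
  have hQ : 0 ≤ Q := by positivity
  -- Small enough for the full equation (bound Q) and for the packet system (bound 2JQ) to stay
  -- within distance one of their data; the final + 1 covers Q = 0.
  set τ : ℝ := ((2 * J + 1) * Q + 1)⁻¹
  have hτ : 0 < τ := by positivity
  have hτ1 : τ * ((2 * J + 1) * Q + 1) = 1 := inv_mul_cancel₀ (by positivity)
  have hsmall : τ * (C₀ * (R₁ + 1) ^ m) ≤ 1 := by
    have h0 : 0 ≤ 2 * J * Q := by positivity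
    refine le_trans ?_ hτ1.le
    refine mul_le_mul_of_nonneg_left ?_ hτ.le
    change Q ≤ _
    linarith
  have hsmall' : τ * (2 * J * C₀ * (R₁ + 1) ^ m) ≤ 1 := by
    rw [mul_assoc _ C₀]
    refine le_trans ?_ hτ1.le
    refine mul_le_mul_of_nonneg_left ?_ hτ.le
    change 2 * J * Q ≤ _
    linarith
  refine ⟨τ, hτ, ?_⟩
  intro A χ hA hχ' S hS hout hres ε s hε hε1 hs ρ C hρ h hh hhR
  have hχ : χ.Admissible A C₀ := hχ'.mono (le_max_left _ _)
  have hγ : ∀ x : ℝ, 0 < x → (x ^ (1 / ((m : ℝ) - 1))) ^ m = x ^ (1 / ((m : ℝ) - 1)) * x := by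
    intro x hx
    have hm1 : (0 : ℝ) < (m : ℝ) - 1 := by
      have : (2 : ℝ) ≤ m := by exact_mod_cast hm
      linarith
    rw [← Real.rpow_natCast, ← Real.rpow_mul hx.le, ← Real.rpow_add_one hx.ne']
    congr 1
    field_simp
    ring
  have hhR₀ : ∀ᶠ β in 𝓝[>] (0 : ℝ), ‖h β‖ ≤ R₀ := hhR.mono fun β hβ => hβ.trans (le_max_left _ _)
  refine ⟨?_, ?_⟩
  · filter_upwards [hρ, hhR₀] with β hβ hhβ
    have hsm : ρ β * (τ / ρ β) * (C₀ * (R₁ + 1) ^ m) ≤ 1 := by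
      rwa [mul_div_cancel₀ _ hβ.1.ne']
    obtain ⟨v, hv, -, hvint⟩ := exists_bounded_slow hA hχ hC₀ hR₁0 hβ.1.le
      (div_pos hτ hβ.1).le hsm (hhβ.trans hR₁)
    exact exists_isFSolution hA hχ (hγ _ hβ.1) hv hvint
  · intro V Vhat hV t ht ε' hε' hε'1
    have hslow : ∀ᶠ β in 𝓝[>] (0 : ℝ), ∃ v : ℝ → Spec d J, ContinuousOn v (Icc 0 (τ / ρ β)) ∧
        ρ β ^ (-(1 / ((m : ℝ) - 1))) • Vhat β (t β) = propagator A (t β) (v (t β)) ∧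
        ∀ t ∈ Icc 0 (τ / ρ β), v t = h β +
          ρ β • ∫ t' in (0 : ℝ)..t, kerOp (interactionKernel A χ t') fun _ => v t' := by
      filter_upwards [hρ, hV, ht] with β hβ hVβ htβ
      obtain ⟨v, hv, hvV, hvint⟩ :=
        hVβ.exists_slow hA hχ (Real.rpow_pos_of_pos hβ.1 _) (hγ _ hβ.1)
      exact ⟨v, hv, by rw [Real.rpow_neg hβ.1.le]; exact hvV _ htβ, hvint⟩
    rcases S.eq_empty_or_nonempty with rfl | hSne
    · refine isMultiWavepacket_empty ?_
      obtain ⟨hl, -, β₀, hβ₀, hsum⟩ := hh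
      filter_upwards [hslow, hρ, ht, Ioo_mem_nhdsGT hβ₀] with β ⟨v, hv, hvV, hvint⟩ hβ htβ hβ0
      rw [hsum β hβ0, Finset.sum_empty] at hvint
      rw [hvV, slow_eq_zero hA hχ hC₀ hβ.1.le hv hvint _ htβ, LinearPart.propagator_eq hA, map_zero]
    obtain ⟨f, K, hK, hf⟩ := hh.exists_localized
    obtain ⟨F, hFc, hFb⟩ := hres.exists_packetFamily hA hS hout
    obtain ⟨K', hK', hcomp⟩ := F.exists_components_slow hA hχ hC₀ hR₀ (by norm_num : (0 : ℝ) ≤ 3)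
      hR₁ hBR hτ.le hsmall hsmall'
    have hpow : Tendsto (fun β : ℝ => β ^ s) (𝓝[>] 0) (𝓝 0) := tendsto_rpow_nhdsGT_zero hs
    have hρ1 : ∀ᶠ β in 𝓝[>] (0 : ℝ), C * β ^ s < 1 := by
      have := hpow.const_mul C
      rw [mul_zero] at this
      exact this.eventually_lt_const one_pos
    have hK1 : ∀ᶠ β in 𝓝[>] (0 : ℝ), K * β ^ s < 1 := by
      have := hpow.const_mul K
      rw [mul_zero] at this
      exact this.eventually_lt_const one_pos
    -- The three summands come from ρ ≤ Cβ^s, from θ = β^s and from the remainder of the initial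
    -- data.
    refine IsMultiWavepacket.of_localized (M := R₁ + 1) (K := K' * (|C| + 1 + K)) hs hSne
      (by positivity) ?_
    filter_upwards [hslow, hf, hρ, hρ1, hK1, hhR₀, ht, self_mem_nhdsWithin,
      eventually_isWeight (d := d) (m := m) hε' hε'1 hs F.δ_pos]
      with β ⟨v, hv, hvV, hvint⟩ hfβ hβ hρβ hKβ hhβ htβ hβ0 ⟨W, hW, hr, hr', hW3⟩
    have hβs : 0 ≤ β ^ s := Real.rpow_nonneg (le_of_lt hβ0) s
    obtain ⟨g, hg, hgl, hga⟩ := hcomp W _ _ _ (ρ β) (τ / ρ β) hW hr hr' hW3 hβs hβ.1.le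
      (hβ.2.trans hρβ.le) (div_pos hτ hβ.1).le (mul_div_cancel₀ _ hβ.1.ne').le (h β)
      (fun i => f i β) hhβ (by rw [hFb, hFc]; exact hfβ.1) (hfβ.2.trans hKβ.le) v hv hvint _ htβ
    rw [hFb, hFc] at hgl
    refine ⟨g, hg, hgl, ?_⟩
    rw [hvV]
    refine hga.trans ?_
    rw [mul_assoc]
    refine mul_le_mul_of_nonneg_left ?_ hK'
    have h1 : C * β ^ s ≤ |C| * β ^ s := mul_le_mul_of_nonneg_right (le_abs_self C) hβs
    linarith [hβ.2, hfβ.2]
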